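/- Notation. Let $n\ge 1$. Cubes $Q\subset\mathbb R^n$ have sides parallel to the axes. A weight is a measurable function on $\mathbb R^n$ with values in $(0,\infty)$ almost everywhere. For $1<r<\infty$ let $r'=r/(r-1)$, and for a weight $v$ put \[[v]_{A_r}=\sup_Q\Big(\frac1{|Q|}\int_Q v\Big)\Big(\frac1{|Q|}\int_Q v^{-r'/r}\Big)^{r/r'}.\] For $1<p<q<\infty$ and a weight $w$ put \[[w]_{A_{p,q}}=\sup_Q\Big(\frac1{|Q|}\int_Q w^{q}\Big)\Big(\frac1{|Q|}\int_Q w^{-p'}\Big)^{q/p'},\] and write $w\in A_{p,q}$ if $[w]_{A_{p,q}}<\infty$. For a weight $\eta$ and a real-valued locally integrable function $b$ put \[\|b\|_{\mathrm{BMO}_\eta}=\sup_Q\frac1{\eta(Q)}\int_Q|b-b_Q|,\qquad \eta(Q)=\int_Q\eta,\quad b_Q=\frac1{|Q|}\int_Q b,\] and write $b\in\mathrm{BMO}_\eta$ if this is finite. For $0<\alpha<n$ let \[I_\alpha f(x)=\int_{\mathbb R^n}\frac{f(y)}{|x-y|^{n-\alpha}}\,dy,\] and define iterated commutators by $(I_\alpha)_b^0=I_\alpha$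 and $(I_\alpha)_b^{k}f=b\,(I_\alpha)_b^{k-1}f-(I_\alpha)_b^{k-1}(bf)$ for $k\ge1$. Theorem. Let $0<\alpha<n$, $1<p<n/\alpha$, let $q$ be defined by $\frac1q+\frac\alpha n=\frac1p$, and let $m\ge1$ be an integer. There is a constant $c=c_{m,n,\alpha,p}$ such that the following holds for all $\mu,\lambda\in A_{p,q}$, with $\nu=\mu/\lambda$. If $b\in\mathrm{BMO}_{\nu^{1/m}}$, then $b\in L^m_{\mathrm{loc}}(\mathbb R^n)$ and, for every $f\in L^p(\mu^p)$, the integrals defining $I_\alpha(b^kf)(x)$, $0\le k\le m$, converge absolutely for almost every $x$, $(I_\alpha)_b^mf\in L^q(\lambda^q)$, and \[\|(I_\alpha)_b^mf\|_{L^q(\lambda^q)}\le c\,\|b\|_{\mathrm{BMO}_{\nu^{1/m}}}^m\,\kappa_m\,\|f\|_{L^p(\mu^p)},\] where \[\kappa_m=\sum_{h=0}^m\binom mh\Big([\lambda]_{A_{p,q}}^{\frac hm}[\mu]_{A_{p,q}}^{\frac{m-h}m}\Big)^{\left(1-\frac\alpha n\right)\max\{1,\frac{p'}q\}}P(m,h)\,Q(m,h),\]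 \[P(m,h)=\Big([\lambda^q]_{A_q}^{\frac{m+(h+1)}2}[\mu^q]_{A_q}^{\frac{m-(h+1)}2}\Big)^{\frac{m-h}m\max\{1,\frac1{q-1}\}},\] \[Q(m,h)=\Big([\lambda^p]_{A_p}^{\frac{h-1}2}[\mu^p]_{A_p}^{m-\frac{h-1}2}\Big)^{\frac hm\max\{1,\frac1{p-1}\}}.\] Conversely, let $\mu,\lambda\in A_{p,q}$, $\nu=\mu/\lambda$, and let $b\in L^m_{\mathrm{loc}}(\mathbb R^n)$ be real-valued. If there is a constant $C$ such that \[\|(I_\alpha)_b^m\chi_E\|_{L^q(\lambda^q)}\le C\,\mu^p(E)^{1/p},\qquad \mu^p(E)=\int_E\mu^p,\] for every measurable set $E$ of finite Lebesgue measure, then $b\in\mathrm{BMO}_{\nu^{1/m}}$. -/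

import Mathlib

open MeasureTheory
open scoped ENNReal NNReal

noncomputable section

/-- The space `ℝⁿ` with its Euclidean norm and Lebesgue measure. -/
abbrev Rn (n : ℕ) : Type := EuclideanSpace ℝ (Fin n)

/-- The (half-open) cube with sides parallel to the axes, lower corner `a` and side length `l`. -/
def cube {n : ℕ} (a : Rn n) (l : ℝ) : Set (Rn n) :=
  {x | ∀ i, a i ≤ x i ∧ x i < a i + l}

/-- The average `1/|Q| ∫_Q f` over the cube `Q = cube a l` of a function with values in `[0,∞]`. -/
def cubeAvg {n : ℕ} (a : Rn n) (l : ℝ) (f : Rn n → ℝ≥0∞) : ℝ≥0∞ :=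
  (∫⁻ x in cube a l, f x) / volume (cube a l)

/-- A weight: a measurable function which is positive (and finite) almost everywhere. Local
integrability is part of the Muckenhoupt conditions below. -/
structure IsWeight {n : ℕ} (w : Rn n → ℝ) : Prop where
  aemeasurable : AEMeasurable w volume
  pos : ∀ᵐ x ∂(volume : Measure (Rn n)), 0 < w x

/-- `[w]_{A_{p,q}} = sup_Q (1/|Q| ∫_Q w^q) (1/|Q| ∫_Q w^{-p'})^{q/p'}`, in `[0,∞]`. -/
def apqConst {n : ℕ} (p q : ℝ) (w : Rn n → ℝ) : ℝ≥0∞ :=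
  ⨆ (a : Rn n) (l : ℝ) (_ : 0 < l),
    cubeAvg a l (fun x => ENNReal.ofReal (w x ^ q)) *
      cubeAvg a l (fun x => ENNReal.ofReal (w x ^ (-p.conjExponent))) ^ (q / p.conjExponent)

/-- `[v]_{A_r} = sup_Q (1/|Q| ∫_Q v) (1/|Q| ∫_Q v^{-r'/r})^{r/r'}`, in `[0,∞]`. -/
def apConst {n : ℕ} (r : ℝ) (v : Rn n → ℝ) : ℝ≥0∞ :=
  ⨆ (a : Rn n) (l : ℝ) (_ : 0 < l),
    cubeAvg a l (fun x => ENNReal.ofReal (v x)) *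
      cubeAvg a l (fun x => ENNReal.ofReal (v x ^ (-(r.conjExponent / r)))) ^ (r / r.conjExponent)

/-- The class `A_{p,q}`. -/
structure MemApq {n : ℕ} (p q : ℝ) (w : Rn n → ℝ) : Prop where
  isWeight : IsWeight w
  const_lt_top : apqConst p q w < ∞

/-- `‖b‖_{BMO_η} = sup_Q 1/η(Q) ∫_Q |b - b_Q|`, in `[0,∞]`, where `η(Q) = ∫_Q η` and `b_Q` is the
mean of `b` over `Q`. -/
def bmoNorm {n : ℕ} (η b : Rn n → ℝ) : ℝ≥0∞ :=
  ⨆ (a : Rn n) (l : ℝ) (_ : 0 < l),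
    (∫⁻ x in cube a l, ENNReal.ofReal |b x - ⨍ y in cube a l, b y|) /
      ∫⁻ x in cube a l, ENNReal.ofReal (η x)

/-- The class `BMO_η`. -/
structure MemBMO {n : ℕ} (η b : Rn n → ℝ) : Prop where
  locallyIntegrable : LocallyIntegrable b volume
  norm_lt_top : bmoNorm η b < ∞

/-- The class `L^m_loc`. -/
structure MemLocPow {n : ℕ} (m : ℕ) (b : Rn n → ℝ) : Prop where
  aestronglyMeasurable : AEStronglyMeasurable b volume
  locallyIntegrable_pow : LocallyIntegrable (fun x => |b x| ^ m) volume

/-- The measure `w^r dx`. -/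
def powMeasure {n : ℕ} (w : Rn n → ℝ) (r : ℝ) : Measure (Rn n) :=
  volume.withDensity fun x => ENNReal.ofReal (w x ^ r)

section Operators

variable {n : ℕ} {F : Type*} [NormedAddCommGroup F] [NormedSpace ℝ F]

/-- The integrand `y ↦ f(y) / |x - y|^{n-α}` of the fractional integral at `x`. -/
def rieszIntegrand (α : ℝ) (f : Rn n → F) (x y : Rn n) : F :=
  (‖x - y‖ ^ ((n : ℝ) - α))⁻¹ • f y

/-- The fractional integral `I_α f(x) = ∫ f(y) / |x - y|^{n-α} dy`. -/
def rieszPotential (α : ℝ) (f : Rn n → F) (x : Rn n) : F :=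
  ∫ y, rieszIntegrand α f x y

/-- The commutator `[b, G] f = b G f - G (b f)`. -/
def bCommutator (b : Rn n → ℝ) (G : (Rn n → F) → Rn n → F) (f : Rn n → F) (x : Rn n) : F :=
  b x • G f x - G (fun y => b y • f y) x

/-- The iterated commutator: `G_b^0 = G` and `G_b^m = [b, G_b^{m-1}]`. -/
def iterCommutator (b : Rn n → ℝ) (G : (Rn n → F) → Rn n → F) : ℕ → (Rn n → F) → Rn n → F
  | 0 => G
  | m + 1 => bCommutator b (iterCommutator b G m)

end Operators

/-- The factor `P(m,h)`, in terms of `L = [λ^q]_{A_q}` and `M = [μ^q]_{A_q}`. -/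
def factorP (q : ℝ) (m h : ℕ) (L M : ℝ≥0∞) : ℝ≥0∞ :=
  (L ^ (((m : ℝ) + (h + 1)) / 2) * M ^ (((m : ℝ) - (h + 1)) / 2)) ^
    (((m : ℝ) - h) / m * max 1 (1 / (q - 1)))

/-- The factor `Q(m,h)`, in terms of `L = [λ^p]_{A_p}` and `M = [μ^p]_{A_p}`. -/
def factorQ (p : ℝ) (m h : ℕ) (L M : ℝ≥0∞) : ℝ≥0∞ :=
  (L ^ (((h : ℝ) - 1) / 2) * M ^ ((m : ℝ) - ((h : ℝ) - 1) / 2)) ^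
    ((h : ℝ) / m * max 1 (1 / (p - 1)))

/-- The quantity `κ_m` attached to the weights `μ` and `lam`. -/
def kappa {n : ℕ} (α p q : ℝ) (m : ℕ) (μ lam : Rn n → ℝ) : ℝ≥0∞ :=
  ∑ h ∈ Finset.range (m + 1), (m.choose h : ℝ≥0∞) *
    (apqConst p q lam ^ ((h : ℝ) / m) * apqConst p q μ ^ (((m : ℝ) - h) / m)) ^
      ((1 - α / n) * max 1 (p.conjExponent / q)) *
    factorP q m h (apConst q fun x => lam x ^ q) (apConst q fun x => μ x ^ q) *
    factorQ p m h (apConst p fun x => lam x ^ p) (apConst p fun x => μ x ^ p)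

/-- The weight `ν^{1/m}` with `ν = μ / lam`. -/
def bloomWeight {n : ℕ} (m : ℕ) (μ lam : Rn n → ℝ) (x : Rn n) : ℝ :=
  (μ x / lam x) ^ (1 / (m : ℝ))

end

/-!
The commutator is the integral operator with kernel `(b x - b y)^m |x - y|^{α-n}`, so both halves
are statements about this kernel.

*Sufficiency.* After taking absolute values, the kernel `|x - y|^{α-n}` is dominated, near the
diagonal and up to a constant, by sums over the cells of the `2^n` translates of a dyadic grid
by thirds of the side length (`lintegral_ball_rieszKernel_mul_le`), so it is enough to bound
`∑_Q |Q|^{α/n} χ_Q(x) ⨍_Q |b(x) - b|^m f` uniformly in the size of the largest cells. A stopping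
time argument (`Grid.tsum_mul_avg_le`) selects a sparse family `S` of cells and bounds this sum by
`∑_h (m choose h) ∑_{R ∈ S} |R|^{α/n} β_R(x)^{m-h} ⨍_R β_R^h f` with `β_R = |b - b_R|`, and the same
family controls `β_R(x)` by a sum over the cells of `S` between `x` and `R` of
`⨍_P |b - b_P| ≤ ‖b‖ η_P`, where `η = ν^{1/m}` and `η_P` is its mean over `P`. The `k`-th power of
such a chain sum is at most a constant times a `k`-fold iterate of `g ↦ η A g`, where
`A g = ∑_{P ∈ S} χ_P ⨍_P g`. The sum therefore splits into compositions of `A`, multiplications by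
`η`, and one sparse fractional operator. Each step is bounded by a one-weight inequality
(`NestedFamily.weightedNorm_iterate_le`), because multiplication by `η` carries the weight
`λ^{(m-j)/m} μ^{j/m}` to the next one; the Muckenhoupt constants of these intermediate weights are
log-convex in `j`, and the products of their bounds are exactly the factors of `κ_m`
(`prod_interpConst_rpow_eq_factorP`, `prod_interpConst_rpow_eq_factorQ`). The one-weight
inequality, with its sharp exponent `(1 - α/n) max(1, p'/q)`, is proved directly for sparse
families: the bilinear form is estimated by maximal functions on the disjoint parts `E_Q`, in one
range of the exponents after reduction to cells at which the average of one of the two functions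
reaches a new power of `2`.

*Necessity.* Let `c` be a median of `b` on a cube `Q`, let `E ⊆ Q` be the half where `b ≤ c` and let
`x ∈ Q` satisfy `b x ≥ c` (or both reversed). The integrand of the commutator of `χ_E` at `x` has a
constant sign, so that `|b x - c|^m |E|` is at most a constant times `|Q|^{1-α/n}` times the
commutator at `x` (`mul_volume_le_enorm_iterCommutator`). The hypothesis then bounds a weighted
`L^q` mean of `|b - c|^m` over `Q`. Hölder's inequality, the `A_{p,q}` conditions and the lower
bound for the mean of `ν^{1/m}` in `one_le_lintegral_rootRatio_mul` turn this into a bound for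
`⨍_Q |b - c|` by the mean of `ν^{1/m}`.

All estimates are made for functions with values in `[0,∞]`, for which no convergence question
arises; the absolute convergence of the commutator integrals is read off from them afterwards.
-/

/-! ### Inequalities in `[0,∞]` -/

theorem tsum_zpow_le_rpow {r : ℝ} (hr : 0 < r) : ∃ C : ℝ≥0∞, C ≠ ∞ ∧ ∀ u : ℝ≥0∞,
    ∑' k : ℤ, (if (2 : ℝ≥0∞) ^ (k : ℝ) ≤ u then (2 : ℝ≥0∞) ^ ((k : ℝ) * r) else 0) ≤ C * u ^ r := by
  have h2 : (2 : ℝ≥0∞) ^ (-r) < 1 := ENNReal.rpow_lt_one_of_one_lt_of_neg (by norm_num) (by linarith)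
  have hC : (1 - (2 : ℝ≥0∞) ^ (-r))⁻¹ ≠ ∞ := by
    simpa [tsub_eq_zero_iff_le] using h2
  have hC0 : (1 - (2 : ℝ≥0∞) ^ (-r))⁻¹ ≠ 0 :=
    ENNReal.inv_ne_zero.2 (ne_top_of_le_ne_top ENNReal.one_ne_top tsub_le_self)
  refine ⟨(1 - (2 : ℝ≥0∞) ^ (-r))⁻¹, hC, fun u => ?_⟩
  rcases eq_or_ne u 0 with rfl | hu0
  · have h (k : ℤ) : ¬ (2 : ℝ≥0∞) ^ (k : ℝ) ≤ 0 := by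
      rw [nonpos_iff_eq_zero, ENNReal.rpow_eq_zero_iff]; simp
    simp only [h, if_false, tsum_zero, zero_le]
  rcases eq_or_ne u ∞ with rfl | hut
  · simp [ENNReal.top_rpow_of_pos hr, ENNReal.mul_top hC0]
  obtain ⟨K, hK1, hK2⟩ := ENNReal.exists_mem_Ico_zpow hu0 hut (y := 2) (by norm_num) (by norm_num)
  rw [← ENNReal.rpow_intCast] at hK1 hK2
  have hinj : Function.Injective (fun j : ℕ => K - (j : ℤ)) := by
    intro i j h; simpa using h
  rw [← hinj.tsum_eq]
  · calc ∑' j : ℕ, (if (2 : ℝ≥0∞) ^ (((K - (j : ℤ) : ℤ)) : ℝ) ≤ u then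
            (2 : ℝ≥0∞) ^ ((((K - (j : ℤ) : ℤ)) : ℝ) * r) else 0)
        ≤ ∑' j : ℕ, (2 : ℝ≥0∞) ^ ((K : ℝ) * r) * ((2 : ℝ≥0∞) ^ (-r)) ^ j := by
          refine ENNReal.tsum_le_tsum fun j => ?_
          refine (ite_le_sup _ _ _).trans ?_
          rw [← ENNReal.rpow_natCast, ← ENNReal.rpow_mul,
            ← ENNReal.rpow_add _ _ (by norm_num) (by norm_num)]
          refine sup_le (le_of_eq ?_) zero_le
          congr 1; push_cast; ring
      _ = (1 - (2 : ℝ≥0∞) ^ (-r))⁻¹ * (2 : ℝ≥0∞) ^ ((K : ℝ) * r) := by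
          rw [ENNReal.tsum_mul_left, ENNReal.tsum_geometric, mul_comm]
      _ ≤ _ := by
          gcongr
          rw [ENNReal.rpow_mul]
          exact ENNReal.rpow_le_rpow hK1 hr.le
  · intro k hk
    rw [Function.mem_support] at hk
    have hk' : (2 : ℝ≥0∞) ^ (k : ℝ) ≤ u := by
      by_contra h; rw [if_neg h] at hk; exact hk rfl
    have hlt : (2 : ℝ≥0∞) ^ (k : ℝ) < 2 ^ ((K + 1 : ℤ) : ℝ) := hk'.trans_lt hK2
    have hkK : k ≤ K := by
      by_contra h
      push Not at h
      refine absurd hlt (not_lt.2 (ENNReal.rpow_le_rpow_of_exponent_le (by norm_num) ?_))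
      exact_mod_cast h
    exact ⟨(K - k).toNat, by simp [Int.toNat_of_nonneg (sub_nonneg.2 hkK)]⟩

theorem rpow_le_tsum_zpow {r : ℝ} (hr : 0 < r) (u : ℝ≥0∞) :
    u ^ r ≤ (2 : ℝ≥0∞) ^ r *
      ∑' k : ℤ, (if (2 : ℝ≥0∞) ^ (k : ℝ) < u then (2 : ℝ≥0∞) ^ ((k : ℝ) * r) else 0) := by
  rcases eq_or_ne u 0 with rfl | hu0
  · simp [hr]
  rcases eq_or_ne u ∞ with rfl | hut
  · have : ∑' k : ℤ, (if (2 : ℝ≥0∞) ^ (k : ℝ) < ∞ then (2 : ℝ≥0∞) ^ ((k : ℝ) * r) else 0) = ∞ := by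
      refine top_le_iff.1 ((ENNReal.tsum_const_eq_top_of_ne_zero (α := ℕ) (c := 1)
        one_ne_zero).symm.le.trans ?_)
      refine le_trans (ENNReal.tsum_le_tsum fun j => ?_)
        (ENNReal.tsum_comp_le_tsum_of_injective (f := Int.ofNat) Int.ofNat_injective _)
      have h : (2 : ℝ≥0∞) ^ (((j : ℕ) : ℤ) : ℝ) < ∞ := ENNReal.rpow_lt_top_of_nonneg (by positivity) (by norm_num)
      rw [Int.ofNat_eq_natCast, if_pos h]
      rw [← ENNReal.rpow_zero (x := 2)]
      exact ENNReal.rpow_le_rpow_of_exponent_le (by norm_num) (by positivity)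
    rw [this, ENNReal.mul_top (by simp)]
    exact le_top
  obtain ⟨K, hK1, hK2⟩ := ENNReal.exists_mem_Ioc_zpow hu0 hut (y := 2) (by norm_num) (by norm_num)
  rw [← ENNReal.rpow_intCast] at hK1 hK2
  calc u ^ r ≤ ((2 : ℝ≥0∞) ^ (((K + 1 : ℤ)) : ℝ)) ^ r := ENNReal.rpow_le_rpow hK2 hr.le
    _ = (2 : ℝ≥0∞) ^ r * (2 : ℝ≥0∞) ^ ((K : ℝ) * r) := by
        rw [← ENNReal.rpow_mul, ← ENNReal.rpow_add _ _ (by norm_num) (by norm_num)]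
        congr 1; push_cast; ring
    _ ≤ _ := by
        gcongr
        refine le_trans (le_of_eq ?_) (ENNReal.le_tsum K)
        rw [if_pos hK1]

theorem tsum_mul_le_rpow {J : Type*} {θ : ℝ} (h0 : 0 < θ) (h1 : θ < 1) (x y : J → ℝ≥0∞) :
    ∑' i, x i * y i ≤ (∑' i, x i ^ (1 / θ)) ^ θ * (∑' i, y i ^ (1 / (1 - θ))) ^ (1 - θ) := by
  let _ : MeasurableSpace J := ⊤
  have hpq : (1 / θ).HolderConjugate (1 / (1 - θ)) := by
    rw [Real.holderConjugate_iff]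
    exact ⟨by rw [lt_div_iff₀ h0]; linarith, by simp⟩
  have := ENNReal.lintegral_mul_le_Lp_mul_Lq (Measure.count : Measure J) hpq
    (f := x) (g := y) (measurable_from_top.aemeasurable) (measurable_from_top.aemeasurable)
  simpa [lintegral_count] using this

theorem lintegral_mul_le_rpow {X : Type*} [MeasurableSpace X] {μ : Measure X} {θ : ℝ} (h0 : 0 < θ)
    (h1 : θ < 1) {f g : X → ℝ≥0∞} (hf : AEMeasurable f μ) (hg : AEMeasurable g μ) :
    ∫⁻ x, f x * g x ∂μ ≤
      (∫⁻ x, f x ^ (1 / θ) ∂μ) ^ θ * (∫⁻ x, g x ^ (1 / (1 - θ)) ∂μ) ^ (1 - θ) := by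
  have hpq : (1 / θ).HolderConjugate (1 / (1 - θ)) := by
    rw [Real.holderConjugate_iff]
    exact ⟨by rw [lt_div_iff₀ h0]; linarith, by simp⟩
  simpa using ENNReal.lintegral_mul_le_Lp_mul_Lq μ hpq hf hg

/-! ### Nested families of cells -/

/-- A family of nonempty cells, each with a level: a cell that meets a cell of a level that is
no larger is contained in it, and distinct cells of the same level are disjoint. -/
structure NestedFamily (X J : Type*) [MeasurableSpace X] where
  /-- The cells of the family. -/
  cell : J → Set X
  /-- The level of a cell; cells of larger level are smaller. -/
  lev : J → ℕ
  measurableSet_cell : ∀ i, MeasurableSet (cell i)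
  nonempty_cell : ∀ i, (cell i).Nonempty
  nested : ∀ i j, lev i ≤ lev j → (cell i ∩ cell j).Nonempty → cell j ⊆ cell i
  eq_of_lev_eq : ∀ i j, lev i = lev j → (cell i ∩ cell j).Nonempty → i = j

namespace NestedFamily

variable {X J : Type*} [MeasurableSpace X] (N : NestedFamily X J)

/-- The cell `i` is contained in the cell `j`, which has a level that is no larger. -/
def Below (i j : J) : Prop := N.lev j ≤ N.lev i ∧ N.cell i ⊆ N.cell j

variable {N}

theorem Below.refl (i : J) : N.Below i i := ⟨le_rfl, subset_rfl⟩

theorem Below.trans {i j k : J} (h : N.Below i j) (h' : N.Below j k) : N.Below i k :=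
  ⟨h'.1.trans h.1, h.2.trans h'.2⟩

theorem Below.inter_nonempty {i j : J} (h : N.Below i j) : (N.cell i ∩ N.cell j).Nonempty := by
  rw [Set.inter_eq_left.2 h.2]; exact N.nonempty_cell i

theorem Below.eq_of_lev_le {i j : J} (h : N.Below i j) (h' : N.lev i ≤ N.lev j) : i = j :=
  N.eq_of_lev_eq i j (le_antisymm h' h.1) h.inter_nonempty

theorem below_or_below {i j : J} (h : (N.cell i ∩ N.cell j).Nonempty) :
    N.Below i j ∨ N.Below j i := by
  rcases le_total (N.lev i) (N.lev j) with hl | hl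
  · exact Or.inr ⟨hl, N.nested i j hl h⟩
  · exact Or.inl ⟨hl, N.nested j i hl (by rwa [Set.inter_comm])⟩

theorem below_or_below_of_mem {i j : J} {x : X} (hi : x ∈ N.cell i) (hj : x ∈ N.cell j) :
    N.Below i j ∨ N.Below j i := below_or_below ⟨x, hi, hj⟩

variable (N)

/-- The maximal cells among those in `A`. -/
def maximalCells (A : Set J) : Set J := {i ∈ A | ∀ j ∈ A, N.Below i j → j = i}

variable {N}

theorem exists_maximalCells_above {A : Set J} {i : J} (hi : i ∈ A) :
    ∃ j ∈ N.maximalCells A, N.Below i j := by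
  classical
  have hne : ∃ l, ∃ j ∈ A, N.Below i j ∧ N.lev j = l := ⟨_, i, hi, Below.refl i, rfl⟩
  obtain ⟨j, hjA, hij, hjl⟩ := Nat.find_spec hne
  refine ⟨j, ⟨hjA, fun k hk hjk => ?_⟩, hij⟩
  have : Nat.find hne ≤ N.lev k := Nat.find_min' hne ⟨k, hk, hij.trans hjk, rfl⟩
  exact (hjk.eq_of_lev_le (by omega)).symm

theorem pairwiseDisjoint_maximalCells (A : Set J) : (N.maximalCells A).PairwiseDisjoint N.cell := by
  intro i hi j hj hij
  by_contra h
  rw [Function.onFun, Set.not_disjoint_iff_nonempty_inter] at h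
  rcases below_or_below h with h | h
  · exact hij (hi.2 j hj.1 h).symm
  · exact hij (hj.2 i hi.1 h)

theorem biUnion_maximalCells (A : Set J) : ⋃ i ∈ N.maximalCells A, N.cell i = ⋃ i ∈ A, N.cell i := by
  apply subset_antisymm
  · exact Set.biUnion_subset_biUnion_left fun i hi => hi.1
  · intro x hx
    simp only [Set.mem_iUnion, exists_prop] at hx ⊢
    obtain ⟨i, hi, hx⟩ := hx
    obtain ⟨j, hj, hij⟩ := exists_maximalCells_above (N := N) hi
    exact ⟨j, hj, hij.2 hx⟩

/-- A comparison of two measures on the cells of `A` passes to the union of these cells. -/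
theorem mul_measure_biUnion_le [Countable J] {A : Set J} {μ σ : Measure X} {t : ℝ≥0∞}
    (h : ∀ i ∈ A, t * μ (N.cell i) ≤ σ (N.cell i)) :
    t * μ (⋃ i ∈ A, N.cell i) ≤ σ (⋃ i ∈ A, N.cell i) := by
  rw [← biUnion_maximalCells (N := N), measure_biUnion (Set.to_countable _) (pairwiseDisjoint_maximalCells A)
    (fun i _ => N.measurableSet_cell i),
    measure_biUnion (Set.to_countable _)
    (pairwiseDisjoint_maximalCells A) (fun i _ => N.measurableSet_cell i), ← ENNReal.tsum_mul_left]
  exact ENNReal.tsum_le_tsum fun i => h i i.2.1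

variable (N)

/-- The average of `f` over the cell `i` with respect to `σ`. -/
noncomputable def avg (σ : Measure X) (f : X → ℝ≥0∞) (i : J) : ℝ≥0∞ :=
  (∫⁻ x in N.cell i, f x ∂σ) / σ (N.cell i)

/-- The maximal function of the family with respect to `σ`. -/
noncomputable def maxFun (σ : Measure X) (f : X → ℝ≥0∞) (x : X) : ℝ≥0∞ :=
  ⨆ i, (N.cell i).indicator (fun _ => N.avg σ f i) x

/-- The largest average of `f` over a cell that contains the cell `i`. -/
noncomputable def supAvg (σ : Measure X) (f : X → ℝ≥0∞) (i : J) : ℝ≥0∞ :=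
  ⨆ (j) (_ : N.Below i j), N.avg σ f j

variable {N} {σ μ : Measure X} {f g : X → ℝ≥0∞}

theorem avg_le_maxFun {i : J} {x : X} (hx : x ∈ N.cell i) : N.avg σ f i ≤ N.maxFun σ f x := by
  refine le_trans (le_of_eq ?_) (le_iSup _ i)
  simp [hx]

theorem supAvg_le_maxFun {i : J} {x : X} (hx : x ∈ N.cell i) : N.supAvg σ f i ≤ N.maxFun σ f x :=
  iSup₂_le fun _ hj => avg_le_maxFun (hj.2 hx)

theorem avg_le_supAvg {i j : J} (h : N.Below i j) : N.avg σ f j ≤ N.supAvg σ f i :=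
  le_iSup₂ (f := fun j (_ : N.Below i j) => N.avg σ f j) j h

theorem measurable_maxFun [Countable J] : Measurable (N.maxFun σ f) :=
  Measurable.iSup fun i => measurable_const.indicator (N.measurableSet_cell i)

theorem lt_maxFun_set_eq (t : ℝ≥0∞) :
    {x | t < N.maxFun σ f x} = ⋃ i ∈ {i | t < N.avg σ f i}, N.cell i := by
  ext x
  simp only [maxFun, lt_iSup_iff, Set.mem_ofPred_eq, Set.mem_iUnion, exists_prop]
  refine exists_congr fun i => ?_
  by_cases hx : x ∈ N.cell i <;> simp [hx]

theorem mul_measure_lt_maxFun_le [Countable J] (t : ℝ≥0∞) :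
    t * σ {x | t < N.maxFun σ f x} ≤ ∫⁻ x, f x ∂σ := by
  rw [lt_maxFun_set_eq]
  have h := mul_measure_biUnion_le (N := N) (A := {i | t < N.avg σ f i}) (μ := σ) (σ := σ.withDensity f)
    (t := t) (fun i hi => by
      rw [withDensity_apply _ (N.measurableSet_cell i)]
      exact ENNReal.mul_le_of_le_div (le_of_lt hi))
  refine h.trans ((measure_mono (Set.subset_univ _)).trans ?_)
  rw [withDensity_apply _ MeasurableSet.univ, Measure.restrict_univ]

/-- Splitting `f` at height `t` improves the weak type inequality so that it can be integrated. -/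
theorem mul_measure_two_mul_lt_maxFun_le [Countable J] (hf : Measurable f) (t : ℝ≥0∞) :
    t * σ {x | 2 * t < N.maxFun σ f x} ≤ ∫⁻ x, {x | t ≤ f x}.indicator f x ∂σ := by
  have hs : MeasurableSet {x | t ≤ f x} := measurableSet_le measurable_const hf
  refine le_trans (mul_le_mul_right (measure_mono ?_) t)
    (mul_measure_lt_maxFun_le (N := N) (f := {x | t ≤ f x}.indicator f) t)
  intro x hx
  simp only [Set.mem_ofPred_eq, maxFun, lt_iSup_iff] at hx ⊢
  obtain ⟨i, hi⟩ := hx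
  refine ⟨i, ?_⟩
  by_cases hxi : x ∈ N.cell i
  · simp only [hxi, Set.indicator_of_mem] at hi ⊢
    have h1 : N.avg σ f i ≤ N.avg σ ({x | t ≤ f x}.indicator f) i + t := by
      have h2 : ∫⁻ x in N.cell i, f x ∂σ ≤
          ∫⁻ x in N.cell i, {x | t ≤ f x}.indicator f x ∂σ + t * σ (N.cell i) := by
        rw [← setLIntegral_const, ← lintegral_add_right _ measurable_const]
        refine lintegral_mono fun x => ?_
        by_cases hx : t ≤ f x
        · simp [hx]
        · simpa [hx] using (not_le.1 hx).le
      calc N.avg σ f i ≤ _ := ENNReal.div_le_div_right h2 _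
        _ = N.avg σ ({x | t ≤ f x}.indicator f) i + t * (σ (N.cell i) / σ (N.cell i)) := by
            rw [ENNReal.add_div, avg, mul_div_assoc]
        _ ≤ _ := by
            gcongr
            exact mul_le_of_le_one_right' ENNReal.div_self_le_one
    rw [two_mul] at hi
    exact lt_of_add_lt_add_right (hi.trans_le h1)
  · simp [hxi] at hi

/-- The maximal inequality on `L^p(σ)`, with a constant that does not depend on `σ`. -/
theorem lintegral_maxFun_rpow_le {p : ℝ} (hp : 1 < p) : ∃ C : ℝ≥0∞, C ≠ ∞ ∧
    ∀ {X J : Type*} [MeasurableSpace X] [Countable J] (N : NestedFamily X J) (σ : Measure X)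
      {f : X → ℝ≥0∞}, Measurable f →
    ∫⁻ x, N.maxFun σ f x ^ p ∂σ ≤ C * ∫⁻ x, f x ^ p ∂σ := by
  obtain ⟨C, hC, h⟩ := tsum_zpow_le_rpow (r := p - 1) (by linarith)
  refine ⟨2 ^ p * (2 ^ p * C), by
    refine ENNReal.mul_ne_top (by simp) (ENNReal.mul_ne_top (by simp) hC), ?_⟩
  intro X J _ _ N σ f hf
  have hmeas (k : ℝ) : MeasurableSet {x | (2 : ℝ≥0∞) ^ k < N.maxFun σ f x} :=
    measurableSet_lt measurable_const measurable_maxFun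
  have key (k : ℤ) : (2 : ℝ≥0∞) ^ ((k : ℝ) * p) * σ {x | (2 : ℝ≥0∞) ^ (k : ℝ) < N.maxFun σ f x} ≤
      ∫⁻ x, 2 ^ p * (f x * (if (2 : ℝ≥0∞) ^ (((k - 1 : ℤ)) : ℝ) ≤ f x then
        (2 : ℝ≥0∞) ^ ((((k - 1 : ℤ)) : ℝ) * (p - 1)) else 0)) ∂σ := by
    have h1 := mul_measure_two_mul_lt_maxFun_le (N := N) (σ := σ) hf
      ((2 : ℝ≥0∞) ^ (((k - 1 : ℤ)) : ℝ))
    have h2 : (2 : ℝ≥0∞) * 2 ^ (((k - 1 : ℤ)) : ℝ) = 2 ^ (k : ℝ) := by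
      conv_lhs => rw [← ENNReal.rpow_one 2, ← ENNReal.rpow_mul, ← ENNReal.rpow_add _ _ (by norm_num) (by norm_num)]
      congr 1; push_cast; ring
    rw [h2] at h1
    calc _ = 2 ^ p * (2 : ℝ≥0∞) ^ ((((k - 1 : ℤ)) : ℝ) * (p - 1)) * ((2 : ℝ≥0∞) ^ (((k - 1 : ℤ)) : ℝ) *
            σ {x | (2 : ℝ≥0∞) ^ (k : ℝ) < N.maxFun σ f x}) := by
          rw [← mul_assoc, ← ENNReal.rpow_add _ _ (by norm_num) (by norm_num),
            ← ENNReal.rpow_add _ _ (by norm_num) (by norm_num)]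
          congr 2; push_cast; ring
      _ ≤ 2 ^ p * (2 : ℝ≥0∞) ^ ((((k - 1 : ℤ)) : ℝ) * (p - 1)) *
            ∫⁻ x, {x | (2 : ℝ≥0∞) ^ (((k - 1 : ℤ)) : ℝ) ≤ f x}.indicator f x ∂σ := by gcongr
      _ = _ := by
          rw [← lintegral_const_mul _ (hf.indicator (measurableSet_le measurable_const hf))]
          refine lintegral_congr fun x => ?_
          by_cases hx : (2 : ℝ≥0∞) ^ (((k - 1 : ℤ)) : ℝ) ≤ f x
          · simp only [Set.indicator, Set.mem_ofPred_eq, hx, if_true]; ring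
          · simp only [Set.indicator, Set.mem_ofPred_eq, hx, if_false, mul_zero]
  calc ∫⁻ x, N.maxFun σ f x ^ p ∂σ
      ≤ ∫⁻ x, 2 ^ p * ∑' k : ℤ, {x | (2 : ℝ≥0∞) ^ (k : ℝ) < N.maxFun σ f x}.indicator
          (fun _ => (2 : ℝ≥0∞) ^ ((k : ℝ) * p)) x ∂σ :=
        lintegral_mono fun x => by
          simpa only [Set.indicator_apply, Set.mem_ofPred_eq] using
            rpow_le_tsum_zpow (r := p) (by linarith) (N.maxFun σ f x)
    _ = 2 ^ p * ∑' k : ℤ, (2 : ℝ≥0∞) ^ ((k : ℝ) * p) *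
          σ {x | (2 : ℝ≥0∞) ^ (k : ℝ) < N.maxFun σ f x} := by
        rw [lintegral_const_mul, lintegral_tsum]
        · congr 2; ext k
          rw [lintegral_indicator_const (hmeas k)]
        · exact fun k => (measurable_const.indicator (hmeas k)).aemeasurable
        · exact Measurable.tsum fun k => measurable_const.indicator (hmeas k)
    _ ≤ 2 ^ p * ∑' k : ℤ, ∫⁻ x, 2 ^ p * (f x * (if (2 : ℝ≥0∞) ^ (((k - 1 : ℤ)) : ℝ) ≤ f x then
        (2 : ℝ≥0∞) ^ ((((k - 1 : ℤ)) : ℝ) * (p - 1)) else 0)) ∂σ := by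
        gcongr with k; exact key k
    _ = 2 ^ p * ∫⁻ x, 2 ^ p * (f x * ∑' k : ℤ, (if (2 : ℝ≥0∞) ^ (k : ℝ) ≤ f x then
        (2 : ℝ≥0∞) ^ ((k : ℝ) * (p - 1)) else 0)) ∂σ := by
        rw [← lintegral_tsum]
        · congr 2; ext x
          rw [ENNReal.tsum_mul_left, ENNReal.tsum_mul_left]
          congr 2
          exact (Equiv.subRight (1 : ℤ)).tsum_eq (fun k : ℤ => (if (2 : ℝ≥0∞) ^ (k : ℝ) ≤ f x then
            (2 : ℝ≥0∞) ^ ((k : ℝ) * (p - 1)) else 0))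
        · intro k
          refine (measurable_const.mul (hf.mul (Measurable.ite ?_ measurable_const
            measurable_const))).aemeasurable
          exact measurableSet_le measurable_const hf
    _ ≤ 2 ^ p * ∫⁻ x, 2 ^ p * (C * f x ^ p) ∂σ := by
        refine mul_le_mul_right (lintegral_mono fun x => mul_le_mul_right ?_ _) _
        calc _ ≤ f x * (C * f x ^ (p - 1)) := by exact mul_le_mul_right (h _) _
          _ ≤ C * f x ^ p := by
            rw [mul_left_comm]
            gcongr
            rcases eq_or_ne (f x) ∞ with h | h
            · simp [h, ENNReal.top_rpow_of_pos (by linarith : 0 < p)]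
            rcases eq_or_ne (f x) 0 with h0 | h0
            · simp [h0]
            conv_lhs => rw [← ENNReal.rpow_one (f x), ← ENNReal.rpow_mul, ← ENNReal.rpow_add _ _ h0 h]
            rw [one_mul, add_sub_cancel]
    _ = _ := by
        rw [lintegral_const_mul _ (by fun_prop), lintegral_const_mul _ (by fun_prop)]; ring

end NestedFamily

/-! ### Embedding theorems for sparse families -/

namespace NestedFamily

/-- The sets `E i ⊆ cell i` are pairwise disjoint and take up at least half of the cells. -/
structure IsSparse {X J : Type*} [MeasurableSpace X] (N : NestedFamily X J) (μ : Measure X)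
    (E : J → Set X) : Prop where
  measurableSet : ∀ i, MeasurableSet (E i)
  subset : ∀ i, E i ⊆ N.cell i
  disjoint : Pairwise (Function.onFun Disjoint E)
  le : ∀ i, μ (N.cell i) ≤ 2 * μ (E i)

theorem tsum_supAvg_rpow_le {p : ℝ} (hp : 1 < p) : ∃ C : ℝ≥0∞, C ≠ ∞ ∧
    ∀ {X J : Type*} [MeasurableSpace X] [Countable J] {N : NestedFamily X J} {μ : Measure X}
      {E : J → Set X} (_ : N.IsSparse μ E) (σ : Measure X) {f : X → ℝ≥0∞}, Measurable f →
    ∑' i, N.supAvg σ f i ^ p * σ (E i) ≤ C * ∫⁻ x, f x ^ p ∂σ := by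
  obtain ⟨C, hC, h⟩ := lintegral_maxFun_rpow_le hp
  refine ⟨C, hC, fun {X J} _ _ {N μ E} hE σ {f} hf => le_trans ?_ (h N σ hf)⟩
  calc ∑' i, N.supAvg σ f i ^ p * σ (E i) ≤ ∑' i, ∫⁻ x in E i, N.maxFun σ f x ^ p ∂σ := by
        refine ENNReal.tsum_le_tsum fun i => ?_
        rw [← setLIntegral_const]
        refine setLIntegral_mono (measurable_maxFun.pow_const p) fun x hx => ?_
        exact ENNReal.rpow_le_rpow (supAvg_le_maxFun (hE.subset i hx)) (by linarith)
    _ = ∫⁻ x in ⋃ i, E i, N.maxFun σ f x ^ p ∂σ :=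
        (lintegral_iUnion hE.measurableSet hE.disjoint _).symm
    _ ≤ _ := setLIntegral_le_lintegral _ _

theorem measure_rpow_mul_avg_le {X J : Type*} [MeasurableSpace X] {N : NestedFamily X J}
    {σ : Measure X} {f : X → ℝ≥0∞} (hf : Measurable f) {P : ℝ} (h0 : 0 < P) (h1 : P < 1) {i : J}
    (hi0 : σ (N.cell i) ≠ 0) (hi1 : σ (N.cell i) ≠ ∞) :
    σ (N.cell i) ^ P * N.avg σ f i ≤ (∫⁻ x, f x ^ (1 / P) ∂σ) ^ P := by
  have h := lintegral_mul_le_rpow (μ := σ.restrict (N.cell i)) h0 h1 hf.aemeasurable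
    (aemeasurable_const (b := 1))
  simp only [mul_one, ENNReal.one_rpow, lintegral_const, Measure.restrict_apply, MeasurableSet.univ,
    Set.univ_inter, one_mul] at h
  calc σ (N.cell i) ^ P * N.avg σ f i
      ≤ σ (N.cell i) ^ P * (((∫⁻ x in N.cell i, f x ^ (1 / P) ∂σ) ^ P * σ (N.cell i) ^ (1 - P)) *
          σ (N.cell i) ^ (-1 : ℝ)) := by
        rw [avg, div_eq_mul_inv, ENNReal.rpow_neg_one]; gcongr
    _ = (∫⁻ x in N.cell i, f x ^ (1 / P) ∂σ) ^ P *
          (σ (N.cell i) ^ P * σ (N.cell i) ^ (1 - P) * σ (N.cell i) ^ (-1 : ℝ)) := by ring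
    _ = (∫⁻ x in N.cell i, f x ^ (1 / P) ∂σ) ^ P := by
        rw [← ENNReal.rpow_add _ _ hi0 hi1, ← ENNReal.rpow_add _ _ hi0 hi1]; simp
    _ ≤ _ := ENNReal.rpow_le_rpow (setLIntegral_le_lintegral _ _) h0.le

theorem measure_rpow_mul_supAvg_le {X J : Type*} [MeasurableSpace X] {N : NestedFamily X J}
    {σ : Measure X} {f : X → ℝ≥0∞} (hf : Measurable f) {P : ℝ} (h0 : 0 < P) (h1 : P < 1) (i : J)
    (hi0 : ∀ i, σ (N.cell i) ≠ 0) (hi1 : ∀ i, σ (N.cell i) ≠ ∞) :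
    σ (N.cell i) ^ P * N.supAvg σ f i ≤ (∫⁻ x, f x ^ (1 / P) ∂σ) ^ P := by
  rw [supAvg, ENNReal.mul_iSup]
  refine iSup_le fun j => ?_
  rw [ENNReal.mul_iSup]
  refine iSup_le fun hj => le_trans ?_ (measure_rpow_mul_avg_le hf h0 h1 (hi0 j) (hi1 j))
  gcongr
  exact hj.2

/-- A fractional embedding: the diagonal embedding interpolated with Hölder's inequality. -/
theorem tsum_fractional_supAvg_le {P β : ℝ} (h1 : P < 1) (hβ : 0 ≤ β) (hβP : β < P) :
    ∃ C : ℝ≥0∞, C ≠ ∞ ∧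
    ∀ {X J : Type*} [MeasurableSpace X] [Countable J] {N : NestedFamily X J} {μ : Measure X}
      {E : J → Set X} (_ : N.IsSparse μ E) (σ : Measure X) {f : X → ℝ≥0∞}, Measurable f →
      (∀ i, σ (N.cell i) ≠ 0) → (∀ i, σ (N.cell i) ≠ ∞) →
    (∑' i, (σ (N.cell i) ^ β * N.supAvg σ f i) ^ (1 / (P - β)) * σ (E i)) ^ (P - β) ≤
      C * (∫⁻ x, f x ^ (1 / P) ∂σ) ^ P := by
  have h0 : 0 < P := hβ.trans_lt hβP
  have hτ : 0 < P - β := by linarith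
  obtain ⟨C, hC, h⟩ := tsum_supAvg_rpow_le (p := 1 / P) (by rw [lt_div_iff₀ h0]; linarith)
  refine ⟨C ^ (P - β), by finiteness, fun {X J} _ _ {N μ E} hE σ {f} hf hi0 hi1 => ?_⟩
  set F := ∫⁻ x, f x ^ (1 / P) ∂σ with hF
  have key (i : J) : (σ (N.cell i) ^ β * N.supAvg σ f i) ^ (1 / (P - β)) ≤
      F ^ (β / (P - β)) * N.supAvg σ f i ^ (1 / P) := by
    have h2 := measure_rpow_mul_supAvg_le hf h0 h1 i hi0 hi1
    have h3 : σ (N.cell i) ^ β * N.supAvg σ f i =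
        (σ (N.cell i) ^ P * N.supAvg σ f i) ^ (β / P) * N.supAvg σ f i ^ ((P - β) / P) := by
      rw [ENNReal.mul_rpow_of_nonneg _ _ (by positivity), ← ENNReal.rpow_mul, mul_assoc,
        ← ENNReal.rpow_add_of_nonneg _ _ (by positivity) (by positivity)]
      congr 2
      · field_simp
      · rw [← add_div, add_sub_cancel, div_self h0.ne', ENNReal.rpow_one]
    calc _ = (σ (N.cell i) ^ P * N.supAvg σ f i) ^ (β / P * (1 / (P - β))) *
          N.supAvg σ f i ^ ((P - β) / P * (1 / (P - β))) := by
          rw [h3, ENNReal.mul_rpow_of_nonneg _ _ (by positivity), ← ENNReal.rpow_mul,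
            ← ENNReal.rpow_mul]
      _ ≤ (F ^ P) ^ (β / P * (1 / (P - β))) * N.supAvg σ f i ^ (1 / P) := by
          gcongr ?_ * ?_
          · exact ENNReal.rpow_le_rpow h2 (by positivity)
          · exact le_of_eq (by congr 1; field_simp)
      _ = _ := by
          rw [← ENNReal.rpow_mul]; congr 2; field_simp
  calc _ ≤ (∑' i, F ^ (β / (P - β)) * (N.supAvg σ f i ^ (1 / P) * σ (E i))) ^ (P - β) := by
        refine ENNReal.rpow_le_rpow (ENNReal.tsum_le_tsum fun i => ?_) hτ.le
        rw [← mul_assoc]; gcongr; exact key i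
    _ ≤ (F ^ (β / (P - β)) * (C * F)) ^ (P - β) := by
        rw [ENNReal.tsum_mul_left]
        exact ENNReal.rpow_le_rpow (mul_le_mul_right (h hE σ hf) _) hτ.le
    _ = C ^ (P - β) * (F ^ β * F ^ (P - β)) := by
        rw [ENNReal.mul_rpow_of_nonneg _ _ hτ.le, ENNReal.mul_rpow_of_nonneg _ _ hτ.le,
          ← ENNReal.rpow_mul, div_mul_cancel₀ _ hτ.ne']
        ring
    _ = _ := by
        rw [← ENNReal.rpow_add_of_nonneg _ _ hβ hτ.le, add_sub_cancel]

section Records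

variable {X J : Type*} [MeasurableSpace X] (N : NestedFamily X J)

/-- The cells maximal subject to the average of `f` exceeding `2 ^ k`. -/
def recordsAt (σ : Measure X) (f : X → ℝ≥0∞) (k : ℤ) : Set J :=
  N.maximalCells {i | (2 : ℝ≥0∞) ^ (k : ℝ) < N.avg σ f i}

/-- The cells on which the average of `f` is, up to a factor `2`, a record among all larger
cells. -/
def records (σ : Measure X) (f : X → ℝ≥0∞) : Set J := ⋃ k : ℤ, N.recordsAt σ f k

variable {N}

theorem exists_record_above {σ : Measure X} {f : X → ℝ≥0∞} {i : J} (h0 : N.avg σ f i ≠ 0)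
    (h1 : N.avg σ f i ≠ ∞) :
    ∃ j ∈ N.records σ f, N.Below i j ∧ N.avg σ f i ≤ 2 * N.avg σ f j := by
  obtain ⟨K, hK1, hK2⟩ := ENNReal.exists_mem_Ioc_zpow h0 h1 (y := 2) (by norm_num) (by norm_num)
  rw [← ENNReal.rpow_intCast] at hK1 hK2
  obtain ⟨j, hj, hij⟩ := exists_maximalCells_above (N := N)
    (A := {i | (2 : ℝ≥0∞) ^ (K : ℝ) < N.avg σ f i}) hK1
  refine ⟨j, Set.mem_iUnion.2 ⟨K, hj⟩, hij, hK2.trans ?_⟩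
  have : (2 : ℝ≥0∞) ^ ((K + 1 : ℤ) : ℝ) = 2 * 2 ^ (K : ℝ) := by
    push_cast
    rw [ENNReal.rpow_add _ _ (by norm_num) (by norm_num), ENNReal.rpow_one, mul_comm]
  rw [this]
  gcongr
  exact hj.1.le

/-- The records satisfy the embedding with the full measure of the cells, since the averages grow
geometrically along chains of records. -/
theorem tsum_records_avg_rpow_le {p : ℝ} (hp : 1 < p) : ∃ C : ℝ≥0∞, C ≠ ∞ ∧
    ∀ {X J : Type*} [MeasurableSpace X] [Countable J] (N : NestedFamily X J) (σ : Measure X)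
      {f : X → ℝ≥0∞}, Measurable f → (∀ i, N.avg σ f i ≠ ∞) →
    ∑' i, (N.records σ f).indicator (fun i => N.avg σ f i ^ p * σ (N.cell i)) i ≤
      C * ∫⁻ x, f x ^ p ∂σ := by
  obtain ⟨C, hC, h⟩ := lintegral_maxFun_rpow_le hp
  obtain ⟨C', hC', h'⟩ := tsum_zpow_le_rpow (r := p) (by linarith)
  refine ⟨2 ^ p * C' * C, by finiteness, fun {X J} _ _ N σ {f} hf hfin => ?_⟩
  have key (i : J) : (N.records σ f).indicator (fun i => N.avg σ f i ^ p * σ (N.cell i)) i ≤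
      ∑' k : ℤ, 2 ^ p * 2 ^ ((k : ℝ) * p) *
        (N.recordsAt σ f k).indicator (fun i => σ (N.cell i)) i := by
    by_cases hi : i ∈ N.records σ f
    · obtain ⟨k, hk⟩ := Set.mem_iUnion.1 hi
      rw [Set.indicator_of_mem hi]
      have h0 : N.avg σ f i ≠ 0 := (bot_le.trans_lt hk.1).ne'
      obtain ⟨K, hK1, hK2⟩ := ENNReal.exists_mem_Ioc_zpow h0 (hfin i) (y := 2) (by norm_num)
        (by norm_num)
      rw [← ENNReal.rpow_intCast] at hK1 hK2
      have hkK : k ≤ K := by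
        by_contra hlt
        push Not at hlt
        refine absurd (hk.1.trans_le hK2) (not_lt.2 (ENNReal.rpow_le_rpow_of_exponent_le
          (by norm_num) ?_))
        exact_mod_cast hlt
      have hiK : i ∈ N.recordsAt σ f K := by
        refine ⟨hK1, fun j hj hij => hk.2 j ?_ hij⟩
        refine Set.mem_ofPred_eq.mpr (lt_of_le_of_lt ?_ hj)
        exact ENNReal.rpow_le_rpow_of_exponent_le (by norm_num) (by exact_mod_cast hkK)
      refine le_trans ?_ (ENNReal.le_tsum K)
      rw [Set.indicator_of_mem hiK]
      gcongr
      refine (ENNReal.rpow_le_rpow hK2 (by linarith)).trans (le_of_eq ?_)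
      rw [← ENNReal.rpow_mul, ← ENNReal.rpow_add _ _ (by norm_num) (by norm_num)]
      congr 1; push_cast; ring
    · rw [Set.indicator_of_notMem hi]; exact zero_le
  have hlev (k : ℤ) : ∑' i, (N.recordsAt σ f k).indicator (fun i => σ (N.cell i)) i ≤
      σ {x | (2 : ℝ≥0∞) ^ (k : ℝ) < N.maxFun σ f x} := by
    rw [← tsum_subtype, lt_maxFun_set_eq, ← biUnion_maximalCells,
      measure_biUnion (Set.to_countable _) (pairwiseDisjoint_maximalCells _)
      (fun i _ => N.measurableSet_cell i)]
    rfl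
  have hmeas (k : ℤ) : MeasurableSet {x | (2 : ℝ≥0∞) ^ (k : ℝ) < N.maxFun σ f x} :=
    measurableSet_lt measurable_const measurable_maxFun
  calc _ ≤ ∑' i, ∑' k : ℤ, 2 ^ p * 2 ^ ((k : ℝ) * p) *
        (N.recordsAt σ f k).indicator (fun i => σ (N.cell i)) i := ENNReal.tsum_le_tsum key
    _ = ∑' k : ℤ, 2 ^ p * 2 ^ ((k : ℝ) * p) *
        ∑' i, (N.recordsAt σ f k).indicator (fun i => σ (N.cell i)) i := by
        rw [ENNReal.tsum_comm]; simp_rw [ENNReal.tsum_mul_left]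
    _ ≤ ∑' k : ℤ, 2 ^ p * 2 ^ ((k : ℝ) * p) *
        σ {x | (2 : ℝ≥0∞) ^ (k : ℝ) < N.maxFun σ f x} :=
        ENNReal.tsum_le_tsum fun k => mul_le_mul_right (hlev k) _
    _ = ∫⁻ x, 2 ^ p * ∑' k : ℤ, {x | (2 : ℝ≥0∞) ^ (k : ℝ) < N.maxFun σ f x}.indicator
          (fun _ => (2 : ℝ≥0∞) ^ ((k : ℝ) * p)) x ∂σ := by
        rw [lintegral_const_mul, lintegral_tsum, ← ENNReal.tsum_mul_left]
        · congr 1; ext k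
          rw [lintegral_indicator_const (hmeas k), mul_assoc]
        · exact fun k => (measurable_const.indicator (hmeas k)).aemeasurable
        · exact Measurable.tsum fun k => measurable_const.indicator (hmeas k)
    _ ≤ ∫⁻ x, 2 ^ p * (C' * N.maxFun σ f x ^ p) ∂σ := by
        refine lintegral_mono fun x => mul_le_mul_right (le_trans ?_ (h' (N.maxFun σ f x))) _
        refine ENNReal.tsum_le_tsum fun k => ?_
        simp only [Set.indicator_apply, Set.mem_ofPred_eq]
        split_ifs with h1 h2
        · exact le_rfl
        · exact absurd h1.le h2
        · exact zero_le
        · exact le_rfl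
    _ = 2 ^ p * C' * ∫⁻ x, N.maxFun σ f x ^ p ∂σ := by
        simp_rw [← mul_assoc]
        rw [lintegral_const_mul _ (measurable_maxFun.pow_const p)]
    _ ≤ _ := by
        rw [mul_assoc _ C]; gcongr; exact h N σ hf

end Records

/-- A Kolmogorov type inequality: the sum is dominated by its top term. -/
theorem tsum_below_le {δ : ℝ} (h0 : 0 < δ) (h1 : δ < 1) : ∃ C : ℝ≥0∞, C ≠ ∞ ∧
    ∀ {X J : Type*} [MeasurableSpace X] [Countable J] {N : NestedFamily X J} {μ : Measure X}
      {E : J → Set X} (_ : N.IsSparse μ E) (σ : Measure X),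
      (∀ i, σ (N.cell i) ≠ 0) → (∀ i, σ (N.cell i) ≠ ∞) →
      (∀ i, μ (N.cell i) ≠ 0) → (∀ i, μ (N.cell i) ≠ ∞) → ∀ R : J,
    ∑' i, {i | N.Below i R}.indicator (fun i => μ (N.cell i) ^ (1 - δ) * σ (N.cell i) ^ δ) i ≤
      C * (μ (N.cell R) ^ (1 - δ) * σ (N.cell R) ^ δ) := by
  obtain ⟨C₁, hC₁, hs₁⟩ := tsum_zpow_le_rpow h0
  obtain ⟨C₂, hC₂, hs₂⟩ := tsum_zpow_le_rpow (r := 1 - δ) (by linarith)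
  refine ⟨2 * 2 ^ δ * (C₁ + C₂), by finiteness,
    fun {X J} _ _ {N μ E} hE σ hσ0 hσ1 hμ0 hμ1 R => ?_⟩
  set d : J → ℝ≥0∞ := fun i => σ (N.cell i) / μ (N.cell i) with hd
  set A : ℤ → Set J := fun k => {i | N.Below i R ∧ (2 : ℝ≥0∞) ^ (k : ℝ) < d i} with hA
  have hterm (i : J) : μ (N.cell i) ^ (1 - δ) * σ (N.cell i) ^ δ = μ (N.cell i) * d i ^ δ := by
    rw [hd, ENNReal.div_rpow_of_nonneg _ _ h0.le, div_eq_mul_inv, ← ENNReal.rpow_neg,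
      ENNReal.rpow_sub _ _ (hμ0 i) (hμ1 i), ENNReal.rpow_one, ENNReal.rpow_neg, div_eq_mul_inv]
    ring
  -- the cells of density above `2 ^ k` below `R` cover little of `R`
  have hlev (k : ℤ) : ∑' i, (A k).indicator (fun i => μ (E i)) i ≤
      min (μ (N.cell R)) (2 ^ (-(k : ℝ)) * σ (N.cell R)) := by
    have hsub : ⋃ i ∈ A k, N.cell i ⊆ N.cell R := by
      refine Set.iUnion₂_subset fun i hi => hi.1.2
    have h2 : ∑' i, (A k).indicator (fun i => μ (E i)) i ≤ μ (⋃ i ∈ A k, N.cell i) := by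
      rw [← tsum_subtype, ← measure_biUnion (Set.to_countable _)
        (fun i _ j _ hij => hE.disjoint hij) (fun i _ => hE.measurableSet i)]
      exact measure_mono (Set.biUnion_mono subset_rfl fun i _ => hE.subset i)
    refine h2.trans (le_min (measure_mono hsub) ?_)
    have h3 := mul_measure_biUnion_le (N := N) (A := A k) (μ := μ) (σ := σ)
      (t := (2 : ℝ≥0∞) ^ (k : ℝ)) (fun i hi => ENNReal.mul_le_of_le_div hi.2.le)
    calc μ (⋃ i ∈ A k, N.cell i)
        = 2 ^ (-(k : ℝ)) * ((2 : ℝ≥0∞) ^ (k : ℝ) * μ (⋃ i ∈ A k, N.cell i)) := by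
          rw [← mul_assoc, ← ENNReal.rpow_add _ _ (by norm_num) (by norm_num), neg_add_cancel,
            ENNReal.rpow_zero, one_mul]
      _ ≤ _ := by gcongr; exact h3.trans (measure_mono hsub)
  set T := d R with hT
  have hT0 : T ≠ 0 := (ENNReal.div_pos (hσ0 R) (hμ1 R)).ne'
  have hT1 : T ≠ ∞ := ENNReal.div_ne_top (hσ1 R) (hμ0 R)
  calc _ ≤ ∑' i, ∑' k : ℤ, 2 * 2 ^ δ * 2 ^ ((k : ℝ) * δ) * (A k).indicator (fun i => μ (E i)) i := by
        refine ENNReal.tsum_le_tsum fun i => ?_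
        by_cases hi : N.Below i R
        · rw [Set.indicator_of_mem (by exact hi), hterm]
          calc μ (N.cell i) * d i ^ δ ≤ (2 * μ (E i)) * (2 ^ δ *
                ∑' k : ℤ, (if (2 : ℝ≥0∞) ^ (k : ℝ) < d i then (2 : ℝ≥0∞) ^ ((k : ℝ) * δ) else 0)) := by
                gcongr
                · exact hE.le i
                · exact rpow_le_tsum_zpow h0 _
            _ = _ := by
                rw [← ENNReal.tsum_mul_left, ← ENNReal.tsum_mul_left]
                refine tsum_congr fun k => ?_
                by_cases hk : (2 : ℝ≥0∞) ^ (k : ℝ) < d i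
                · rw [if_pos hk, Set.indicator_of_mem (show i ∈ A k from ⟨hi, hk⟩)]; ring
                · rw [if_neg hk, Set.indicator_of_notMem (fun h : i ∈ A k => hk h.2)]; simp
        · rw [Set.indicator_of_notMem (by exact hi)]; exact zero_le
    _ = ∑' k : ℤ, 2 * 2 ^ δ * 2 ^ ((k : ℝ) * δ) * ∑' i, (A k).indicator (fun i => μ (E i)) i := by
        rw [ENNReal.tsum_comm]; simp_rw [ENNReal.tsum_mul_left]
    _ ≤ ∑' k : ℤ, (2 * 2 ^ δ * (μ (N.cell R) *
          (if (2 : ℝ≥0∞) ^ (k : ℝ) ≤ T then (2 : ℝ≥0∞) ^ ((k : ℝ) * δ) else 0)) +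
          2 * 2 ^ δ * (σ (N.cell R) * (if (2 : ℝ≥0∞) ^ (((-k : ℤ)) : ℝ) ≤ T⁻¹ then
            (2 : ℝ≥0∞) ^ ((((-k : ℤ)) : ℝ) * (1 - δ)) else 0))) := by
        refine ENNReal.tsum_le_tsum fun k => ?_
        rcases le_total ((2 : ℝ≥0∞) ^ (k : ℝ)) T with hk | hk
        · refine le_trans ?_ le_self_add
          rw [if_pos hk, mul_comm (μ (N.cell R)), ← mul_assoc]
          gcongr
          exact (hlev k).trans (min_le_left _ _)
        · refine le_trans ?_ le_add_self
          have hk' : (2 : ℝ≥0∞) ^ (((-k : ℤ)) : ℝ) ≤ T⁻¹ := by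
            push_cast
            rw [ENNReal.rpow_neg]
            exact ENNReal.inv_le_inv.2 hk
          rw [if_pos hk', mul_assoc (2 * 2 ^ δ)]
          refine mul_le_mul_right ?_ _
          calc (2 : ℝ≥0∞) ^ ((k : ℝ) * δ) * ∑' i, (A k).indicator (fun i => μ (E i)) i
              ≤ (2 : ℝ≥0∞) ^ ((k : ℝ) * δ) * (2 ^ (-(k : ℝ)) * σ (N.cell R)) := by
                gcongr; exact (hlev k).trans (min_le_right _ _)
            _ = _ := by
                rw [← mul_assoc, ← ENNReal.rpow_add _ _ (by norm_num) (by norm_num), mul_comm]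
                congr 2; push_cast; ring
    _ ≤ 2 * 2 ^ δ * (μ (N.cell R) * (C₁ * T ^ δ)) +
          2 * 2 ^ δ * (σ (N.cell R) * (C₂ * T⁻¹ ^ (1 - δ))) := by
        rw [ENNReal.tsum_add]
        simp_rw [ENNReal.tsum_mul_left]
        gcongr
        · exact hs₁ T
        · refine le_trans (le_of_eq ?_) (hs₂ T⁻¹)
          exact (Equiv.neg ℤ).tsum_eq (fun k : ℤ => (if (2 : ℝ≥0∞) ^ (k : ℝ) ≤ T⁻¹ then
            (2 : ℝ≥0∞) ^ ((k : ℝ) * (1 - δ)) else 0))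
    _ = _ := by
        have hσT : σ (N.cell R) * T⁻¹ ^ (1 - δ) = μ (N.cell R) * T ^ δ := by
          have : σ (N.cell R) = μ (N.cell R) * T := by
            rw [hT, hd, ENNReal.mul_div_cancel (hμ0 R) (hμ1 R)]
          rw [this, ENNReal.inv_rpow, ← ENNReal.rpow_neg, mul_assoc]
          congr 1
          conv_lhs => rw [← ENNReal.rpow_one T, ← ENNReal.rpow_mul, ← ENNReal.rpow_add _ _ hT0 hT1]
          congr 1; ring
        rw [hterm R, mul_left_comm (σ (N.cell R)), hσT]; ring

end NestedFamily

/-! ### The weighted bound for sparse operators -/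

theorem rpow_le_rpow_of_exponent_nonpos {x y : ℝ≥0∞} {z : ℝ} (hz : z ≤ 0) (h : x ≤ y) :
    y ^ z ≤ x ^ z := by
  rw [← neg_neg z, ENNReal.rpow_neg, ENNReal.rpow_neg x]
  exact ENNReal.inv_le_inv.2 (ENNReal.rpow_le_rpow h (by linarith))

namespace NestedFamily

/-- The hypotheses of the bilinear estimate: `μ` is the ambient measure, `σ` and `u` are the two
weighted measures, related to `μ` by Hölder's inequality on the sets `E i` and by the Muckenhoupt
condition with constant `A` on the cells. -/
structure BilinearData {X J : Type*} [MeasurableSpace X] (N : NestedFamily X J) (E : J → Set X)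
    (μ σ u : Measure X) (a b : ℝ) (A : ℝ≥0∞) : Prop where
  sparse : N.IsSparse μ E
  sigma_ne_zero : ∀ i, σ (N.cell i) ≠ 0
  sigma_ne_top : ∀ i, σ (N.cell i) ≠ ∞
  u_ne_zero : ∀ i, u (N.cell i) ≠ 0
  u_ne_top : ∀ i, u (N.cell i) ≠ ∞
  mu_ne_zero : ∀ i, μ (N.cell i) ≠ 0
  mu_ne_top : ∀ i, μ (N.cell i) ≠ ∞
  holder : ∀ i, μ (E i) ^ (a + b) ≤ σ (E i) ^ a * u (E i) ^ b
  muckenhoupt : ∀ i, u (N.cell i) ^ b * σ (N.cell i) ^ a ≤ A * μ (N.cell i) ^ (a + b)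

/-- The bilinear form of a sparse operator of order `s`. -/
noncomputable def sparseForm {X J : Type*} [MeasurableSpace X] (N : NestedFamily X J)
    (μ σ u : Measure X) (s : ℝ) (f g : X → ℝ≥0∞) : ℝ≥0∞ :=
  ∑' i, μ (N.cell i) ^ (-s) * ((∫⁻ x in N.cell i, f x ∂σ) * ∫⁻ x in N.cell i, g x ∂u)

variable {X J : Type*} [MeasurableSpace X] {N : NestedFamily X J} {E : J → Set X}
  {μ σ u : Measure X} {a b : ℝ} {A : ℝ≥0∞} {f g : X → ℝ≥0∞}

/-- The Muckenhoupt condition is used to the power `1 + a / b`, which is the sharp exponent of `A`.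
The exponents of the three measures in the remaining coefficient add up to `2 - (a + b)`, what
Hölder's inequality and the two embeddings require. -/
theorem BilinearData.coeff_le (h : BilinearData N E μ σ u a b A) (hb : 0 < b) (hba : b ≤ a) (i : J) :
    μ (N.cell i) ^ (-(a + b)) * (σ (N.cell i) * u (N.cell i)) ≤ A ^ (1 + a / b) *
      (μ (N.cell i) ^ (a / b * (a + b)) * u (N.cell i) ^ (1 - (a + b)) *
        σ (N.cell i) ^ (1 - a / b * (a + b))) := by
  have hu0 := h.u_ne_zero i
  have hu1 := h.u_ne_top i
  have hs0 := h.sigma_ne_zero i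
  have hs1 := h.sigma_ne_top i
  have hm0 := h.mu_ne_zero i
  have hm1 := h.mu_ne_top i
  have hM := h.muckenhoupt i
  generalize u (N.cell i) = U at *
  generalize σ (N.cell i) = S at *
  generalize μ (N.cell i) = V at *
  have hab : 0 ≤ 1 + a / b := by have := div_nonneg (hb.le.trans hba) hb.le; linarith
  have h1 : (U ^ b * S ^ a) ^ (1 + a / b) ≤ A ^ (1 + a / b) * V ^ ((a + b) * (1 + a / b)) := by
    refine (ENNReal.rpow_le_rpow hM hab).trans (le_of_eq ?_)
    rw [ENNReal.mul_rpow_of_nonneg _ _ hab, ← ENNReal.rpow_mul]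
  have h2 : U ^ b * (U ^ (a / b * b)) = U ^ (a + b) := by
    rw [← ENNReal.rpow_add _ _ hu0 hu1, div_mul_cancel₀ _ hb.ne', add_comm]
  calc V ^ (-(a + b)) * (S * U)
      = V ^ (-(a + b)) * ((U ^ b * S ^ a) ^ (1 + a / b) * (U ^ (1 - (a + b)) *
          S ^ (1 - a / b * (a + b)))) := by
        congr 1
        rw [ENNReal.mul_rpow_of_nonneg _ _ hab, ← ENNReal.rpow_mul, ← ENNReal.rpow_mul,
          mul_mul_mul_comm, ← ENNReal.rpow_add _ _ hu0 hu1, ← ENNReal.rpow_add _ _ hs0 hs1]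
        have e1 : b * (1 + a / b) + (1 - (a + b)) = 1 := by field_simp; ring
        have e2 : a * (1 + a / b) + (1 - a / b * (a + b)) = 1 := by field_simp; ring
        rw [e1, e2, ENNReal.rpow_one, ENNReal.rpow_one, mul_comm]
    _ ≤ V ^ (-(a + b)) * ((A ^ (1 + a / b) * V ^ ((a + b) * (1 + a / b))) * (U ^ (1 - (a + b)) *
          S ^ (1 - a / b * (a + b)))) := by gcongr
    _ = A ^ (1 + a / b) * ((V ^ (-(a + b)) * V ^ ((a + b) * (1 + a / b))) * U ^ (1 - (a + b)) *
          S ^ (1 - a / b * (a + b))) := by ring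
    _ = _ := by
        rw [← ENNReal.rpow_add _ _ hm0 hm1]
        congr 4; ring

/-- The factor `|Q|` is replaced by the weighted measures of `E`. -/
theorem BilinearData.mu_rpow_le (h : BilinearData N E μ σ u a b A) (hb : 0 < b) (hba : b ≤ a)
    (i : J) : μ (N.cell i) ^ (a / b * (a + b)) ≤
      2 ^ (a / b * (a + b)) * (σ (E i) ^ (a / b * a) * u (E i) ^ a) := by
  have hab : 0 ≤ a / b := div_nonneg (hb.le.trans hba) hb.le
  have hab' : 0 ≤ a / b * (a + b) := mul_nonneg hab (by linarith)
  calc μ (N.cell i) ^ (a / b * (a + b)) ≤ (2 * μ (E i)) ^ (a / b * (a + b)) :=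
        ENNReal.rpow_le_rpow (h.sparse.le i) hab'
    _ = 2 ^ (a / b * (a + b)) * (μ (E i) ^ (a + b)) ^ (a / b) := by
        rw [ENNReal.mul_rpow_of_nonneg _ _ hab', ← ENNReal.rpow_mul, mul_comm (a + b)]
    _ ≤ 2 ^ (a / b * (a + b)) * (σ (E i) ^ a * u (E i) ^ b) ^ (a / b) := by
        gcongr; exact h.holder i
    _ = _ := by
        rw [ENNReal.mul_rpow_of_nonneg _ _ hab, ← ENNReal.rpow_mul, ← ENNReal.rpow_mul,
          mul_comm a, mul_div_cancel₀ _ hb.ne']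

theorem sparseForm_term_eq (h : BilinearData N E μ σ u a b A) (i : J) (s : ℝ) :
    μ (N.cell i) ^ (-s) * ((∫⁻ x in N.cell i, f x ∂σ) * ∫⁻ x in N.cell i, g x ∂u) =
      μ (N.cell i) ^ (-s) * (σ (N.cell i) * u (N.cell i)) * (N.avg σ f i * N.avg u g i) := by
  have h1 : ∫⁻ x in N.cell i, f x ∂σ = σ (N.cell i) * N.avg σ f i :=
    (ENNReal.mul_div_cancel (h.sigma_ne_zero i) (h.sigma_ne_top i)).symm
  have h2 : ∫⁻ x in N.cell i, g x ∂u = u (N.cell i) * N.avg u g i :=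
    (ENNReal.mul_div_cancel (h.u_ne_zero i) (h.u_ne_top i)).symm
  rw [h1, h2]; ring

/-- Hölder's inequality for sums, with the two factors estimated separately. -/
theorem tsum_le_of_holder {θ : ℝ} (h0 : 0 < θ) (h1 : θ < 1) {x y c : J → ℝ≥0∞}
    {K F G : ℝ≥0∞} (hc : ∀ i, c i ≤ K * (x i * y i))
    (hx : (∑' i, x i ^ (1 / (1 - θ))) ^ (1 - θ) ≤ F) (hy : (∑' i, y i ^ (1 / θ)) ^ θ ≤ G) :
    ∑' i, c i ≤ K * (F * G) := by
  calc ∑' i, c i ≤ ∑' i, K * (y i * x i) := ENNReal.tsum_le_tsum fun i => by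
        rw [mul_comm (y i)]; exact hc i
    _ ≤ K * ((∑' i, y i ^ (1 / θ)) ^ θ * (∑' i, x i ^ (1 / (1 - θ))) ^ (1 - θ)) := by
        rw [ENNReal.tsum_mul_left]
        exact mul_le_mul_right (tsum_mul_le_rpow h0 h1 y x) _
    _ ≤ _ := by rw [mul_comm F]; gcongr

/-- If the power of `σ(Q)` left over in the coefficient is nonpositive, then `Q` may be replaced by
the smaller set `E_Q` there, and the embeddings into the disjoint sets `E_Q` suffice. -/
theorem sparseForm_le_of_nonpos (hb : 0 < b) (hba : b ≤ a) (hab : a + b ≤ 1)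
    (hδ : 1 - a / b * (a + b) ≤ 0) : ∃ C : ℝ≥0∞, C ≠ ∞ ∧
    ∀ {X J : Type*} [MeasurableSpace X] [Countable J] {N : NestedFamily X J} {E : J → Set X}
      {μ σ u : Measure X} {A : ℝ≥0∞} {f g : X → ℝ≥0∞},
      BilinearData N E μ σ u a b A → Measurable f → Measurable g →
    N.sparseForm μ σ u (a + b) f g ≤ C * A ^ (1 + a / b) *
      ((∫⁻ x, f x ^ (1 / (1 - a)) ∂σ) ^ (1 - a) * (∫⁻ x, g x ^ (1 / (1 - b)) ∂u) ^ (1 - b)) := by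
  have ha0 : 0 < a := hb.trans_le hba
  have ha1 : a < 1 := by linarith
  obtain ⟨C₁, hC₁, hf⟩ := tsum_fractional_supAvg_le (P := 1 - a) (β := 0) (by linarith) le_rfl
    (by linarith)
  obtain ⟨C₂, hC₂, hg⟩ := tsum_fractional_supAvg_le (P := 1 - b) (β := 1 - (a + b)) (by linarith)
    (by linarith) (by linarith)
  have e : 1 - b - (1 - (a + b)) = a := by ring
  rw [e] at hg
  simp only [sub_zero, ENNReal.rpow_zero, one_mul] at hf
  have hs0 : 0 ≤ a / b * (a + b) := mul_nonneg (div_pos ha0 hb).le (by linarith)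
  refine ⟨2 ^ (a / b * (a + b)) * (C₁ * C₂), by finiteness,
    fun {X J} _ _ {N E μ σ u A f g} h hfm hgm => ?_⟩
  set F := (∫⁻ x, f x ^ (1 / (1 - a)) ∂σ) ^ (1 - a)
  set G := (∫⁻ x, g x ^ (1 / (1 - b)) ∂u) ^ (1 - b)
  refine (tsum_le_of_holder (θ := a) ha0 ha1 (K := A ^ (1 + a / b) * 2 ^ (a / b * (a + b)))
    (x := fun i => σ (E i) ^ (1 - a) * N.supAvg σ f i)
    (y := fun i => u (E i) ^ a * (u (N.cell i) ^ (1 - (a + b)) * N.supAvg u g i))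
    (F := C₁ * F) (G := C₂ * G) (fun i => ?_) ?_ ?_).trans (le_of_eq (by ring))
  · rw [sparseForm_term_eq h]
    have hσE0 : σ (E i) ≠ 0 := by
      intro h0
      have h2 := h.holder i
      rw [h0, ENNReal.zero_rpow_of_pos ha0, zero_mul, nonpos_iff_eq_zero,
        ENNReal.rpow_eq_zero_iff_of_pos (by linarith)] at h2
      have := h.sparse.le i
      rw [h2, mul_zero] at this
      exact h.mu_ne_zero i (nonpos_iff_eq_zero.1 this)
    have hσE1 : σ (E i) ≠ ∞ := ne_top_of_le_ne_top (h.sigma_ne_top i) (measure_mono (h.sparse.subset i))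
    have hδ' : σ (N.cell i) ^ (1 - a / b * (a + b)) ≤ σ (E i) ^ (1 - a / b * (a + b)) :=
      rpow_le_rpow_of_exponent_nonpos hδ (measure_mono (h.sparse.subset i))
    calc _ ≤ (A ^ (1 + a / b) * (2 ^ (a / b * (a + b)) * (σ (E i) ^ (a / b * a) * u (E i) ^ a) *
            u (N.cell i) ^ (1 - (a + b)) * σ (E i) ^ (1 - a / b * (a + b)))) *
            (N.supAvg σ f i * N.supAvg u g i) := by
          gcongr ?_ * (?_ * ?_)
          · refine (h.coeff_le hb hba i).trans ?_
            gcongr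
            exact h.mu_rpow_le hb hba i
          · exact avg_le_supAvg (Below.refl i)
          · exact avg_le_supAvg (Below.refl i)
      _ = A ^ (1 + a / b) * 2 ^ (a / b * (a + b)) * ((σ (E i) ^ (a / b * a) *
            σ (E i) ^ (1 - a / b * (a + b)) * N.supAvg σ f i) *
            (u (E i) ^ a * (u (N.cell i) ^ (1 - (a + b)) * N.supAvg u g i))) := by ring
      _ ≤ _ := by
          rw [← ENNReal.rpow_add _ _ hσE0 hσE1, show
            a / b * a + (1 - a / b * (a + b)) = 1 - a by field_simp; ring]
  · refine le_trans (le_of_eq ?_) (hf h.sparse σ hfm h.sigma_ne_zero h.sigma_ne_top)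
    congr 1
    refine tsum_congr fun i => ?_
    rw [ENNReal.mul_rpow_of_nonneg _ _ (by rw [one_div, inv_nonneg]; linarith), ← ENNReal.rpow_mul, mul_one_div_cancel (by linarith), ENNReal.rpow_one, mul_comm]
  · refine le_trans (le_of_eq ?_) (hg h.sparse u hgm h.u_ne_zero h.u_ne_top)
    congr 1
    refine tsum_congr fun i => ?_
    rw [ENNReal.mul_rpow_of_nonneg _ _ (by positivity), ← ENNReal.rpow_mul, mul_one_div_cancel ha0.ne', ENNReal.rpow_one, mul_comm]

/-- Each cell lies below a record cell of `f` and a record cell of `g`. At the smaller of the two,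
the average of the one function and the largest average of the other over the larger cells control
the product of the averages over the given cell. -/
theorem exists_record_pair {i : J} (hf0 : N.avg σ f i ≠ 0) (hf1 : N.avg σ f i ≠ ∞)
    (hg0 : N.avg u g i ≠ 0) (hg1 : N.avg u g i ≠ ∞) :
    (∃ R ∈ N.records σ f, N.Below i R ∧
      N.avg σ f i * N.avg u g i ≤ 4 * (N.avg σ f R * N.supAvg u g R)) ∨
    (∃ R ∈ N.records u g, N.Below i R ∧
      N.avg σ f i * N.avg u g i ≤ 4 * (N.supAvg σ f R * N.avg u g R)) := by
  obtain ⟨R, hR, hiR, hfR⟩ := exists_record_above hf0 hf1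
  obtain ⟨T, hT, hiT, hgT⟩ := exists_record_above hg0 hg1
  obtain ⟨x, hx⟩ := N.nonempty_cell i
  have h4 (y z : ℝ≥0∞) : 2 * y * (2 * z) = 4 * (y * z) := by ring
  rcases below_or_below_of_mem (hiR.2 hx) (hiT.2 hx) with h | h
  · refine Or.inl ⟨R, hR, hiR, (mul_le_mul' hfR hgT).trans ?_⟩
    rw [h4]
    gcongr
    exact avg_le_supAvg h
  · refine Or.inr ⟨T, hT, hiT, (mul_le_mul' hfR hgT).trans ?_⟩
    rw [h4]
    gcongr
    exact avg_le_supAvg h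

theorem avg_ne_top_of_lintegral (hfm : Measurable f) {P : ℝ} (h0 : 0 < P) (h1 : P < 1) {i : J}
    (hi0 : σ (N.cell i) ≠ 0) (hi1 : σ (N.cell i) ≠ ∞) (hfin : ∫⁻ x, f x ^ (1 / P) ∂σ ≠ ∞) :
    N.avg σ f i ≠ ∞ := by
  intro h
  have h2 := measure_rpow_mul_avg_le hfm h0 h1 hi0 hi1
  rw [h, ENNReal.mul_top, top_le_iff] at h2
  · exact (ENNReal.rpow_ne_top_of_nonneg h0.le hfin) h2
  · rw [Ne, ENNReal.rpow_eq_zero_iff_of_pos h0]; exact hi0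

/-- Sums of coefficients over the cells below record cells. -/
theorem tsum_le_of_records {c t : J → ℝ≥0∞} {F : Set J} {w : J → ℝ≥0∞} {K : ℝ≥0∞}
    (hK : ∀ R, ∑' i, {i | N.Below i R}.indicator c i ≤ K * c R)
    (ht : ∀ i, t i ≤ ∑' R, F.indicator (fun R => {i | N.Below i R}.indicator c i * w R) R) :
    ∑' i, t i ≤ K * ∑' R, F.indicator (fun R => c R * w R) R := by
  calc ∑' i, t i ≤ ∑' i, ∑' R, F.indicator (fun R => {i | N.Below i R}.indicator c i * w R) R :=
        ENNReal.tsum_le_tsum ht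
    _ = ∑' R, ∑' i, F.indicator (fun R => {i | N.Below i R}.indicator c i * w R) R :=
        ENNReal.tsum_comm
    _ ≤ ∑' R, K * F.indicator (fun R => c R * w R) R := by
        refine ENNReal.tsum_le_tsum fun R => ?_
        by_cases hR : R ∈ F
        · simp only [Set.indicator_of_mem hR]
          rw [ENNReal.tsum_mul_right, ← mul_assoc]
          gcongr
          exact hK R
        · simp [Set.indicator_of_notMem hR]
    _ = _ := ENNReal.tsum_mul_left

/-- If the power of `σ(Q)` left over in the coefficient is positive, it cannot be replaced by a power
of `σ(E_Q)`. The terms are then grouped below record cells, and the coefficients below a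
record cell are summed by `tsum_below_le`; this leaves sums over record cells, on which the averages
satisfy an embedding with `σ(Q)` in place of `σ(E_Q)`. -/
theorem sparseForm_le_of_pos (hb : 0 < b) (hba : b ≤ a) (hab : a + b ≤ 1)
    (hδ : 0 < 1 - a / b * (a + b)) : ∃ C : ℝ≥0∞, C ≠ ∞ ∧
    ∀ {X J : Type*} [MeasurableSpace X] [Countable J] {N : NestedFamily X J} {E : J → Set X}
      {μ σ u : Measure X} {A : ℝ≥0∞} {f g : X → ℝ≥0∞},
      BilinearData N E μ σ u a b A → Measurable f → Measurable g →
      ∫⁻ x, f x ^ (1 / (1 - a)) ∂σ ≠ ∞ → ∫⁻ x, g x ^ (1 / (1 - b)) ∂u ≠ ∞ →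
    N.sparseForm μ σ u (a + b) f g ≤ C * A ^ (1 + a / b) *
      ((∫⁻ x, f x ^ (1 / (1 - a)) ∂σ) ^ (1 - a) * (∫⁻ x, g x ^ (1 / (1 - b)) ∂u) ^ (1 - b)) := by
  have ha0 : 0 < a := hb.trans_le hba
  have ha1 : a < 1 := by linarith
  have hb1 : b < 1 := by linarith
  have hs0 : 0 < a / b * (a + b) := mul_pos (div_pos ha0 hb) (by linarith)
  obtain ⟨C₁, hC₁, hfs⟩ := tsum_fractional_supAvg_le (P := 1 - a) (β := 1 - (a + b)) (by linarith)
    (by linarith) (by linarith)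
  obtain ⟨C₂, hC₂, hgs⟩ := tsum_fractional_supAvg_le (P := 1 - b) (β := 1 - (a + b)) (by linarith)
    (by linarith) (by linarith)
  obtain ⟨C₃, hC₃, hfr⟩ := tsum_records_avg_rpow_le (p := 1 / (1 - a))
    (by rw [lt_div_iff₀ (by linarith)]; linarith)
  obtain ⟨C₄, hC₄, hgr⟩ := tsum_records_avg_rpow_le (p := 1 / (1 - b))
    (by rw [lt_div_iff₀ (by linarith)]; linarith)
  obtain ⟨C₅, hC₅, hK⟩ := tsum_below_le hδ (by linarith)
  have e1 : 1 - b - (1 - (a + b)) = a := by ring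
  have e2 : 1 - a - (1 - (a + b)) = b := by ring
  have e3 : 1 - (1 - a / b * (a + b)) = a / b * (a + b) := by ring
  rw [e1] at hgs
  rw [e2] at hfs
  rw [e3] at hK
  have ha' : 0 ≤ 1 - a := by linarith
  have hb' : 0 ≤ 1 - b := by linarith
  refine ⟨4 * (C₅ * 2 ^ (a / b * (a + b))) * (C₃ ^ (1 - a) * C₂ + C₁ * C₄ ^ (1 - b)), by finiteness,
    fun {X J} _ _ {N E μ σ u A f g} h hfm hgm hff hgf => ?_⟩
  set F := (∫⁻ x, f x ^ (1 / (1 - a)) ∂σ) ^ (1 - a) with hF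
  set G := (∫⁻ x, g x ^ (1 / (1 - b)) ∂u) ^ (1 - b) with hG
  set c : J → ℝ≥0∞ := fun i => μ (N.cell i) ^ (a / b * (a + b)) * u (N.cell i) ^ (1 - (a + b)) *
        σ (N.cell i) ^ (1 - a / b * (a + b)) with hc
  set w₁ : J → ℝ≥0∞ := fun R => N.avg σ f R * N.supAvg u g R
  set w₂ : J → ℝ≥0∞ := fun R => N.supAvg σ f R * N.avg u g R
  have havf (i : J) : N.avg σ f i ≠ ∞ := avg_ne_top_of_lintegral hfm (by linarith) (by linarith)
    (h.sigma_ne_zero i) (h.sigma_ne_top i) hff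
  have havg (i : J) : N.avg u g i ≠ ∞ := avg_ne_top_of_lintegral hgm (by linarith) (by linarith)
    (h.u_ne_zero i) (h.u_ne_top i) hgf
  have hKc (R : J) : ∑' i, {i | N.Below i R}.indicator c i ≤ C₅ * c R := by
    calc _ ≤ ∑' i, u (N.cell R) ^ (1 - (a + b)) * {i | N.Below i R}.indicator
            (fun i => μ (N.cell i) ^ (a / b * (a + b)) * σ (N.cell i) ^ (1 - a / b * (a + b))) i := by
          refine ENNReal.tsum_le_tsum fun i => ?_
          by_cases hi : N.Below i R
          · rw [Set.indicator_of_mem (by exact hi), Set.indicator_of_mem (by exact hi), hc]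
            calc _ = u (N.cell i) ^ (1 - (a + b)) * (μ (N.cell i) ^ (a / b * (a + b)) *
                  σ (N.cell i) ^ (1 - a / b * (a + b))) := by ring
              _ ≤ _ := mul_le_mul_left (ENNReal.rpow_le_rpow (measure_mono hi.2) (by linarith)) _
          · rw [Set.indicator_of_notMem (by exact hi)]; exact zero_le
      _ ≤ _ := by
          rw [ENNReal.tsum_mul_left]
          refine (mul_le_mul_right (hK h.sparse σ h.sigma_ne_zero h.sigma_ne_top h.mu_ne_zero
            h.mu_ne_top R) _).trans (le_of_eq (by rw [hc]; ring))
  have hcE (i : J) : c i ≤ 2 ^ (a / b * (a + b)) * (σ (E i) ^ (a / b * a) * u (E i) ^ a) *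
      u (N.cell i) ^ (1 - (a + b)) * σ (N.cell i) ^ (1 - a / b * (a + b)) := by
    rw [hc]
    exact mul_le_mul_left (mul_le_mul_left (h.mu_rpow_le hb hba i) _) _
  -- records of `f`
  have hS₁ : ∑' R, (N.records σ f).indicator (fun R => c R * w₁ R) R ≤
      2 ^ (a / b * (a + b)) * ((C₃ ^ (1 - a) * F) * (C₂ * G)) := by
    refine tsum_le_of_holder (θ := a) ha0 ha1
      (x := (N.records σ f).indicator fun i => σ (N.cell i) ^ (1 - a) * N.avg σ f i)
      (y := fun i => u (E i) ^ a * (u (N.cell i) ^ (1 - (a + b)) * N.supAvg u g i))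
      (fun i => ?_) ?_ ?_
    · by_cases hi : i ∈ N.records σ f
      · rw [Set.indicator_of_mem hi, Set.indicator_of_mem hi]
        calc c i * w₁ i ≤ 2 ^ (a / b * (a + b)) * (σ (N.cell i) ^ (a / b * a) * u (E i) ^ a) *
              u (N.cell i) ^ (1 - (a + b)) * σ (N.cell i) ^ (1 - a / b * (a + b)) * w₁ i := by
              refine mul_le_mul_left ((hcE i).trans ?_) _
              gcongr
              exact h.sparse.subset i
          _ = 2 ^ (a / b * (a + b)) * ((σ (N.cell i) ^ (a / b * a) *
              σ (N.cell i) ^ (1 - a / b * (a + b)) * N.avg σ f i) *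
              (u (E i) ^ a * (u (N.cell i) ^ (1 - (a + b)) * N.supAvg u g i))) := by ring
          _ ≤ _ := by
              rw [← ENNReal.rpow_add _ _ (h.sigma_ne_zero i) (h.sigma_ne_top i), show
                a / b * a + (1 - a / b * (a + b)) = 1 - a by field_simp; ring]
      · rw [Set.indicator_of_notMem hi]; exact zero_le
    · rw [hF, ← ENNReal.mul_rpow_of_nonneg _ _ ha']
      refine ENNReal.rpow_le_rpow (le_trans (le_of_eq ?_) (hfr N σ hfm havf)) ha'
      refine tsum_congr fun i => ?_
      by_cases hi : i ∈ N.records σ f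
      · rw [Set.indicator_of_mem hi, Set.indicator_of_mem hi, ENNReal.mul_rpow_of_nonneg _ _ (by rw [one_div, inv_nonneg]; linarith), ← ENNReal.rpow_mul,
          mul_one_div_cancel (by linarith), ENNReal.rpow_one, mul_comm]
      · rw [Set.indicator_of_notMem hi, Set.indicator_of_notMem hi, ENNReal.zero_rpow_of_pos (by rw [one_div, inv_pos]; linarith)]
    · refine le_trans (le_of_eq ?_) (hgs h.sparse u hgm h.u_ne_zero h.u_ne_top)
      congr 1
      refine tsum_congr fun i => ?_
      rw [ENNReal.mul_rpow_of_nonneg _ _ (by positivity), ← ENNReal.rpow_mul,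
        mul_one_div_cancel ha0.ne', ENNReal.rpow_one, mul_comm]
  -- records of `g`
  have hS₂ : ∑' R, (N.records u g).indicator (fun R => c R * w₂ R) R ≤
      2 ^ (a / b * (a + b)) * ((C₄ ^ (1 - b) * G) * (C₁ * F)) := by
    refine tsum_le_of_holder (θ := b) hb hb1
      (x := (N.records u g).indicator fun i => u (N.cell i) ^ (1 - b) * N.avg u g i)
      (y := fun i => σ (E i) ^ b * (σ (N.cell i) ^ (1 - (a + b)) * N.supAvg σ f i))
      (fun i => ?_) ?_ ?_
    · by_cases hi : i ∈ N.records u g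
      · rw [Set.indicator_of_mem hi, Set.indicator_of_mem hi]
        have h1 : σ (E i) ^ (a / b * a) ≤ σ (E i) ^ b * σ (N.cell i) ^ (a / b * a - b) := by
          have hge : 0 ≤ a / b * a - b := by
            rw [sub_nonneg]
            calc b ≤ a := hba
              _ = 1 * a := (one_mul a).symm
              _ ≤ _ := by gcongr; rwa [le_div_iff₀ hb, one_mul]
          calc σ (E i) ^ (a / b * a) = σ (E i) ^ b * σ (E i) ^ (a / b * a - b) := by
                rw [← ENNReal.rpow_add_of_nonneg _ _ hb.le hge, add_sub_cancel]
            _ ≤ _ := by gcongr; exact h.sparse.subset i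
        calc c i * w₂ i ≤ 2 ^ (a / b * (a + b)) * ((σ (E i) ^ b * σ (N.cell i) ^ (a / b * a - b)) *
                u (N.cell i) ^ a) *
              u (N.cell i) ^ (1 - (a + b)) * σ (N.cell i) ^ (1 - a / b * (a + b)) * w₂ i := by
              refine mul_le_mul_left ((hcE i).trans ?_) _
              gcongr
              exact h.sparse.subset i
          _ = 2 ^ (a / b * (a + b)) * (((u (N.cell i) ^ a * u (N.cell i) ^ (1 - (a + b))) *
              N.avg u g i) * (σ (E i) ^ b * ((σ (N.cell i) ^ (a / b * a - b) *
              σ (N.cell i) ^ (1 - a / b * (a + b))) * N.supAvg σ f i))) := by ring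
          _ ≤ _ := by
              rw [← ENNReal.rpow_add _ _ (h.sigma_ne_zero i) (h.sigma_ne_top i),
                ← ENNReal.rpow_add _ _ (h.u_ne_zero i) (h.u_ne_top i)]
              rw [show a + (1 - (a + b)) = 1 - b by ring,
                show a / b * a - b + (1 - a / b * (a + b)) = 1 - (a + b) by field_simp; ring]
      · rw [Set.indicator_of_notMem hi]; exact zero_le
    · rw [hG, ← ENNReal.mul_rpow_of_nonneg _ _ hb']
      refine ENNReal.rpow_le_rpow (le_trans (le_of_eq ?_) (hgr N u hgm havg)) hb'
      refine tsum_congr fun i => ?_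
      by_cases hi : i ∈ N.records u g
      · rw [Set.indicator_of_mem hi, Set.indicator_of_mem hi, ENNReal.mul_rpow_of_nonneg _ _ (by rw [one_div, inv_nonneg]; linarith), ← ENNReal.rpow_mul,
          mul_one_div_cancel (by linarith), ENNReal.rpow_one, mul_comm]
      · rw [Set.indicator_of_notMem hi, Set.indicator_of_notMem hi, ENNReal.zero_rpow_of_pos (by rw [one_div, inv_pos]; linarith)]
    · refine le_trans (le_of_eq ?_) (hfs h.sparse σ hfm h.sigma_ne_zero h.sigma_ne_top)
      congr 1
      refine tsum_congr fun i => ?_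
      rw [ENNReal.mul_rpow_of_nonneg _ _ (by positivity), ← ENNReal.rpow_mul,
        mul_one_div_cancel hb.ne', ENNReal.rpow_one, mul_comm]
  -- each term is assigned to a record
  have hmain : ∑' i, c i * (N.avg σ f i * N.avg u g i) ≤
      4 * (C₅ * ∑' R, (N.records σ f).indicator (fun R => c R * w₁ R) R +
        C₅ * ∑' R, (N.records u g).indicator (fun R => c R * w₂ R) R) := by
    classical
    calc _ ≤ ∑' i, 4 * (∑' R, (N.records σ f).indicator
              (fun R => {i | N.Below i R}.indicator c i * w₁ R) R +
            ∑' R, (N.records u g).indicator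
              (fun R => {i | N.Below i R}.indicator c i * w₂ R) R) := by
          refine ENNReal.tsum_le_tsum fun i => ?_
          rcases eq_or_ne (N.avg σ f i) 0 with hf0 | hf0
          · simp [hf0]
          rcases eq_or_ne (N.avg u g i) 0 with hg0 | hg0
          · simp [hg0]
          rcases exists_record_pair hf0 (havf i) hg0 (havg i) with ⟨R, hR, hiR, hle⟩ | ⟨R, hR, hiR, hle⟩
          · refine le_trans ?_ (mul_le_mul_right le_self_add _)
            refine le_trans ?_ (mul_le_mul_right (ENNReal.le_tsum R) _)
            rw [Set.indicator_of_mem hR, Set.indicator_of_mem (by exact hiR), mul_left_comm 4]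
            exact mul_le_mul_right hle _
          · refine le_trans ?_ (mul_le_mul_right le_add_self _)
            refine le_trans ?_ (mul_le_mul_right (ENNReal.le_tsum R) _)
            rw [Set.indicator_of_mem hR, Set.indicator_of_mem (by exact hiR), mul_left_comm 4]
            exact mul_le_mul_right hle _
      _ ≤ _ := by
          rw [ENNReal.tsum_mul_left, ENNReal.tsum_add]
          gcongr
          · exact tsum_le_of_records hKc fun i => le_rfl
          · exact tsum_le_of_records hKc fun i => le_rfl
  calc N.sparseForm μ σ u (a + b) f g
      ≤ ∑' i, A ^ (1 + a / b) * (c i * (N.avg σ f i * N.avg u g i)) := by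
        refine ENNReal.tsum_le_tsum fun i => ?_
        rw [sparseForm_term_eq h, ← mul_assoc (A ^ _)]
        exact mul_le_mul_left (h.coeff_le hb hba i) _
    _ ≤ A ^ (1 + a / b) * (4 * (C₅ * (2 ^ (a / b * (a + b)) * ((C₃ ^ (1 - a) * F) * (C₂ * G))) +
        C₅ * (2 ^ (a / b * (a + b)) * ((C₄ ^ (1 - b) * G) * (C₁ * F))))) := by
        rw [ENNReal.tsum_mul_left]
        gcongr
        refine hmain.trans ?_
        gcongr
    _ = _ := by ring

end NestedFamily

/-- The converse of Hölder's inequality. Truncated powers of `F` serve as test functions, so that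
only `g` of finite norm need to be tested. -/
theorem lintegral_rpow_le_of_dual {X : Type*} [MeasurableSpace X] {ν : Measure X} [SigmaFinite ν]
    {b : ℝ} (hb : 0 < b) (hb1 : b < 1) {F : X → ℝ≥0∞} (hF : Measurable F) {M : ℝ≥0∞}
    (h : ∀ g : X → ℝ≥0∞, Measurable g → ∫⁻ x, g x ^ (1 / (1 - b)) ∂ν ≠ ∞ →
      ∫⁻ x, F x * g x ∂ν ≤ M * (∫⁻ x, g x ^ (1 / (1 - b)) ∂ν) ^ (1 - b)) :
    (∫⁻ x, F x ^ (1 / b) ∂ν) ^ b ≤ M := by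
  have hb' : 0 < 1 - b := by linarith
  have hb2 : 0 < 1 / b - 1 := by rw [sub_pos, lt_div_iff₀ hb]; linarith
  set G : ℕ → X → ℝ≥0∞ := fun k => (spanningSets ν k).indicator fun x => min (F x) k with hG
  have hGm (k : ℕ) : Measurable (G k) :=
    (hF.min measurable_const).indicator (measurableSet_spanningSets ν k)
  have hGF (k : ℕ) (x : X) : G k x ≤ F x := by
    rw [hG]; exact Set.indicator_le_self' (fun _ _ => zero_le) x |>.trans (min_le_left _ _)
  have hGk (k : ℕ) : ∫⁻ x, G k x ^ (1 / b) ∂ν ≠ ∞ := by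
    refine ne_top_of_le_ne_top (b := (k : ℝ≥0∞) ^ (1 / b) * ν (spanningSets ν k)) ?_ ?_
    · exact ENNReal.mul_ne_top (ENNReal.rpow_ne_top_of_nonneg (by positivity) (by simp))
        (measure_spanningSets_lt_top ν k).ne
    · rw [← setLIntegral_const, ← lintegral_indicator (measurableSet_spanningSets ν k)]
      refine lintegral_mono fun x => ?_
      by_cases hx : x ∈ spanningSets ν k
      · simp only [hG, Set.indicator_of_mem hx]
        exact ENNReal.rpow_le_rpow (min_le_right _ _) (by positivity)
      · simp [hG, Set.indicator_of_notMem hx, hb]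
  have hstep (k : ℕ) : (∫⁻ x, G k x ^ (1 / b) ∂ν) ^ b ≤ M := by
    set I := ∫⁻ x, G k x ^ (1 / b) ∂ν with hI
    rcases eq_or_ne I 0 with h0 | h0
    · rw [h0, ENNReal.zero_rpow_of_pos hb]; exact zero_le
    have hg : ∫⁻ x, (G k x ^ (1 / b - 1)) ^ (1 / (1 - b)) ∂ν = I := by
      refine lintegral_congr fun x => ?_
      rw [← ENNReal.rpow_mul]
      congr 1; field_simp
    have h1 := h (fun x => G k x ^ (1 / b - 1)) ((hGm k).pow_const _) (by rw [hg]; exact hGk k)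
    rw [hg] at h1
    have h2 : I ≤ M * I ^ (1 - b) := by
      refine le_trans ?_ h1
      refine lintegral_mono fun x => ?_
      calc G k x ^ (1 / b) = G k x ^ (1 : ℝ) * G k x ^ (1 / b - 1) := by
            rw [← ENNReal.rpow_add_of_nonneg _ _ zero_le_one hb2.le]; congr 1; ring
        _ ≤ _ := by rw [ENNReal.rpow_one]; gcongr; exact hGF k x
    calc I ^ b = I * I ^ (-(1 - b)) := by
          nth_rewrite 2 [← ENNReal.rpow_one I]
          rw [← ENNReal.rpow_add _ _ h0 (hGk k)]; congr 1; ring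
      _ ≤ M * I ^ (1 - b) * I ^ (-(1 - b)) := by gcongr
      _ = M := by
          rw [mul_assoc, ← ENNReal.rpow_add _ _ h0 (hGk k), add_neg_cancel, ENNReal.rpow_zero,
            mul_one]
  have hsup : ∫⁻ x, F x ^ (1 / b) ∂ν = ⨆ k, ∫⁻ x, G k x ^ (1 / b) ∂ν := by
    rw [← lintegral_iSup]
    · refine lintegral_congr fun x => le_antisymm ?_ (iSup_le fun k =>
        ENNReal.rpow_le_rpow (hGF k x) (by positivity))
      obtain ⟨k₀, hk₀⟩ : ∃ k, x ∈ spanningSets ν k := by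
        rw [← Set.mem_iUnion, iUnion_spanningSets]; trivial
      have hlim : Filter.Tendsto (fun k : ℕ => min (F x) (k : ℝ≥0∞) ^ (1 / b)) Filter.atTop
          (nhds (F x ^ (1 / b))) := by
        refine ((ENNReal.continuous_rpow_const).tendsto _).comp ?_
        have := (tendsto_const_nhds (x := F x)).min ENNReal.tendsto_nat_nhds_top
        simpa using this
      refine le_of_tendsto hlim (Filter.eventually_atTop.2 ⟨k₀, fun k hk => ?_⟩)
      refine le_trans (le_of_eq ?_) (le_iSup (fun k => G k x ^ (1 / b)) k)
      have : x ∈ spanningSets ν k := monotone_spanningSets ν hk hk₀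
      simp only [hG, Set.indicator_of_mem this]
    · exact fun k => (hGm k).pow_const _
    · intro i j hij x
      refine ENNReal.rpow_le_rpow ?_ (by positivity)
      by_cases hx : x ∈ spanningSets ν i
      · have hx' : x ∈ spanningSets ν j := monotone_spanningSets ν hij hx
        simp only [hG, Set.indicator_of_mem hx, Set.indicator_of_mem hx']
        gcongr
      · simp [hG, Set.indicator_of_notMem hx]
  rw [hsup]
  have := (ENNReal.orderIsoRpow b hb).map_iSup (fun k => ∫⁻ x, G k x ^ (1 / b) ∂ν)
  simp only [ENNReal.orderIsoRpow_apply] at this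
  rw [this]
  exact iSup_le hstep

namespace NestedFamily

theorem sparseForm_le_of_le {a b : ℝ} (hb : 0 < b) (hba : b ≤ a) (hab : a + b ≤ 1) :
    ∃ C : ℝ≥0∞, C ≠ ∞ ∧
    ∀ {X J : Type*} [MeasurableSpace X] [Countable J] {N : NestedFamily X J} {E : J → Set X}
      {μ σ u : Measure X} {A : ℝ≥0∞} {f g : X → ℝ≥0∞},
      BilinearData N E μ σ u a b A → Measurable f → Measurable g →
      ∫⁻ x, f x ^ (1 / (1 - a)) ∂σ ≠ ∞ → ∫⁻ x, g x ^ (1 / (1 - b)) ∂u ≠ ∞ →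
    N.sparseForm μ σ u (a + b) f g ≤ C * A ^ (1 + a / b) *
      ((∫⁻ x, f x ^ (1 / (1 - a)) ∂σ) ^ (1 - a) * (∫⁻ x, g x ^ (1 / (1 - b)) ∂u) ^ (1 - b)) := by
  rcases le_or_gt (1 - a / b * (a + b)) 0 with hδ | hδ
  · obtain ⟨C, hC, h⟩ := sparseForm_le_of_nonpos hb hba hab hδ
    exact ⟨C, hC, fun hd hf hg _ _ => h hd hf hg⟩
  · exact sparseForm_le_of_pos hb hba hab hδ

theorem BilinearData.symm {X J : Type*} [MeasurableSpace X] {N : NestedFamily X J} {E : J → Set X}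
    {μ σ u : Measure X} {a b : ℝ} {A : ℝ≥0∞} (h : BilinearData N E μ σ u a b A) :
    BilinearData N E μ u σ b a A where
  sparse := h.sparse
  sigma_ne_zero := h.u_ne_zero
  sigma_ne_top := h.u_ne_top
  u_ne_zero := h.sigma_ne_zero
  u_ne_top := h.sigma_ne_top
  mu_ne_zero := h.mu_ne_zero
  mu_ne_top := h.mu_ne_top
  holder i := by rw [add_comm, mul_comm]; exact h.holder i
  muckenhoupt i := by rw [add_comm, mul_comm]; exact h.muckenhoupt i

theorem sparseForm_comm {X J : Type*} [MeasurableSpace X] (N : NestedFamily X J)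
    (μ σ u : Measure X) (s : ℝ) (f g : X → ℝ≥0∞) :
    N.sparseForm μ σ u s f g = N.sparseForm μ u σ s g f := by
  unfold sparseForm
  exact tsum_congr fun i => by rw [mul_comm (∫⁻ x in N.cell i, f x ∂σ)]

/-- The bilinear estimate. The case `a < b` follows from the case `b ≤ a` by symmetry. -/
theorem sparseForm_le {a b : ℝ} (ha : 0 < a) (hb : 0 < b) (hab : a + b ≤ 1) :
    ∃ C : ℝ≥0∞, C ≠ ∞ ∧
    ∀ {X J : Type*} [MeasurableSpace X] [Countable J] {N : NestedFamily X J} {E : J → Set X}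
      {μ σ u : Measure X} {A : ℝ≥0∞} {f g : X → ℝ≥0∞},
      BilinearData N E μ σ u a b A → Measurable f → Measurable g →
      ∫⁻ x, f x ^ (1 / (1 - a)) ∂σ ≠ ∞ → ∫⁻ x, g x ^ (1 / (1 - b)) ∂u ≠ ∞ →
    N.sparseForm μ σ u (a + b) f g ≤ C * A ^ ((a + b) / b * max 1 (b / a)) *
      ((∫⁻ x, f x ^ (1 / (1 - a)) ∂σ) ^ (1 - a) * (∫⁻ x, g x ^ (1 / (1 - b)) ∂u) ^ (1 - b)) := by
  rcases le_total b a with h | h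
  · rw [max_eq_left ((div_le_one ha).2 h), show (a + b) / b * 1 = 1 + a / b by field_simp; ring]
    exact sparseForm_le_of_le hb h hab
  · rw [max_eq_right ((one_le_div ha).2 h), show (a + b) / b * (b / a) = 1 + b / a by field_simp]
    obtain ⟨C, hC, hle⟩ := sparseForm_le_of_le ha h (by linarith)
    refine ⟨C, hC, fun {X J} _ _ {N E μ σ u A f g} hd hf hg hf' hg' => ?_⟩
    rw [sparseForm_comm, add_comm a b, mul_comm ((∫⁻ x, f x ^ (1 / (1 - a)) ∂σ) ^ (1 - a))]
    exact hle hd.symm hg hf hg' hf'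

/-- The sparse operator of order `s`: it sends `φ` to `∑ |Q|^{-s} (∫_Q φ) χ_Q`. The order `1` gives
sums of averages, smaller orders give fractional operators. -/
noncomputable def sparseOp {X J : Type*} [MeasurableSpace X] (N : NestedFamily X J) (μ : Measure X)
    (s : ℝ) (φ : X → ℝ≥0∞) (x : X) : ℝ≥0∞ :=
  ∑' i, (N.cell i).indicator (fun _ => μ (N.cell i) ^ (-s) * ∫⁻ y in N.cell i, φ y ∂μ) x

theorem measurable_sparseOp {X J : Type*} [MeasurableSpace X] [Countable J] (N : NestedFamily X J)
    (μ : Measure X) (s : ℝ) (φ : X → ℝ≥0∞) : Measurable (N.sparseOp μ s φ) :=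
  Measurable.tsum fun i => measurable_const.indicator (N.measurableSet_cell i)

theorem lintegral_sparseOp_mul {X J : Type*} [MeasurableSpace X] [Countable J]
    (N : NestedFamily X J) (μ u : Measure X) (s : ℝ) (φ : X → ℝ≥0∞) {g : X → ℝ≥0∞}
    (hg : Measurable g) :
    ∫⁻ x, N.sparseOp μ s φ x * g x ∂u = N.sparseForm μ μ u s φ g := by
  unfold sparseOp sparseForm
  simp_rw [← ENNReal.tsum_mul_right]
  rw [lintegral_tsum]
  · refine tsum_congr fun i => ?_
    rw [← mul_assoc, ← lintegral_const_mul _ hg,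
      ← lintegral_indicator (N.measurableSet_cell i)
        (fun x => μ (N.cell i) ^ (-s) * (∫⁻ y in N.cell i, φ y ∂μ) * g x)]
    refine lintegral_congr fun x => ?_
    by_cases hx : x ∈ N.cell i <;> simp [hx]
  · exact fun i => ((measurable_const.indicator (N.measurableSet_cell i)).mul hg).aemeasurable

/-- The measures of the bilinear estimate for the weight `W`, where `a = 1/p'` and `b = 1/q`. -/
theorem bilinearData_of_weight {X J : Type*} [MeasurableSpace X] {N : NestedFamily X J}
    {E : J → Set X} {μ : Measure X} {a b : ℝ} (ha : 0 < a) (hb : 0 < b)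
    (hE : N.IsSparse μ E) (hμ0 : ∀ i, μ (N.cell i) ≠ 0) (hμ1 : ∀ i, μ (N.cell i) ≠ ∞)
    {W : X → ℝ≥0∞} (hW : Measurable W) (hW0 : ∀ x, W x ≠ 0) (hW1 : ∀ x, W x ≠ ∞) {K : ℝ≥0∞}
    (hK1 : K ≠ ∞)
    (hK : ∀ i, (∫⁻ x in N.cell i, W x ^ (1 / b) ∂μ) *
      (∫⁻ x in N.cell i, W x ^ (-(1 / a)) ∂μ) ^ (a / b) ≤ K * μ (N.cell i) ^ (1 + a / b)) :
    BilinearData N E μ (μ.withDensity fun x => W x ^ (-(1 / a)))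
      (μ.withDensity fun x => W x ^ (1 / b)) a b (K ^ b) := by
  have hpos (c : ℝ) (i : J) : ∫⁻ x in N.cell i, W x ^ c ∂μ ≠ 0 := by
    rw [Ne, setLIntegral_eq_zero_iff (N.measurableSet_cell i) (hW.pow_const c)]
    intro h
    refine hμ0 i ?_
    refine measure_mono_null (fun x hx => ?_) h
    simp only [Set.mem_compl_iff, Set.mem_ofPred_eq, not_forall]
    refine ⟨hx, ?_⟩
    exact (ENNReal.rpow_pos (pos_iff_ne_zero.2 (hW0 x)) (hW1 x)).ne'
  have hKf (i : J) : K * μ (N.cell i) ^ (1 + a / b) ≠ ∞ :=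
    ENNReal.mul_ne_top hK1 (ENNReal.rpow_ne_top_of_nonneg (by positivity) (hμ1 i))
  have hdens (c : ℝ) (i : J) : (μ.withDensity fun x => W x ^ c) (N.cell i) =
      ∫⁻ x in N.cell i, W x ^ c ∂μ := withDensity_apply _ (N.measurableSet_cell i)
  refine ⟨hE, ?_, ?_, ?_, ?_, hμ0, hμ1, ?_, ?_⟩
  · intro i; rw [hdens]; exact hpos _ i
  · intro i htop
    rw [hdens] at htop
    have := hK i
    rw [htop, ENNReal.top_rpow_of_pos (by positivity), ENNReal.mul_top (hpos _ i)] at this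
    exact hKf i (top_le_iff.1 this)
  · intro i; rw [hdens]; exact hpos _ i
  · intro i htop
    rw [hdens] at htop
    have := hK i
    have h0 : (∫⁻ x in N.cell i, W x ^ (-(1 / a)) ∂μ) ^ (a / b) ≠ 0 := by
      rw [Ne, ENNReal.rpow_eq_zero_iff_of_pos (by positivity)]; exact hpos _ i
    rw [htop, ENNReal.top_mul h0] at this
    exact hKf i (top_le_iff.1 this)
  · intro i
    have hab : 0 < a + b := by positivity
    have h1 := lintegral_mul_le_rpow (μ := μ.restrict (E i)) (θ := a / (a + b)) (by positivity)
      (by rw [div_lt_one hab]; linarith) (f := fun x => W x ^ (-(1 / (a + b))))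
      (g := fun x => W x ^ (1 / (a + b))) (hW.pow_const _).aemeasurable (hW.pow_const _).aemeasurable
    have h2 : ∫⁻ x in E i, W x ^ (-(1 / (a + b))) * W x ^ (1 / (a + b)) ∂μ = μ (E i) := by
      simp_rw [← ENNReal.rpow_add _ _ (hW0 _) (hW1 _)]
      simp
    have e1 : -(1 / (a + b)) * (1 / (a / (a + b))) = -(1 / a) := by field_simp
    have e2 : 1 / (a + b) * (1 / (1 - a / (a + b))) = 1 / b := by
      rw [show 1 - a / (a + b) = b / (a + b) by field_simp; ring]; field_simp
    simp_rw [← ENNReal.rpow_mul] at h1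
    rw [h2, e1, e2] at h1
    rw [withDensity_apply _ (hE.measurableSet i), withDensity_apply _ (hE.measurableSet i)]
    refine (ENNReal.rpow_le_rpow h1 hab.le).trans (le_of_eq ?_)
    rw [ENNReal.mul_rpow_of_nonneg _ _ hab.le, ← ENNReal.rpow_mul, ← ENNReal.rpow_mul]
    congr 2
    · field_simp
    · field_simp; ring
  · intro i
    rw [hdens, hdens]
    have := ENNReal.rpow_le_rpow (hK i) hb.le
    rw [ENNReal.mul_rpow_of_nonneg _ _ hb.le, ENNReal.mul_rpow_of_nonneg _ _ hb.le,
      ← ENNReal.rpow_mul, ← ENNReal.rpow_mul, div_mul_cancel₀ _ hb.ne'] at this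
    refine this.trans (le_of_eq ?_)
    congr 2; field_simp; ring

/-- Sharp weighted bound for sparse operators from `L^p(W^p)` to `L^q(W^q)`, with `1/p = 1 - a` and
`1/q = b`. -/
theorem lintegral_sparseOp_rpow_le {a b : ℝ} (ha : 0 < a) (hb : 0 < b) (hab : a + b ≤ 1) :
    ∃ C : ℝ≥0∞, C ≠ ∞ ∧
    ∀ {X J : Type*} [MeasurableSpace X] [Countable J] {N : NestedFamily X J} {E : J → Set X}
      {μ : Measure X} [SigmaFinite μ] (_ : N.IsSparse μ E) (_ : ∀ i, μ (N.cell i) ≠ 0)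
      (_ : ∀ i, μ (N.cell i) ≠ ∞) {W : X → ℝ≥0∞} (_ : Measurable W) (_ : ∀ x, W x ≠ 0)
      (_ : ∀ x, W x ≠ ∞) {K : ℝ≥0∞} (_ : K ≠ ∞)
      (_ : ∀ i, (∫⁻ x in N.cell i, W x ^ (1 / b) ∂μ) *
        (∫⁻ x in N.cell i, W x ^ (-(1 / a)) ∂μ) ^ (a / b) ≤ K * μ (N.cell i) ^ (1 + a / b))
      {φ : X → ℝ≥0∞} (_ : Measurable φ),
    (∫⁻ x, (N.sparseOp μ (a + b) φ x * W x) ^ (1 / b) ∂μ) ^ b ≤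
      C * K ^ ((a + b) * max 1 (b / a)) *
        (∫⁻ x, (φ x * W x) ^ (1 / (1 - a)) ∂μ) ^ (1 - a) := by
  obtain ⟨C, hC, hform⟩ := sparseForm_le ha hb hab
  -- the constant has to be nonzero: the right-hand side must be `∞` where the norm of `φ` is
  refine ⟨C + 1, by finiteness, fun {X J} _ _ {N E μ} _ hE hμ0 hμ1 {W} hW hW0 hW1 {K} hK1 hK
    {φ} hφ => ?_⟩
  have ha1 : 0 < 1 - a := by linarith
  have hb1 : b < 1 := by linarith
  have hd := bilinearData_of_weight ha hb hE hμ0 hμ1 hW hW0 hW1 hK1 hK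
  set σ := μ.withDensity fun x => W x ^ (-(1 / a)) with hσ
  set u := μ.withDensity fun x => W x ^ (1 / b) with hu
  rcases isEmpty_or_nonempty J with hJ | ⟨⟨i₀⟩⟩
  · have : ∀ x, N.sparseOp μ (a + b) φ x = 0 := fun x => by simp [sparseOp]
    simp [this, hb]
  have hK0 : K ≠ 0 := by
    rintro rfl
    have h := hd.muckenhoupt i₀
    rw [ENNReal.zero_rpow_of_pos hb, zero_mul, nonpos_iff_eq_zero, mul_eq_zero,
      ENNReal.rpow_eq_zero_iff_of_pos hb, ENNReal.rpow_eq_zero_iff_of_pos ha] at h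
    exact h.elim (hd.u_ne_zero i₀) (hd.sigma_ne_zero i₀)
  have hK' : K ^ ((a + b) * max 1 (b / a)) ≠ 0 :=
    (ENNReal.rpow_pos (pos_iff_ne_zero.2 hK0) hK1).ne'
  rcases eq_or_ne (∫⁻ x, (φ x * W x) ^ (1 / (1 - a)) ∂μ) ∞ with htop | hfin
  · rw [htop, ENNReal.top_rpow_of_pos ha1, ENNReal.mul_top (mul_ne_zero (by simp) hK')]
    exact le_top
  have hWσ : Measurable fun x => W x ^ (-(1 / a)) := hW.pow_const _
  have hWu : Measurable fun x => W x ^ (1 / b) := hW.pow_const _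
  set f : X → ℝ≥0∞ := fun x => φ x * W x ^ (1 / a) with hf
  have hfm : Measurable f := hφ.mul (hW.pow_const _)
  have hcancel (x : X) : W x ^ (-(1 / a)) * f x = φ x := by
    rw [hf]
    simp only
    rw [mul_left_comm, ← ENNReal.rpow_add _ _ (hW0 x) (hW1 x), neg_add_cancel, ENNReal.rpow_zero,
      mul_one]
  have hfσ : ∫⁻ x, f x ^ (1 / (1 - a)) ∂σ = ∫⁻ x, (φ x * W x) ^ (1 / (1 - a)) ∂μ := by
    rw [hσ, lintegral_withDensity_eq_lintegral_mul _ hWσ (hfm.pow_const _)]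
    refine lintegral_congr fun x => ?_
    simp only [Pi.mul_apply, hf]
    rw [ENNReal.mul_rpow_of_nonneg _ _ (by positivity), ENNReal.mul_rpow_of_nonneg _ _ (by positivity),
      mul_left_comm, ← ENNReal.rpow_mul, ← ENNReal.rpow_add _ _ (hW0 x) (hW1 x)]
    congr 2; field_simp; ring
  have hformeq (g : X → ℝ≥0∞) : N.sparseForm μ μ u (a + b) φ g = N.sparseForm μ σ u (a + b) f g := by
    refine tsum_congr fun i => ?_
    congr 2
    rw [hσ, setLIntegral_withDensity_eq_setLIntegral_mul _ hWσ hfm (N.measurableSet_cell i)]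
    exact (setLIntegral_congr_fun (N.measurableSet_cell i) fun x _ => hcancel x).symm
  have : SigmaFinite u := SigmaFinite.withDensity_of_ne_top (ae_of_all _ fun x =>
      ENNReal.rpow_ne_top_of_nonneg (by positivity) (hW1 x))
  have hdual := lintegral_rpow_le_of_dual (ν := u) hb hb1 (N.measurable_sparseOp μ (a + b) φ)
    (M := C * (K ^ b) ^ ((a + b) / b * max 1 (b / a)) *
        (∫⁻ x, (φ x * W x) ^ (1 / (1 - a)) ∂μ) ^ (1 - a)) (fun g hg hgfin => by
      rw [lintegral_sparseOp_mul _ _ _ _ _ hg, hformeq, ← hfσ]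
      refine (hform hd hfm hg (by rw [hfσ]; exact hfin) hgfin).trans (le_of_eq (by ring)))
  have hlhs : ∫⁻ x, (N.sparseOp μ (a + b) φ x * W x) ^ (1 / b) ∂μ =
      ∫⁻ x, N.sparseOp μ (a + b) φ x ^ (1 / b) ∂u := by
    rw [hu, lintegral_withDensity_eq_lintegral_mul _ hWu ((N.measurable_sparseOp _ _ _).pow_const _)]
    refine lintegral_congr fun x => ?_
    simp only [Pi.mul_apply]
    rw [ENNReal.mul_rpow_of_nonneg _ _ (by positivity), mul_comm]
  rw [hlhs]
  refine hdual.trans ?_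
  have hexp : b * ((a + b) / b * max 1 (b / a)) = (a + b) * max 1 (b / a) := by
    rw [← mul_assoc, mul_div_cancel₀ _ hb.ne']
  rw [← ENNReal.rpow_mul, hexp]
  gcongr
  exact le_self_add

end NestedFamily

/-! ### Powers of sums along chains of cells -/

/-- The sum of `a` over all indices related to `R`. -/
noncomputable def sumBelow {J : Type*} (r : J → J → Prop) (a : J → ℝ≥0∞) (R : J) : ℝ≥0∞ :=
  ∑' P, {P | r P R}.indicator a P

/-- A discrete form of `(∫ a)^{k+1} = (k+1) ∫ a (∫ a)^k` for sums along a chain, with a worse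
constant. -/
theorem sumBelow_pow_succ_le {J : Type*} {r : J → J → Prop} {a : J → ℝ≥0∞}
    (htrans : ∀ i j k, r i j → r j k → r i k)
    (htotal : ∀ i j, a i ≠ 0 → a j ≠ 0 → r i j ∨ r j i) (k : ℕ) (R : J) :
    sumBelow r a R ^ (k + 1) ≤ 2 ^ k * sumBelow r (fun P => a P * sumBelow r a P ^ k) R := by
  have hmono {P R : J} (h : r P R) : sumBelow r a P ≤ sumBelow r a R := by
    refine ENNReal.tsum_le_tsum fun i => ?_
    exact Set.indicator_le_indicator_of_subset (fun j hj => htrans _ _ _ hj h) (fun _ => zero_le) i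
  induction k generalizing R with
  | zero => simp
  | succ k ih =>
    have key (P P' : J) : {P | r P R}.indicator (fun P => a P * sumBelow r a P ^ k) P *
        {P | r P R}.indicator a P' ≤
        {P | r P R}.indicator (fun P => a P * sumBelow r a P ^ k) P * {P' | r P' P}.indicator a P' +
        {P | r P R}.indicator (fun P => a P * sumBelow r a P ^ k) P' *
          {P | r P P'}.indicator a P := by
      by_cases hP : r P R
      swap
      · rw [Set.indicator_of_notMem (by exact hP), zero_mul]; exact zero_le
      by_cases hP' : r P' R
      swap
      · rw [Set.indicator_of_notMem (s := {P | r P R}) (a := P') (f := a) (by exact hP'), mul_zero]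
        exact zero_le
      simp only [Set.indicator_of_mem (show P ∈ {P | r P R} from hP),
        Set.indicator_of_mem (show P' ∈ {P | r P R} from hP')]
      rcases eq_or_ne (a P) 0 with h0 | h0
      · simp [h0]
      rcases eq_or_ne (a P') 0 with h0' | h0'
      · simp [h0']
      rcases htotal P P' h0 h0' with h | h
      · refine le_trans ?_ le_add_self
        rw [Set.indicator_of_mem (by exact h)]
        calc a P * sumBelow r a P ^ k * a P' ≤ a P * sumBelow r a P' ^ k * a P' := by
              gcongr; exact hmono h
          _ = _ := by ring
      · refine le_trans ?_ le_self_add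
        rw [Set.indicator_of_mem (s := {P' | r P' P}) (by exact h)]
    calc sumBelow r a R ^ (k + 1 + 1)
        ≤ 2 ^ k * sumBelow r (fun P => a P * sumBelow r a P ^ k) R * sumBelow r a R := by
          rw [pow_succ]; gcongr; exact ih R
      _ = 2 ^ k * ∑' P, ∑' P', {P | r P R}.indicator (fun P => a P * sumBelow r a P ^ k) P *
            {P | r P R}.indicator a P' := by
          rw [mul_assoc]
          congr 1
          unfold sumBelow
          rw [← ENNReal.tsum_mul_right]
          simp_rw [← ENNReal.tsum_mul_left]
      _ ≤ 2 ^ k * ∑' P, ∑' P', ({P | r P R}.indicator (fun P => a P * sumBelow r a P ^ k) P *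
            {P' | r P' P}.indicator a P' +
          {P | r P R}.indicator (fun P => a P * sumBelow r a P ^ k) P' *
            {P | r P P'}.indicator a P) := by
          gcongr with P P'; exact key P P'
      _ = 2 ^ k * (∑' P, {P | r P R}.indicator (fun P => a P * sumBelow r a P ^ k) P *
            sumBelow r a P + ∑' P', {P | r P R}.indicator (fun P => a P * sumBelow r a P ^ k) P' *
            sumBelow r a P') := by
          simp_rw [ENNReal.tsum_add]
          congr 2
          · simp_rw [ENNReal.tsum_mul_left]; rfl
          · rw [ENNReal.tsum_comm]; simp_rw [ENNReal.tsum_mul_left]; rfl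
      _ = _ := by
          rw [← two_mul, ← mul_assoc, ← pow_succ]
          congr 1
          refine tsum_congr fun P => ?_
          by_cases hP : r P R
          · rw [Set.indicator_of_mem (by exact hP), Set.indicator_of_mem (by exact hP), pow_succ,
              mul_assoc]
          · rw [Set.indicator_of_notMem (by exact hP), Set.indicator_of_notMem (by exact hP),
              zero_mul]

namespace NestedFamily

variable {X J : Type*} [MeasurableSpace X] (N : NestedFamily X J) (μ : Measure X)

/-- The sum over the cells `P` below `R` of the averages `η_P χ_P`. -/
noncomputable def chainSum (η : X → ℝ≥0∞) (R : J) (x : X) : ℝ≥0∞ :=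
  sumBelow N.Below (fun P => (N.cell P).indicator (fun _ => N.avg μ η P) x) R

variable {N μ} {η : X → ℝ≥0∞}

theorem chainSum_pow_succ_le (k : ℕ) (R : J) (x : X) :
    N.chainSum μ η R x ^ (k + 1) ≤ 2 ^ k * ∑' P, {P | N.Below P R}.indicator (fun P =>
      (N.cell P).indicator (fun _ => N.avg μ η P) x * N.chainSum μ η P x ^ k) P := by
  refine sumBelow_pow_succ_le (fun i j k => Below.trans) (fun i j hi hj => ?_) k R
  exact below_or_below_of_mem (Set.mem_of_indicator_ne_zero hi) (Set.mem_of_indicator_ne_zero hj)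

theorem measurable_chainSum [Countable J] (R : J) : Measurable (N.chainSum μ η R) := by
  refine Measurable.tsum fun P => ?_
  by_cases hP : N.Below P R
  · simp only [Set.indicator_of_mem (show P ∈ {P | N.Below P R} from hP)]
    exact measurable_const.indicator (N.measurableSet_cell P)
  · simp only [Set.indicator_of_notMem (show P ∉ {P | N.Below P R} from hP)]
    exact measurable_const

theorem sparseOp_one_eq (φ : X → ℝ≥0∞) (x : X) :
    N.sparseOp μ 1 φ x = ∑' i, (N.cell i).indicator (fun _ => N.avg μ φ i) x := by
  unfold sparseOp avg
  simp_rw [ENNReal.rpow_neg_one, div_eq_mul_inv, mul_comm]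

theorem sparseOp_mono {s : ℝ} {φ ψ : X → ℝ≥0∞} (h : ∀ x, φ x ≤ ψ x) (x : X) :
    N.sparseOp μ s φ x ≤ N.sparseOp μ s ψ x := by
  refine ENNReal.tsum_le_tsum fun i => Set.indicator_le_indicator ?_
  exact mul_le_mul_right (lintegral_mono h) _

variable (N μ η)

/-- The operator `g ↦ A(η g)`, where `A` sums averages over the cells. -/
noncomputable def opMulRight (g : X → ℝ≥0∞) : X → ℝ≥0∞ :=
  N.sparseOp μ 1 fun y => η y * g y

/-- The operator `g ↦ η A(g)`, where `A` sums averages over the cells. -/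
noncomputable def opMulLeft (g : X → ℝ≥0∞) : X → ℝ≥0∞ := fun y => η y * N.sparseOp μ 1 g y

variable {N μ η}

theorem opMulRight_iterate_mono (k : ℕ) {g h : X → ℝ≥0∞} (hgh : ∀ x, g x ≤ h x) (x : X) :
    (N.opMulRight μ η)^[k] g x ≤ (N.opMulRight μ η)^[k] h x := by
  induction k generalizing g h with
  | zero => exact hgh x
  | succ k ih =>
    rw [Function.iterate_succ_apply, Function.iterate_succ_apply]
    exact ih fun y => sparseOp_mono (fun z => mul_le_mul_right (hgh z) _) y

theorem measurable_opMulLeft_iterate [Countable J] (hη : Measurable η) (k : ℕ) {g : X → ℝ≥0∞}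
    (hg : Measurable g) : Measurable ((N.opMulLeft μ η)^[k] g) := by
  cases k with
  | zero => exact hg
  | succ k =>
    rw [Function.iterate_succ_apply']
    exact hη.mul (N.measurable_sparseOp _ _ _)

theorem measurable_opMulRight_iterate [Countable J] (k : ℕ) {g : X → ℝ≥0∞}
    (hg : Measurable g) : Measurable ((N.opMulRight μ η)^[k] g) := by
  cases k with
  | zero => exact hg
  | succ k =>
    rw [Function.iterate_succ_apply']
    exact N.measurable_sparseOp _ _ _

/-- Powers of chain sums are absorbed by iterating the sparse operator on the outside. -/
theorem tsum_mul_chainSum_pow_le (k : ℕ) (c : J → ℝ≥0∞) (x : X) :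
    ∑' R, (N.cell R).indicator (fun _ => c R) x * N.chainSum μ η R x ^ k ≤
      2 ^ (k * k) * (N.opMulRight μ η)^[k]
        (fun y => ∑' R, (N.cell R).indicator (fun _ => c R) y) x := by
  induction k generalizing c with
  | zero => simp
  | succ k ih =>
    set c' : J → ℝ≥0∞ := fun P => N.avg μ η P * ∑' R, {R | N.Below P R}.indicator c R with hc'
    have h1 : ∑' R, (N.cell R).indicator (fun _ => c R) x * N.chainSum μ η R x ^ (k + 1) ≤
        2 ^ k * ∑' P, (N.cell P).indicator (fun _ => c' P) x * N.chainSum μ η P x ^ k := by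
      calc _ ≤ ∑' R, ∑' P, 2 ^ k * (c R * {P | N.Below P R}.indicator (fun P =>
            (N.cell P).indicator (fun _ => N.avg μ η P) x * N.chainSum μ η P x ^ k) P) := by
            refine ENNReal.tsum_le_tsum fun R => ?_
            rw [ENNReal.tsum_mul_left, ENNReal.tsum_mul_left, mul_left_comm]
            exact mul_le_mul' (Set.indicator_le_self' (fun _ _ => zero_le) x)
              (chainSum_pow_succ_le k R x)
        _ = 2 ^ k * ∑' P, ∑' R, c R * {P | N.Below P R}.indicator (fun P =>
            (N.cell P).indicator (fun _ => N.avg μ η P) x * N.chainSum μ η P x ^ k) P := by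
            rw [ENNReal.tsum_comm]; simp_rw [ENNReal.tsum_mul_left]
        _ = _ := by
            congr 1
            refine tsum_congr fun P => ?_
            by_cases hx : x ∈ N.cell P
            · simp only [Set.indicator_of_mem hx, hc']
              rw [mul_assoc, mul_comm (∑' R, _), ← mul_assoc, ← ENNReal.tsum_mul_left]
              refine tsum_congr fun R => ?_
              by_cases hR : N.Below P R
              · rw [Set.indicator_of_mem (show P ∈ {P | N.Below P R} from hR),
                  Set.indicator_of_mem (show R ∈ {R | N.Below P R} from hR),
                  Set.indicator_of_mem hx, mul_comm]
              · rw [Set.indicator_of_notMem (show P ∉ {P | N.Below P R} from hR),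
                  Set.indicator_of_notMem (show R ∉ {R | N.Below P R} from hR), mul_zero, mul_zero]
            · simp [Set.indicator_of_notMem hx]
    have h2 (y : X) : ∑' P, (N.cell P).indicator (fun _ => c' P) y ≤
        N.opMulRight μ η (fun y => ∑' R, (N.cell R).indicator (fun _ => c R) y) y := by
      unfold opMulRight
      rw [sparseOp_one_eq]
      refine ENNReal.tsum_le_tsum fun P => Set.indicator_le_indicator ?_
      simp only [hc', avg]
      rw [ENNReal.div_eq_inv_mul, ENNReal.div_eq_inv_mul, mul_assoc]
      gcongr
      refine (lintegral_mul_const_le _ _).trans ?_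
      refine setLIntegral_mono_ae' (N.measurableSet_cell P) (ae_of_all _ fun z hz => ?_)
      gcongr with R
      by_cases hR : N.Below P R
      · rw [Set.indicator_of_mem (by exact hR), Set.indicator_of_mem (hR.2 hz)]
      · rw [Set.indicator_of_notMem (by exact hR)]; exact zero_le
    calc _ ≤ 2 ^ k * (2 ^ (k * k) * (N.opMulRight μ η)^[k]
          (fun y => ∑' R, (N.cell R).indicator (fun _ => c' R) y) x) :=
          h1.trans (mul_le_mul_right (ih c') _)
      _ ≤ 2 ^ ((k + 1) * (k + 1)) * (N.opMulRight μ η)^[k] (N.opMulRight μ η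
          (fun y => ∑' R, (N.cell R).indicator (fun _ => c R) y)) x := by
          rw [← mul_assoc, ← pow_add]
          gcongr ?_ * ?_
          · exact pow_le_pow_right₀ (by norm_num) (by nlinarith)
          · exact opMulRight_iterate_mono k h2 x
      _ = _ := by rw [Function.iterate_succ_apply]

/-- Powers of chain sums are absorbed by iterating the sparse operator on the inside. -/
theorem lintegral_chainSum_pow_mul_le [Countable J] (hη : Measurable η) (k : ℕ) {f : X → ℝ≥0∞}
    (hf : Measurable f) (R : J) :
    ∫⁻ x in N.cell R, N.chainSum μ η R x ^ k * f x ∂μ ≤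
      2 ^ (k * k) * ∫⁻ x in N.cell R, (N.opMulLeft μ η)^[k] f x ∂μ := by
  induction k generalizing R with
  | zero => simp
  | succ k ih =>
    set φ := (N.opMulLeft μ η)^[k] f with hφ
    have hφm : Measurable φ := measurable_opMulLeft_iterate hη k hf
    have hm (P : J) : Measurable fun x => (N.cell P).indicator
        (fun x => N.chainSum μ η P x ^ k * f x) x :=
      (((measurable_chainSum P).pow_const k).mul hf).indicator (N.measurableSet_cell P)
    calc ∫⁻ x in N.cell R, N.chainSum μ η R x ^ (k + 1) * f x ∂μ
        ≤ ∫⁻ x in N.cell R, 2 ^ k * ∑' P, {P | N.Below P R}.indicator (fun P =>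
            N.avg μ η P * (N.cell P).indicator
              (fun x => N.chainSum μ η P x ^ k * f x) x) P ∂μ := by
          refine lintegral_mono fun x => ?_
          refine (mul_le_mul_left (chainSum_pow_succ_le k R x) (f x)).trans (le_of_eq ?_)
          rw [mul_assoc, ← ENNReal.tsum_mul_right]
          congr 1
          refine tsum_congr fun P => ?_
          by_cases hP : N.Below P R
          · simp only [Set.indicator_of_mem (show P ∈ {P | N.Below P R} from hP)]
            by_cases hx : x ∈ N.cell P
            · simp only [Set.indicator_of_mem hx]; ring
            · simp only [Set.indicator_of_notMem hx]; ring
          · rw [Set.indicator_of_notMem (by exact hP), Set.indicator_of_notMem (by exact hP),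
              zero_mul]
      _ ≤ 2 ^ k * ∑' P, {P | N.Below P R}.indicator (fun P =>
            N.avg μ η P * ∫⁻ x in N.cell P, N.chainSum μ η P x ^ k * f x ∂μ) P := by
          have hmm (P : J) : Measurable fun x => {P | N.Below P R}.indicator (fun P =>
              N.avg μ η P * (N.cell P).indicator
                (fun x => N.chainSum μ η P x ^ k * f x) x) P := by
            by_cases hP : N.Below P R
            · simp only [Set.indicator_of_mem (show P ∈ {P | N.Below P R} from hP)]
              exact (hm P).const_mul _
            · simp only [Set.indicator_of_notMem (show P ∉ {P | N.Below P R} from hP)]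
              exact measurable_const
          rw [lintegral_const_mul _ (Measurable.tsum hmm),
            lintegral_tsum fun P => (hmm P).aemeasurable]
          gcongr with P
          by_cases hP : N.Below P R
          · simp only [Set.indicator_of_mem (show P ∈ {P | N.Below P R} from hP)]
            rw [lintegral_const_mul _ (hm P), ← lintegral_indicator (N.measurableSet_cell P)]
            exact mul_le_mul_right (setLIntegral_le_lintegral _ _) _
          · simp [Set.indicator_of_notMem (show P ∉ {P | N.Below P R} from hP)]
      _ ≤ 2 ^ k * ∑' P, 2 ^ (k * k) * ∫⁻ x in N.cell R,
            (N.cell P).indicator (fun x => η x * N.avg μ φ P) x ∂μ := by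
          gcongr with P
          by_cases hP : N.Below P R
          · rw [Set.indicator_of_mem (by exact hP), setLIntegral_indicator (N.measurableSet_cell P),
              Set.inter_eq_left.2 hP.2, lintegral_mul_const _ hη]
            calc N.avg μ η P * ∫⁻ x in N.cell P, N.chainSum μ η P x ^ k * f x ∂μ
                ≤ N.avg μ η P * (2 ^ (k * k) * ∫⁻ x in N.cell P, φ x ∂μ) := by gcongr; exact ih P
              _ = _ := by simp only [avg, div_eq_mul_inv]; ring
          · rw [Set.indicator_of_notMem (by exact hP)]; exact zero_le
      _ = 2 ^ k * 2 ^ (k * k) * ∫⁻ x in N.cell R, η x * N.sparseOp μ 1 φ x ∂μ := by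
          rw [ENNReal.tsum_mul_left, ← lintegral_tsum fun P =>
            ((hη.mul_const _).indicator (N.measurableSet_cell P)).aemeasurable, mul_assoc]
          congr 2
          refine lintegral_congr fun x => ?_
          rw [sparseOp_one_eq, ← ENNReal.tsum_mul_left]
          refine tsum_congr fun P => ?_
          by_cases hx : x ∈ N.cell P
          · simp only [Set.indicator_of_mem hx]
          · simp only [Set.indicator_of_notMem hx, mul_zero]
      _ ≤ _ := by
          rw [← pow_add, Function.iterate_succ_apply']
          refine mul_le_mul' ?_ le_rfl
          exact pow_le_pow_right₀ (by norm_num) (by nlinarith)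

end NestedFamily

/-! ### Grids and stopping cells -/

/-- A refining sequence of partitions of `X`, given by the labels of the points: the cells of level
`k` are the fibres of `idx k`. -/
structure Grid (X Z : Type*) [MeasurableSpace X] where
  /-- The label of the cell of level `k` that contains a point. -/
  idx : ℕ → X → Z
  /-- The label of the parent of a cell. -/
  par : Z → Z
  idx_par : ∀ k x, idx k x = par (idx (k + 1) x)
  measurableSet : ∀ k z, MeasurableSet {x | idx k x = z}
  nonempty : ∀ k z, ∃ x, idx k x = z

namespace Grid

variable {X Z : Type*} [MeasurableSpace X] (G : Grid X Z)

theorem idx_eq_of_le {k l : ℕ} (hkl : k ≤ l) {x y : X} (h : G.idx l x = G.idx l y) :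
    G.idx k x = G.idx k y := by
  induction l, hkl using Nat.le_induction with
  | base => exact h
  | succ l _ ih => exact ih (by rw [G.idx_par l x, G.idx_par l y, h])

/-- The nested family of all cells of a grid. -/
def family : NestedFamily X (ℕ × Z) where
  cell i := {x | G.idx i.1 x = i.2}
  lev i := i.1
  measurableSet_cell i := G.measurableSet i.1 i.2
  nonempty_cell i := G.nonempty i.1 i.2
  nested i j hij := by
    rintro ⟨x, hx, hx'⟩ y hy
    simp only [Set.mem_ofPred_eq] at *
    rw [← hx]
    exact G.idx_eq_of_le hij (hy.trans hx'.symm)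
  eq_of_lev_eq i j hij := by
    rintro ⟨x, hx, hx'⟩
    simp only [Set.mem_ofPred_eq] at *
    exact Prod.ext hij (by rw [← hx, ← hx', hij])

/-- The cell of level `k` that contains `x`. -/
def at' (k : ℕ) (x : X) : ℕ × Z := (k, G.idx k x)

variable {G}

theorem mem_cell_iff {i : ℕ × Z} {x : X} : x ∈ G.family.cell i ↔ G.idx i.1 x = i.2 := Iff.rfl

theorem mem_cell_at (k : ℕ) (x : X) : x ∈ G.family.cell (G.at' k x) := rfl

theorem eq_at_of_mem {i : ℕ × Z} {x : X} (h : x ∈ G.family.cell i) : i = G.at' i.1 x :=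
  Prod.ext rfl h.symm

theorem below_at {i : ℕ × Z} {x : X} (h : x ∈ G.family.cell i) {k : ℕ} (hk : i.1 ≤ k) :
    G.family.Below (G.at' k x) i :=
  ⟨hk, G.family.nested i (G.at' k x) hk ⟨x, h, mem_cell_at k x⟩⟩

theorem below_par (k : ℕ) (z : Z) : G.family.Below (k + 1, z) (k, G.par z) := by
  refine ⟨Nat.le_succ k, fun x hx => ?_⟩
  rw [mem_cell_iff] at hx ⊢
  rw [G.idx_par, hx]

section Stopping

variable (G) (cond : ℕ × Z → ℕ × Z → Prop)

open Classical in
/-- The stopping ancestor of a cell: on the way down from the top level, the current cell replaces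
the previous stopping cell as soon as the condition holds. -/
noncomputable def anc : ℕ → Z → ℕ × Z
  | 0, z => (0, z)
  | k + 1, z => if cond (anc k (G.par z)) (k + 1, z) then (k + 1, z) else anc k (G.par z)

/-- The stopping cells. -/
def stopping : Set (ℕ × Z) := {i | G.anc cond i.1 i.2 = i}

variable {G cond}

theorem anc_eq_or (k : ℕ) (z : Z) : G.anc cond (k + 1) z = (k + 1, z) ∧
    cond (G.anc cond k (G.par z)) (k + 1, z) ∨
    G.anc cond (k + 1) z = G.anc cond k (G.par z) ∧
      ¬ cond (G.anc cond k (G.par z)) (k + 1, z) := by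
  rw [anc]
  split_ifs with h
  · exact Or.inl ⟨rfl, h⟩
  · exact Or.inr ⟨rfl, h⟩

theorem below_anc (k : ℕ) (z : Z) : G.family.Below (k, z) (G.anc cond k z) := by
  induction k generalizing z with
  | zero => exact NestedFamily.Below.refl _
  | succ k ih =>
    rcases anc_eq_or (G := G) (cond := cond) k z with ⟨h, -⟩ | ⟨h, -⟩
    · rw [h]; exact NestedFamily.Below.refl _
    · rw [h]; exact (below_par k z).trans (ih _)

theorem anc_fst_le (k : ℕ) (z : Z) : (G.anc cond k z).1 ≤ k := (below_anc k z).1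

theorem anc_mem_stopping (k : ℕ) (z : Z) : G.anc cond k z ∈ G.stopping cond := by
  induction k generalizing z with
  | zero => exact rfl
  | succ k ih =>
    rcases anc_eq_or (G := G) (cond := cond) k z with ⟨h, -⟩ | ⟨h, -⟩
    · rw [h]; exact h
    · rw [h]; exact ih _

theorem cond_of_mem_stopping {k : ℕ} {z : Z} (h : (k + 1, z) ∈ G.stopping cond) :
    cond (G.anc cond k (G.par z)) (k + 1, z) := by
  rcases anc_eq_or (G := G) (cond := cond) k z with ⟨-, h'⟩ | ⟨h', -⟩
  · exact h'
  · have h1 : G.anc cond (k + 1) z = (k + 1, z) := h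
    have h2 := anc_fst_le (G := G) (cond := cond) k (G.par z)
    rw [← h', h1] at h2
    exact absurd h2 (by simp)

/-- The stopping ancestor is the smallest stopping cell that contains a given cell. -/
theorem anc_below_of_below {k : ℕ} {z : Z} {R : ℕ × Z} (hR : R ∈ G.stopping cond)
    (h : G.family.Below (k, z) R) : G.family.Below (G.anc cond k z) R := by
  induction k generalizing z with
  | zero =>
    have : ((0, z) : ℕ × Z) = R := h.eq_of_lev_le (Nat.zero_le _)
    exact this ▸ NestedFamily.Below.refl _
  | succ k ih =>
    rcases anc_eq_or (G := G) (cond := cond) k z with ⟨h', -⟩ | ⟨h', -⟩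
    · rw [h']; exact h
    · rcases Nat.lt_or_ge R.1 (k + 1) with hlt | hge
      · rw [h']
        refine ih ?_
        obtain ⟨x, hx⟩ := G.family.nonempty_cell (k + 1, z)
        have h1 := (below_par k z).2 hx
        have := below_at (h.2 hx) (Nat.lt_succ_iff.1 hlt)
        rwa [← eq_at_of_mem h1] at this
      · have : ((k + 1, z) : ℕ × Z) = R := h.eq_of_lev_le hge
        rw [← this] at hR ⊢
        rw [show G.anc cond (k + 1) z = (k + 1, z) from hR]
        exact NestedFamily.Below.refl _

variable (G cond)

/-- The part of a cell that is not covered by smaller stopping cells. -/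
def core (R : ℕ × Z) : Set X :=
  G.family.cell R \ ⋃ P ∈ {P | P ∈ G.stopping cond ∧ G.family.Below P R ∧ P ≠ R}, G.family.cell P

variable {G cond}

theorem measurableSet_core [Countable Z] (R : ℕ × Z) : MeasurableSet (G.core cond R) :=
  (G.family.measurableSet_cell R).diff
    (MeasurableSet.biUnion (Set.to_countable _) fun P _ => G.family.measurableSet_cell P)

theorem disjoint_core {R R' : ℕ × Z} (hR : R ∈ G.stopping cond) (hR' : R' ∈ G.stopping cond)
    (h : R ≠ R') : Disjoint (G.core cond R) (G.core cond R') := by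
  rw [Set.disjoint_left]
  rintro x ⟨hx, hx'⟩ ⟨hy, hy'⟩
  simp only [Set.mem_iUnion, exists_prop, not_exists, not_and] at hx' hy'
  rcases NestedFamily.below_or_below_of_mem hx hy with hb | hb
  · exact hy' R ⟨hR, hb, h⟩ hx
  · exact hx' R' ⟨hR', hb, h.symm⟩ hy

/-- A smaller stopping cell is contained in a cell at which the process stopped directly after
the given one. -/
theorem exists_cond_of_mem {R P : ℕ × Z} {x : X} (hR : R ∈ G.stopping cond)
    (hP : P ∈ G.stopping cond) (hPR : G.family.Below P R) (hne : P ≠ R) (hx : x ∈ G.family.cell P) :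
    ∃ Q, G.family.Below Q R ∧ cond R Q ∧ x ∈ G.family.cell Q := by
  classical
  have hlt : R.1 < P.1 := by
    rcases Nat.lt_or_ge R.1 P.1 with h | h
    · exact h
    · exact absurd (hPR.eq_of_lev_le h) hne
  have hex : ∃ k, R.1 < k ∧ G.at' k x ∈ G.stopping cond :=
    ⟨P.1, hlt, by rwa [← eq_at_of_mem hx]⟩
  obtain ⟨hk, hkS⟩ := Nat.find_spec hex
  obtain ⟨k, hkeq⟩ : ∃ k, Nat.find hex = k + 1 := ⟨Nat.find hex - 1, by omega⟩
  rw [hkeq] at hk hkS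
  have hxR : x ∈ G.family.cell R := hPR.2 hx
  refine ⟨G.at' (k + 1) x, below_at hxR hk.le, ?_, mem_cell_at _ _⟩
  have h1 := cond_of_mem_stopping hkS
  suffices G.anc cond k (G.par (G.idx (k + 1) x)) = R by rwa [this] at h1
  rw [← G.idx_par]
  have hkR : G.family.Below (G.at' k x) R := below_at hxR (Nat.lt_succ_iff.1 hk)
  have hle : G.family.Below (G.anc cond k (G.idx k x)) R := anc_below_of_below hR hkR
  refine hle.eq_of_lev_le ?_
  by_contra hcon
  have hxA : x ∈ G.family.cell (G.anc cond k (G.idx k x)) :=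
    (below_anc k (G.idx k x)).2 (mem_cell_at k x)
  have hAlt : R.1 < (G.anc cond k (G.idx k x)).1 := not_le.1 hcon
  have hmin := Nat.find_min' hex ⟨hAlt, by
    rw [← eq_at_of_mem hxA]; exact anc_mem_stopping _ _⟩
  have := anc_fst_le (G := G) (cond := cond) k (G.idx k x)
  omega

end Stopping

end Grid

/-- The nested family of the cells in `S`. -/
def NestedFamily.restrict {X J : Type*} [MeasurableSpace X] (N : NestedFamily X J) (S : Set J) :
    NestedFamily X S where
  cell i := N.cell i
  lev i := N.lev i
  measurableSet_cell i := N.measurableSet_cell i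
  nonempty_cell i := N.nonempty_cell i
  nested i j := N.nested i j
  eq_of_lev_eq i j h h' := Subtype.ext (N.eq_of_lev_eq i j h h')

namespace Grid

variable {X Z : Type*} [MeasurableSpace X] {G : Grid X Z} {μ : Measure X} {M : ℕ}
  {Φ : ℕ × Z → Fin M → X → ℝ≥0∞}

variable (G μ Φ) in
/-- The stopping condition: some average of the functions attached to the stopping cell `R` is much
larger over `Q` than over `R`. -/
def stopCond (R Q : ℕ × Z) : Prop :=
  ∃ l, 2 * M * G.family.avg μ (Φ R l) R < G.family.avg μ (Φ R l) Q

theorem avg_anc_le (k : ℕ) (z : Z) (l : Fin M) :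
    G.family.avg μ (Φ (G.anc (G.stopCond μ Φ) k z) l) (k, z) ≤
      2 * M * G.family.avg μ (Φ (G.anc (G.stopCond μ Φ) k z) l) (G.anc (G.stopCond μ Φ) k z) := by
  have h1 : (1 : ℝ≥0∞) ≤ 2 * M := by
    have : 1 ≤ 2 * M := by have := l.pos; omega
    exact_mod_cast this
  have htriv (y : ℝ≥0∞) : y ≤ 2 * M * y := le_mul_of_one_le_left' h1
  cases k with
  | zero => exact htriv _
  | succ k =>
    rcases anc_eq_or (G := G) (cond := G.stopCond μ Φ) k z with ⟨h, -⟩ | ⟨h, h'⟩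
    · rw [h]; exact htriv _
    · rw [h]
      exact not_lt.1 fun hlt => h' ⟨l, hlt⟩

/-- By the weak type inequality, the cells below `R` on which one given function out of `M` triggers
the stopping condition occupy at most the fraction `1 / (2 M)` of `R`, hence all of them at most one
half. -/
theorem isSparse_stopping [Countable Z] (hμ1 : ∀ i, μ (G.family.cell i) ≠ ∞) :
    (G.family.restrict (G.stopping (G.stopCond μ Φ))).IsSparse μ
      fun R => G.core (G.stopCond μ Φ) R where
  measurableSet R := measurableSet_core _
  subset R := Set.sdiff_subset
  disjoint R R' h := disjoint_core R.2 R'.2 fun h' => h (Subtype.ext h')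
  le R := by
    obtain ⟨R, hR⟩ := R
    set cond := G.stopCond μ Φ with hcond
    change μ (G.family.cell R) ≤ 2 * μ (G.core cond R)
    set U := ⋃ P ∈ {P | P ∈ G.stopping cond ∧ G.family.Below P R ∧ P ≠ R}, G.family.cell P with hU
    set A : Fin M → Set (ℕ × Z) := fun l => {Q | G.family.Below Q R ∧
      2 * M * G.family.avg μ (Φ R l) R < G.family.avg μ (Φ R l) Q} with hA
    have hsub : U ⊆ ⋃ l, ⋃ Q ∈ A l, G.family.cell Q := by
      intro x hx
      simp only [hU, Set.mem_iUnion, exists_prop] at hx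
      obtain ⟨P, ⟨hP, hPR, hne⟩, hx⟩ := hx
      obtain ⟨Q, hQR, ⟨l, hl⟩, hxQ⟩ := exists_cond_of_mem hR hP hPR hne hx
      simp only [Set.mem_iUnion, exists_prop]
      exact ⟨l, Q, ⟨hQR, hl⟩, hxQ⟩
    have hl (l : Fin M) : 2 * M * μ (⋃ Q ∈ A l, G.family.cell Q) ≤ μ (G.family.cell R) := by
      set t := G.family.avg μ (Φ R l) R with ht
      have hsubR : ⋃ Q ∈ A l, G.family.cell Q ⊆ G.family.cell R :=
        Set.iUnion₂_subset fun Q hQ => hQ.1.2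
      have h1 := NestedFamily.mul_measure_biUnion_le (N := G.family) (A := A l) (μ := μ)
        (σ := μ.withDensity (Φ R l)) (t := 2 * M * t) (fun Q hQ => by
          rw [withDensity_apply _ (G.family.measurableSet_cell Q)]
          exact ENNReal.mul_le_of_le_div hQ.2.le)
      have h2 : 2 * M * t * μ (⋃ Q ∈ A l, G.family.cell Q) ≤ t * μ (G.family.cell R) := by
        refine h1.trans ((measure_mono hsubR).trans ?_)
        rw [withDensity_apply _ (G.family.measurableSet_cell R)]
        rcases eq_or_ne (μ (G.family.cell R)) 0 with h0 | h0
        · rw [setLIntegral_measure_zero _ _ h0]; exact zero_le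
        · rw [ht, NestedFamily.avg, ENNReal.div_mul_cancel h0 (hμ1 R)]
      have hM : (2 * M : ℝ≥0∞) ≠ 0 := by
        have := l.pos
        simp; omega
      rcases eq_or_ne t ∞ with htop | htop
      · have : A l = ∅ := by
          refine Set.eq_empty_of_forall_notMem fun Q hQ => ?_
          have h3 := hQ.2
          rw [← ht, htop, ENNReal.mul_top hM] at h3
          exact not_top_lt h3
        simp [this]
      rcases eq_or_ne t 0 with h0 | h0
      · have hzero : μ (⋃ Q ∈ A l, G.family.cell Q) = 0 := by
          refine (measure_biUnion_null_iff (Set.to_countable _)).2 fun Q hQ => ?_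
          have h3 : ∫⁻ x in G.family.cell Q, Φ R l x ∂μ = 0 ∨ μ (G.family.cell R) = 0 := by
            rcases ENNReal.div_eq_zero_iff.1 h0 with h | h
            · left
              refine le_antisymm ?_ zero_le
              rw [← h]
              exact lintegral_mono_set hQ.1.2
            · exact absurd h (hμ1 R)
          rcases h3 with h3 | h3
          · have h4 := hQ.2
            rw [NestedFamily.avg.eq_def _ μ (Φ R l) Q, h3, ENNReal.zero_div] at h4
            exact absurd h4 not_lt_zero
          · exact measure_mono_null hQ.1.2 h3
        rw [hzero, mul_zero]; exact zero_le
      · rw [mul_comm _ t, mul_assoc] at h2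
        exact (ENNReal.mul_le_mul_iff_right h0 htop).1 h2
    have hUmu : 2 * μ U ≤ μ (G.family.cell R) := by
      rcases Nat.eq_zero_or_pos M with rfl | hMpos
      · have : U ⊆ ∅ := hsub.trans (by simp)
        rw [Set.subset_empty_iff.1 this]; simp
      have hM0 : (M : ℝ≥0∞) ≠ 0 := by simp; omega
      refine (ENNReal.mul_le_mul_iff_right hM0 (by simp)).1 ?_
      calc (M : ℝ≥0∞) * (2 * μ U) ≤ M * (2 * ∑ l, μ (⋃ Q ∈ A l, G.family.cell Q)) := by
            gcongr
            refine (measure_mono hsub).trans ?_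
            refine (measure_iUnion_le _).trans (le_of_eq ?_)
            rw [tsum_fintype]
        _ = ∑ l, 2 * M * μ (⋃ Q ∈ A l, G.family.cell Q) := by
            rw [Finset.mul_sum, Finset.mul_sum]
            exact Finset.sum_congr rfl fun l _ => by ring
        _ ≤ ∑ _l : Fin M, μ (G.family.cell R) := Finset.sum_le_sum fun l _ => hl l
        _ = _ := by simp
    have hcore : μ (G.family.cell R) ≤ μ (G.core cond R) + μ U := by
      rw [core]
      exact (measure_mono (by rw [Set.sdiff_union_self]; exact Set.subset_union_left)).trans
        (measure_union_le _ _)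
    have hUfin : μ U ≠ ∞ := by
      refine ne_top_of_le_ne_top (hμ1 R) (le_trans ?_ hUmu)
      exact le_mul_of_one_le_left' (by norm_num)
    have hsum : μ (G.family.cell R) + 2 * μ U ≤ 2 * μ (G.core cond R) + 2 * μ U := by
      calc μ (G.family.cell R) + 2 * μ U ≤ 2 * μ (G.family.cell R) := by
            rw [two_mul (μ (G.family.cell R))]; gcongr
        _ ≤ 2 * (μ (G.core cond R) + μ U) := by gcongr
        _ = _ := by ring
    exact (ENNReal.add_le_add_iff_right (by finiteness)).1 hsum

end Grid

/-! ### Sparse domination of sums over all cells -/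

theorem ofReal_abs_setAverage_sub_le {X : Type*} [MeasurableSpace X] {μ : Measure X} {b : X → ℝ}
    {s : Set X} (hs0 : μ s ≠ 0) (hs1 : μ s ≠ ∞) (hint : IntegrableOn b s μ) (r : ℝ) :
    ENNReal.ofReal |(⨍ y in s, b y ∂μ) - r| ≤ (∫⁻ y in s, ENNReal.ofReal |b y - r| ∂μ) / μ s := by
  have hc : IntegrableOn (fun _ : X => r) s μ := by
    rw [integrableOn_const_iff]; right; exact hs1.lt_top
  have hsub : IntegrableOn (fun y => b y - r) s μ := hint.sub hc
  have h1 : (⨍ y in s, b y ∂μ) - r = ⨍ y in s, (b y - r) ∂μ := by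
    rw [setAverage_eq, setAverage_eq, integral_sub hint hc, smul_sub, ← setAverage_eq _ (fun _ => r),
      setAverage_const hs0 hs1]
  have h2 : |⨍ y in s, (b y - r) ∂μ| ≤ ⨍ y in s, |b y - r| ∂μ := by
    rw [setAverage_eq, setAverage_eq, smul_eq_mul, smul_eq_mul, abs_mul,
      abs_of_nonneg (inv_nonneg.2 measureReal_nonneg)]
    gcongr
    exact abs_integral_le_integral_abs
  rw [h1]
  refine (ENNReal.ofReal_le_ofReal h2).trans (le_of_eq ?_)
  rw [ofReal_setAverage hsub.abs (ae_of_all _ fun _ => abs_nonneg _)]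

namespace Grid

variable {X Z : Type*} [MeasurableSpace X] (G : Grid X Z) (μ : Measure X) (b : X → ℝ)

/-- The distance of `b` to its mean over the cell `R`. -/
noncomputable def osc (R : ℕ × Z) (x : X) : ℝ≥0∞ :=
  ENNReal.ofReal |b x - ⨍ y in G.family.cell R, b y ∂μ|

/-- The functions whose averages are controlled by the stopping process: the products of `f` with
the powers of the oscillation of `b`, and the oscillation itself. -/
noncomputable def stopFun (m : ℕ) (f : X → ℝ≥0∞) (R : ℕ × Z) (l : Fin (m + 2)) (x : X) : ℝ≥0∞ :=
  if (l : ℕ) ≤ m then G.osc μ b R x ^ (l : ℕ) * f x else G.osc μ b R x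

variable {G μ b}

theorem measurable_osc (hb : Measurable b) (R : ℕ × Z) : Measurable (G.osc μ b R) :=
  (continuous_abs.measurable.comp (hb.sub measurable_const)).ennreal_ofReal

theorem ofReal_abs_average_sub_le {Q : ℕ × Z} (hQ0 : μ (G.family.cell Q) ≠ 0)
    (hQ1 : μ (G.family.cell Q) ≠ ∞) (hint : IntegrableOn b (G.family.cell Q) μ) (R : ℕ × Z) :
    ENNReal.ofReal |(⨍ y in G.family.cell Q, b y ∂μ) - ⨍ y in G.family.cell R, b y ∂μ| ≤
      G.family.avg μ (G.osc μ b R) Q :=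
  ofReal_abs_setAverage_sub_le hQ0 hQ1 hint _

theorem avg_par_le {D : ℝ≥0∞} (hμ0 : ∀ i, μ (G.family.cell i) ≠ 0)
    (hμ1 : ∀ i, μ (G.family.cell i) ≠ ∞)
    (hD : ∀ k z, μ (G.family.cell (k, G.par z)) ≤ D * μ (G.family.cell (k + 1, z)))
    (f : X → ℝ≥0∞) (k : ℕ) (z : Z) :
    G.family.avg μ f (k + 1, z) ≤ D * G.family.avg μ f (k, G.par z) := by
  rw [NestedFamily.avg, NestedFamily.avg, ← mul_div_assoc]
  refine ENNReal.div_le_of_le_mul ?_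
  have h0 := hμ0 (k, G.par z)
  have h1 := hμ1 (k, G.par z)
  calc ∫⁻ x in G.family.cell (k + 1, z), f x ∂μ
      ≤ ∫⁻ x in G.family.cell (k, G.par z), f x ∂μ := lintegral_mono_set (below_par k z).2
    _ = (∫⁻ x in G.family.cell (k, G.par z), f x ∂μ) / μ (G.family.cell (k, G.par z)) *
          μ (G.family.cell (k, G.par z)) := (ENNReal.div_mul_cancel h0 h1).symm
    _ ≤ (∫⁻ x in G.family.cell (k, G.par z), f x ∂μ) / μ (G.family.cell (k, G.par z)) *
          (D * μ (G.family.cell (k + 1, z))) := by gcongr; exact hD k z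
    _ = _ := by simp only [div_eq_mul_inv]; ring

section Telescoping

variable {m : ℕ} {f : X → ℝ≥0∞}

theorem stopFun_last (R : ℕ × Z) : G.stopFun μ b m f R (Fin.last (m + 1)) = G.osc μ b R := by
  ext x; simp [stopFun]

theorem stopFun_of_le (R : ℕ × Z) {h : ℕ} (hh : h ≤ m) :
    G.stopFun μ b m f R ⟨h, by omega⟩ = fun x => G.osc μ b R x ^ h * f x := by
  ext x; simp [stopFun, hh]

/-- Telescoping along the stopping ancestors of the cells that contain `x`. -/
theorem ofReal_abs_average_anc_sub_le {D : ℝ≥0∞} (hμ0 : ∀ i, μ (G.family.cell i) ≠ 0)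
    (hμ1 : ∀ i, μ (G.family.cell i) ≠ ∞)
    (hD : ∀ k z, μ (G.family.cell (k, G.par z)) ≤ D * μ (G.family.cell (k + 1, z)))
    (hint : ∀ i, IntegrableOn b (G.family.cell i) μ)
    {R : ℕ × Z} (hR : R ∈ G.stopping (G.stopCond μ (G.stopFun μ b m f))) {x : X}
    (hx : x ∈ G.family.cell R) {t : ℕ → ℝ≥0∞}
    (ht : ∀ k, R.1 ≤ k → G.at' k x ∈ G.stopping (G.stopCond μ (G.stopFun μ b m f)) →
      G.family.avg μ (G.osc μ b (G.at' k x)) (G.at' k x) ≤ t k) {k : ℕ} (hk : R.1 ≤ k) :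
    ENNReal.ofReal |(⨍ y in G.family.cell
        (G.anc (G.stopCond μ (G.stopFun μ b m f)) k (G.idx k x)), b y ∂μ) -
        ⨍ y in G.family.cell R, b y ∂μ| ≤
      D * (2 * (m + 2 : ℕ)) * ∑ l ∈ Finset.range
        (G.anc (G.stopCond μ (G.stopFun μ b m f)) k (G.idx k x)).1, t l := by
  set cond := G.stopCond μ (G.stopFun μ b m f) with hcond
  induction k, hk using Nat.le_induction with
  | base =>
    have h1 : (R.1, G.idx R.1 x) = R := (eq_at_of_mem hx).symm
    have h2 : G.anc cond R.1 (G.idx R.1 x) = R := by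
      have h3 : G.anc cond R.1 R.2 = R := hR
      rwa [show R.2 = G.idx R.1 x from hx.symm] at h3
    rw [h2]; simp
  | succ k hk ih =>
    rcases anc_eq_or (G := G) (cond := cond) k (G.idx (k + 1) x) with ⟨h, -⟩ | ⟨h, -⟩
    swap
    · rw [h, ← G.idx_par]; exact ih
    set A := G.anc cond k (G.idx k x) with hA
    have hAlev : A.1 ≤ k := anc_fst_le _ _
    have hxA : x ∈ G.family.cell A := (below_anc k (G.idx k x)).2 (mem_cell_at k x)
    have hAeq : A = G.at' A.1 x := eq_at_of_mem hxA
    have hAS : A ∈ G.stopping cond := anc_mem_stopping _ _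
    have hRA : R.1 ≤ A.1 := (anc_below_of_below hR (below_at hx hk)).1
    have htA : G.family.avg μ (G.osc μ b A) A ≤ t A.1 := by
      have := ht A.1 hRA
      rw [← hAeq] at this
      exact this hAS
    have hstep : ENNReal.ofReal |(⨍ y in G.family.cell (k + 1, G.idx (k + 1) x), b y ∂μ) -
        ⨍ y in G.family.cell A, b y ∂μ| ≤ D * (2 * (m + 2 : ℕ)) * t A.1 := by
      refine (ofReal_abs_average_sub_le (hμ0 _) (hμ1 _) (hint _) A).trans ?_
      refine (avg_par_le hμ0 hμ1 hD _ k (G.idx (k + 1) x)).trans ?_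
      rw [← G.idx_par, mul_assoc]
      gcongr
      have h5 := avg_anc_le (G := G) (μ := μ) (Φ := G.stopFun μ b m f) k (G.idx k x)
        (Fin.last (m + 1))
      rw [← hcond, ← hA, stopFun_last] at h5
      refine h5.trans ?_
      gcongr
    rw [h]
    calc _ ≤ ENNReal.ofReal (|(⨍ y in G.family.cell (k + 1, G.idx (k + 1) x), b y ∂μ) -
        ⨍ y in G.family.cell A, b y ∂μ| + |(⨍ y in G.family.cell A, b y ∂μ) -
        ⨍ y in G.family.cell R, b y ∂μ|) := ENNReal.ofReal_le_ofReal (abs_sub_le _ _ _)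
      _ ≤ D * (2 * (m + 2 : ℕ)) * t A.1 +
          D * (2 * (m + 2 : ℕ)) * ∑ l ∈ Finset.range A.1, t l := by
          rw [ENNReal.ofReal_add (abs_nonneg _) (abs_nonneg _)]
          exact add_le_add hstep ih
      _ = D * (2 * (m + 2 : ℕ)) * ∑ l ∈ Finset.range (A.1 + 1), t l := by
          rw [Finset.sum_range_succ, mul_add, add_comm]
      _ ≤ _ := by
          gcongr
          exact Nat.succ_le_succ hAlev

/-- At every point where the averages of `b` over the cells of the grid converge to its value, the
oscillation over a stopping cell is controlled by the averages of `η` over the stopping cells below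
it that contain the point. -/
theorem osc_le_chainSum {D B : ℝ≥0∞} (hμ0 : ∀ i, μ (G.family.cell i) ≠ 0)
    (hμ1 : ∀ i, μ (G.family.cell i) ≠ ∞)
    (hD : ∀ k z, μ (G.family.cell (k, G.par z)) ≤ D * μ (G.family.cell (k + 1, z)))
    (hint : ∀ i, IntegrableOn b (G.family.cell i) μ) {η : X → ℝ≥0∞}
    (hB : ∀ i, G.family.avg μ (G.osc μ b i) i ≤ B * G.family.avg μ η i)
    (R : G.stopping (G.stopCond μ (G.stopFun μ b m f))) {x : X}
    (hx : x ∈ G.family.cell R)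
    (hlim : Filter.Tendsto (fun k => ⨍ y in G.family.cell (G.at' k x), b y ∂μ) Filter.atTop
      (nhds (b x))) :
    G.osc μ b R x ≤ (1 + D) * (2 * (m + 2 : ℕ)) * B *
      (G.family.restrict (G.stopping (G.stopCond μ (G.stopFun μ b m f)))).chainSum μ η R x := by
  classical
  obtain ⟨R, hR⟩ := R
  set S := G.stopping (G.stopCond μ (G.stopFun μ b m f)) with hS
  set s := (G.family.restrict S).chainSum μ η ⟨R, hR⟩ x with hs
  change G.osc μ b R x ≤ _
  set t : ℕ → ℝ≥0∞ := fun k => if R.1 ≤ k ∧ G.at' k x ∈ S then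
    G.family.avg μ (G.osc μ b (G.at' k x)) (G.at' k x) else 0 with ht
  have htsum : ∑' k, t k ≤ B * s := by
    set g : ℕ × Z → ℝ≥0∞ := S.indicator fun P => B * {P | G.family.Below P R}.indicator
      (fun P => (G.family.cell P).indicator (fun _ => G.family.avg μ η P) x) P with hg
    calc ∑' k, t k ≤ ∑' k, g (G.at' k x) := by
          refine ENNReal.tsum_le_tsum fun k => ?_
          by_cases hk : R.1 ≤ k ∧ G.at' k x ∈ S
          · have hb : G.family.Below (G.at' k x) R := below_at hx hk.1
            rw [ht, hg]
            simp only [if_pos hk, Set.indicator_of_mem hk.2]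
            rw [Set.indicator_of_mem (by exact hb), Set.indicator_of_mem (mem_cell_at k x)]
            exact hB _
          · rw [ht]; simp only [if_neg hk]; exact zero_le
      _ ≤ ∑' P, g P := ENNReal.tsum_comp_le_tsum_of_injective
          (f := fun k => G.at' k x) (fun k l h => congrArg Prod.fst h) g
      _ = B * s := by
          rw [hg, ← tsum_subtype, ENNReal.tsum_mul_left]
          rfl
  have hbound {k : ℕ} (hk : R.1 ≤ k) :
      ENNReal.ofReal |(⨍ y in G.family.cell (G.at' k x), b y ∂μ) -
        ⨍ y in G.family.cell R, b y ∂μ| ≤ (1 + D) * (2 * (m + 2 : ℕ)) * B * s := by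
    set A := G.anc (G.stopCond μ (G.stopFun μ b m f)) k (G.idx k x) with hA
    have hxA : x ∈ G.family.cell A := (below_anc k (G.idx k x)).2 (mem_cell_at k x)
    have hAS : A ∈ S := anc_mem_stopping _ _
    have hRA : R.1 ≤ A.1 := (anc_below_of_below hR (below_at hx hk)).1
    have hAeq : A = G.at' A.1 x := eq_at_of_mem hxA
    have htA : G.family.avg μ (G.osc μ b A) A ≤ ∑' k, t k := by
      refine le_trans (le_of_eq ?_) (ENNReal.le_tsum A.1)
      rw [ht]
      simp only
      rw [← hAeq, if_pos ⟨hRA, hAS⟩]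
    have h1 : ENNReal.ofReal |(⨍ y in G.family.cell (G.at' k x), b y ∂μ) -
        ⨍ y in G.family.cell A, b y ∂μ| ≤ 2 * (m + 2 : ℕ) * ∑' k, t k := by
      refine (ofReal_abs_average_sub_le (hμ0 _) (hμ1 _) (hint _) A).trans ?_
      have h5 := avg_anc_le (G := G) (μ := μ) (Φ := G.stopFun μ b m f) k (G.idx k x)
        (Fin.last (m + 1))
      rw [← hA, stopFun_last] at h5
      exact h5.trans (mul_le_mul_right htA _)
    have h2 := ofReal_abs_average_anc_sub_le hμ0 hμ1 hD hint hR hx (t := t)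
      (fun k hk hkS => by rw [ht]; simp only; rw [if_pos ⟨hk, hkS⟩]) hk
    rw [← hA] at h2
    calc _ ≤ ENNReal.ofReal (|(⨍ y in G.family.cell (G.at' k x), b y ∂μ) -
        ⨍ y in G.family.cell A, b y ∂μ| + |(⨍ y in G.family.cell A, b y ∂μ) -
        ⨍ y in G.family.cell R, b y ∂μ|) := ENNReal.ofReal_le_ofReal (abs_sub_le _ _ _)
      _ ≤ 2 * (m + 2 : ℕ) * ∑' k, t k + D * (2 * (m + 2 : ℕ)) * ∑' k, t k := by
          rw [ENNReal.ofReal_add (abs_nonneg _) (abs_nonneg _)]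
          refine add_le_add h1 (h2.trans ?_)
          gcongr
          exact ENNReal.sum_le_tsum _
      _ = (1 + D) * (2 * (m + 2 : ℕ)) * ∑' k, t k := by ring
      _ ≤ _ := by rw [mul_assoc _ B]; gcongr
  have hlim' : Filter.Tendsto (fun k => ENNReal.ofReal
      |(⨍ y in G.family.cell (G.at' k x), b y ∂μ) - ⨍ y in G.family.cell R, b y ∂μ|) Filter.atTop
      (nhds (G.osc μ b R x)) :=
    (ENNReal.continuous_ofReal.tendsto _).comp ((hlim.sub_const _).abs)
  exact le_of_tendsto hlim' (Filter.eventually_atTop.2 ⟨R.1, fun k hk => hbound hk⟩)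

end Telescoping

end Grid

namespace Grid

variable {X Z : Type*} [MeasurableSpace X] {G : Grid X Z} {μ : Measure X} {b : X → ℝ}

variable (G μ b) in
/-- The stopping cells for the function `b` and the powers up to `m`, as a nested family. -/
noncomputable abbrev stopFamily (m : ℕ) (f : X → ℝ≥0∞) :
    NestedFamily X (G.stopping (G.stopCond μ (G.stopFun μ b m f))) :=
  G.family.restrict (G.stopping (G.stopCond μ (G.stopFun μ b m f)))

/-- A sum over the cells that contain `x`, grouped according to the stopping ancestors. -/
theorem tsum_mul_anc_le {cond : ℕ × Z → ℕ × Z → Prop} {c : ℕ → ℝ≥0∞} {Cc : ℝ≥0∞}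
    (hc : ∀ l, ∑' k, {k | l ≤ k}.indicator c k ≤ Cc * c l) (H : ℕ × Z → ℝ≥0∞) (x : X) :
    ∑' k, c k * H (G.anc cond k (G.idx k x)) ≤
      Cc * ∑' R : G.stopping cond, (G.family.cell R).indicator (fun _ => c R.1.1 * H R) x := by
  calc ∑' k, c k * H (G.anc cond k (G.idx k x))
      ≤ ∑' k, ∑' R : G.stopping cond, (G.family.cell R).indicator
          (fun _ => {k | R.1.1 ≤ k}.indicator c k * H R) x := by
        refine ENNReal.tsum_le_tsum fun k => ?_
        refine le_trans (le_of_eq ?_) (ENNReal.le_tsum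
          (⟨G.anc cond k (G.idx k x), anc_mem_stopping _ _⟩ : G.stopping cond))
        have hx : x ∈ G.family.cell (G.anc cond k (G.idx k x)) :=
          (below_anc k (G.idx k x)).2 (mem_cell_at k x)
        have hk : (G.anc cond k (G.idx k x)).1 ≤ k := anc_fst_le _ _
        rw [Set.indicator_of_mem hx, Set.indicator_of_mem (by exact hk)]
    _ = ∑' R : G.stopping cond, ∑' k, (G.family.cell R).indicator
          (fun _ => {k | R.1.1 ≤ k}.indicator c k * H R) x := ENNReal.tsum_comm
    _ ≤ ∑' R : G.stopping cond, Cc * (G.family.cell R).indicator (fun _ => c R.1.1 * H R) x := by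
        refine ENNReal.tsum_le_tsum fun R => ?_
        by_cases hx : x ∈ G.family.cell R
        · simp only [Set.indicator_of_mem hx]
          rw [ENNReal.tsum_mul_right, ← mul_assoc]
          exact mul_le_mul_left (hc _) _
        · simp [Set.indicator_of_notMem hx]
    _ = _ := ENNReal.tsum_mul_left

theorem ofReal_abs_sub_pow_le (m : ℕ) (R : ℕ × Z) (x y : X) :
    ENNReal.ofReal |b x - b y| ^ m ≤ ∑ h ∈ Finset.range (m + 1), (m.choose h : ℝ≥0∞) *
      G.osc μ b R x ^ (m - h) * G.osc μ b R y ^ h := by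
  have h1 : ENNReal.ofReal |b x - b y| ≤ G.osc μ b R y + G.osc μ b R x := by
    rw [osc, osc, ← ENNReal.ofReal_add (abs_nonneg _) (abs_nonneg _)]
    refine ENNReal.ofReal_le_ofReal ?_
    have := abs_sub_le (b x) (⨍ y in G.family.cell R, b y ∂μ) (b y)
    rw [abs_sub_comm (⨍ y in G.family.cell R, b y ∂μ) (b y)] at this
    linarith
  calc _ ≤ _ := pow_le_pow_left' h1 m
    _ = _ := by
      rw [add_pow]
      exact Finset.sum_congr rfl fun h _ => by ring

/-- The integral of a power of the oscillation over a stopping cell. -/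
theorem lintegral_osc_pow_le [Countable Z] {m : ℕ} {f : X → ℝ≥0∞} {D B : ℝ≥0∞}
    (hμ0 : ∀ i, μ (G.family.cell i) ≠ 0)
    (hμ1 : ∀ i, μ (G.family.cell i) ≠ ∞)
    (hD : ∀ k z, μ (G.family.cell (k, G.par z)) ≤ D * μ (G.family.cell (k + 1, z)))
    (hint : ∀ i, IntegrableOn b (G.family.cell i) μ)
    {η : X → ℝ≥0∞} (hη : Measurable η)
    (hB : ∀ i, G.family.avg μ (G.osc μ b i) i ≤ B * G.family.avg μ η i)
    (hlim : ∀ᵐ x ∂μ, Filter.Tendsto (fun k => ⨍ y in G.family.cell (G.at' k x), b y ∂μ)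
      Filter.atTop (nhds (b x))) (hf : Measurable f)
    (R : G.stopping (G.stopCond μ (G.stopFun μ b m f))) (h : ℕ) :
    ∫⁻ x in G.family.cell R, G.osc μ b R x ^ h * f x ∂μ ≤
      ((1 + D) * (2 * (m + 2 : ℕ)) * B) ^ h * (2 ^ (h * h) *
        ∫⁻ x in G.family.cell R, ((G.stopFamily μ b m f).opMulLeft μ η)^[h] f x ∂μ) := by
  refine le_trans ?_ (mul_le_mul_right ((G.stopFamily μ b m f).lintegral_chainSum_pow_mul_le hη h
    hf R) _)
  have hmeas : Measurable fun x => (G.stopFamily μ b m f).chainSum μ η R x ^ h * f x :=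
    ((NestedFamily.measurable_chainSum _).pow_const _).mul hf
  rw [← lintegral_const_mul _ hmeas]
  refine setLIntegral_mono_ae (hmeas.const_mul _).aemeasurable ?_
  filter_upwards [hlim] with x hx hxR
  rw [← mul_assoc, ← mul_pow]
  exact mul_le_mul_left (pow_le_pow_left' (osc_le_chainSum hμ0 hμ1 hD hint hB R hxR hx) h) _

/-- Domination of the sum over all cells by iterated sparse operators. -/
theorem tsum_mul_avg_le [Countable Z] {m : ℕ} {f : X → ℝ≥0∞} {D B Cc : ℝ≥0∞}
    (hμ0 : ∀ i, μ (G.family.cell i) ≠ 0)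
    (hμ1 : ∀ i, μ (G.family.cell i) ≠ ∞)
    (hD : ∀ k z, μ (G.family.cell (k, G.par z)) ≤ D * μ (G.family.cell (k + 1, z)))
    (hb : Measurable b) (hint : ∀ i, IntegrableOn b (G.family.cell i) μ)
    {η : X → ℝ≥0∞} (hη : Measurable η)
    (hB : ∀ i, G.family.avg μ (G.osc μ b i) i ≤ B * G.family.avg μ η i)
    (hlim : ∀ᵐ x ∂μ, Filter.Tendsto (fun k => ⨍ y in G.family.cell (G.at' k x), b y ∂μ)
      Filter.atTop (nhds (b x))) (hf : Measurable f)
    {c : ℕ → ℝ≥0∞} (hc : ∀ l, ∑' k, {k | l ≤ k}.indicator c k ≤ Cc * c l) {s : ℝ}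
    (hcs : ∀ i : ℕ × Z, c i.1 * (μ (G.family.cell i))⁻¹ ≤ μ (G.family.cell i) ^ (-s)) {x : X}
    (hx : Filter.Tendsto (fun k => ⨍ y in G.family.cell (G.at' k x), b y ∂μ)
      Filter.atTop (nhds (b x))) :
    ∑' k, c k * G.family.avg μ (fun y => ENNReal.ofReal |b x - b y| ^ m * f y) (G.at' k x) ≤
      Cc * (2 * (m + 2 : ℕ)) * ((1 + D) * (2 * (m + 2 : ℕ)) * B) ^ m * 2 ^ (2 * m * m) *
        ∑ h ∈ Finset.range (m + 1), (m.choose h : ℝ≥0∞) *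
          ((G.stopFamily μ b m f).opMulRight μ η)^[m - h] ((G.stopFamily μ b m f).sparseOp μ s
            (((G.stopFamily μ b m f).opMulLeft μ η)^[h] f)) x := by
  set cond := G.stopCond μ (G.stopFun μ b m f) with hcond
  set N : NestedFamily X (G.stopping cond) := G.family.restrict (G.stopping cond) with hN
  set A := (1 + D) * (2 * (m + 2 : ℕ)) * B with hA
  set K : ℝ≥0∞ := 2 * (m + 2 : ℕ) with hK
  set g : ℕ → X → ℝ≥0∞ := fun h => (N.opMulLeft μ η)^[h] f with hg
  set H : ℕ × Z → ℝ≥0∞ := fun R => K * ∑ h ∈ Finset.range (m + 1), (m.choose h : ℝ≥0∞) *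
      G.osc μ b R x ^ (m - h) * G.family.avg μ (fun y => G.osc μ b R y ^ h * f y) R with hH
  have h1 (k : ℕ) : G.family.avg μ (fun y => ENNReal.ofReal |b x - b y| ^ m * f y) (G.at' k x) ≤
      H (G.anc cond k (G.idx k x)) := by
    set R := G.anc cond k (G.idx k x) with hR
    have hmeas (h : ℕ) : Measurable fun y => G.osc μ b R y ^ h * f y :=
      ((measurable_osc hb R).pow_const _).mul hf
    calc _ ≤ G.family.avg μ (fun y => ∑ h ∈ Finset.range (m + 1), (m.choose h : ℝ≥0∞) *
          G.osc μ b R x ^ (m - h) * (G.osc μ b R y ^ h * f y)) (G.at' k x) := by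
          unfold NestedFamily.avg
          refine ENNReal.div_le_div_right (lintegral_mono fun y => ?_) _
          simp only
          refine (mul_le_mul_left (ofReal_abs_sub_pow_le (G := G) (μ := μ) m R x y) (f y)).trans
            (le_of_eq ?_)
          rw [Finset.sum_mul]
          exact Finset.sum_congr rfl fun h _ => by ring
      _ = ∑ h ∈ Finset.range (m + 1), (m.choose h : ℝ≥0∞) * G.osc μ b R x ^ (m - h) *
          G.family.avg μ (fun y => G.osc μ b R y ^ h * f y) (G.at' k x) := by
          unfold NestedFamily.avg
          rw [lintegral_finsetSum _ fun h _ => (hmeas h).const_mul _, ENNReal.div_eq_inv_mul,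
            Finset.mul_sum]
          refine Finset.sum_congr rfl fun h _ => ?_
          rw [lintegral_const_mul _ (hmeas h), ENNReal.div_eq_inv_mul]
          ring
      _ ≤ H R := by
          rw [hH]
          simp only
          rw [Finset.mul_sum]
          refine Finset.sum_le_sum fun h hh => ?_
          have hhm : h ≤ m := Nat.lt_succ_iff.1 (Finset.mem_range.1 hh)
          have h5 := avg_anc_le (G := G) (μ := μ) (Φ := G.stopFun μ b m f) k (G.idx k x)
            ⟨h, by omega⟩
          rw [← hcond, ← hR, stopFun_of_le R hhm] at h5
          refine (mul_le_mul_right h5 _).trans (le_of_eq ?_)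
          rw [hK]; ring
  have h2 (R : G.stopping cond) (hxR : x ∈ G.family.cell R) : c R.1.1 * H R ≤
      K * A ^ m * 2 ^ (m * m) * ∑ h ∈ Finset.range (m + 1), (m.choose h : ℝ≥0∞) *
        ((μ (N.cell R) ^ (-s) * ∫⁻ y in N.cell R, g h y ∂μ) * N.chainSum μ η R x ^ (m - h)) := by
    rw [hH]
    simp only
    rw [Finset.mul_sum, Finset.mul_sum, Finset.mul_sum]
    refine Finset.sum_le_sum fun h hh => ?_
    have hhm : h ≤ m := Nat.lt_succ_iff.1 (Finset.mem_range.1 hh)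
    have hosc : G.osc μ b R x ^ (m - h) ≤ A ^ (m - h) * N.chainSum μ η R x ^ (m - h) := by
      rw [← mul_pow]
      exact pow_le_pow_left' (osc_le_chainSum hμ0 hμ1 hD hint hB R hxR hx) _
    have hI := lintegral_osc_pow_le hμ0 hμ1 hD hint hη hB hlim hf R h
    have hpow : (2 : ℝ≥0∞) ^ (h * h) ≤ 2 ^ (m * m) :=
      pow_le_pow_right₀ (by norm_num) (Nat.mul_le_mul hhm hhm)
    have hAm : A ^ m = A ^ (m - h) * A ^ h := by rw [← pow_add, Nat.sub_add_cancel hhm]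
    rw [NestedFamily.avg, div_eq_mul_inv]
    calc c R.1.1 * (K * ((m.choose h : ℝ≥0∞) * G.osc μ b R x ^ (m - h) *
          ((∫⁻ y in G.family.cell R, G.osc μ b R y ^ h * f y ∂μ) * (μ (G.family.cell R))⁻¹)))
        = (c R.1.1 * (μ (G.family.cell R))⁻¹) * (K * m.choose h) * (G.osc μ b R x ^ (m - h) *
          (∫⁻ y in G.family.cell R, G.osc μ b R y ^ h * f y ∂μ)) := by ring
      _ ≤ μ (G.family.cell R) ^ (-s) * (K * m.choose h) *
          ((A ^ (m - h) * N.chainSum μ η R x ^ (m - h)) * (A ^ h * (2 ^ (m * m) *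
            ∫⁻ y in G.family.cell R, g h y ∂μ))) := by
          refine mul_le_mul' (mul_le_mul_left (hcs R) _) (mul_le_mul' hosc (hI.trans ?_))
          exact mul_le_mul_right (mul_le_mul_left hpow _) _
      _ = _ := by
          rw [hAm]
          change _ = K * (A ^ (m - h) * A ^ h) * 2 ^ (m * m) * (m.choose h * (μ (G.family.cell R)
            ^ (-s) * (∫⁻ y in G.family.cell R, g h y ∂μ) * N.chainSum μ η R x ^ (m - h)))
          ring
  calc ∑' k, c k * G.family.avg μ (fun y => ENNReal.ofReal |b x - b y| ^ m * f y) (G.at' k x)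
      ≤ ∑' k, c k * H (G.anc cond k (G.idx k x)) :=
        ENNReal.tsum_le_tsum fun k => mul_le_mul_right (h1 k) _
    _ ≤ Cc * ∑' R : G.stopping cond, (G.family.cell R).indicator (fun _ => c R.1.1 * H R) x :=
        tsum_mul_anc_le hc H x
    _ ≤ Cc * ∑' R : G.stopping cond, K * A ^ m * 2 ^ (m * m) * ∑ h ∈ Finset.range (m + 1),
          (m.choose h : ℝ≥0∞) * ((N.cell R).indicator
            (fun _ => μ (N.cell R) ^ (-s) * ∫⁻ y in N.cell R, g h y ∂μ) x *
              N.chainSum μ η R x ^ (m - h)) := by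
        refine mul_le_mul_right (ENNReal.tsum_le_tsum fun R => ?_) _
        by_cases hxR : x ∈ G.family.cell R
        · rw [Set.indicator_of_mem hxR]
          refine (h2 R hxR).trans (le_of_eq ?_)
          congr 1
          refine Finset.sum_congr rfl fun h _ => ?_
          rw [Set.indicator_of_mem (by exact hxR)]
        · rw [Set.indicator_of_notMem hxR]; exact zero_le
    _ = Cc * (K * A ^ m * 2 ^ (m * m)) * ∑ h ∈ Finset.range (m + 1), (m.choose h : ℝ≥0∞) *
          ∑' R : G.stopping cond, (N.cell R).indicator
            (fun _ => μ (N.cell R) ^ (-s) * ∫⁻ y in N.cell R, g h y ∂μ) x *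
              N.chainSum μ η R x ^ (m - h) := by
        rw [ENNReal.tsum_mul_left, Summable.tsum_finsetSum fun _ _ => ENNReal.summable]
        simp_rw [ENNReal.tsum_mul_left]
        ring
    _ ≤ Cc * (K * A ^ m * 2 ^ (m * m)) * ∑ h ∈ Finset.range (m + 1), (m.choose h : ℝ≥0∞) *
          (2 ^ (m * m) * (N.opMulRight μ η)^[m - h] (N.sparseOp μ s (g h)) x) := by
        refine mul_le_mul_right (Finset.sum_le_sum fun h hh => mul_le_mul_right ?_ _) _
        refine (N.tsum_mul_chainSum_pow_le (m - h) _ x).trans (mul_le_mul_left ?_ _)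
        exact pow_le_pow_right₀ (by norm_num) (Nat.mul_le_mul (Nat.sub_le _ _) (Nat.sub_le _ _))
    _ = _ := by
        rw [Finset.mul_sum, Finset.mul_sum]
        refine Finset.sum_congr rfl fun h _ => ?_
        rw [show 2 * m * m = m * m + m * m by ring, pow_add]
        ring

end Grid

/-! ### Weighted bounds for iterated sparse operators -/

/-- The norm of `g` in the weighted space `L^{1/r}(W^{1/r})`. -/
noncomputable def weightedNorm {X : Type*} [MeasurableSpace X] (μ : Measure X) (r : ℝ)
    (W g : X → ℝ≥0∞) : ℝ≥0∞ :=
  (∫⁻ x, (g x * W x) ^ (1 / r) ∂μ) ^ r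

theorem weightedNorm_mono {X : Type*} [MeasurableSpace X] {μ : Measure X} {r : ℝ} (hr : 0 ≤ r)
    {W g h : X → ℝ≥0∞} (hgh : ∀ᵐ x ∂μ, g x ≤ h x) : weightedNorm μ r W g ≤ weightedNorm μ r W h := by
  refine ENNReal.rpow_le_rpow (lintegral_mono_ae ?_) hr
  filter_upwards [hgh] with x hx
  exact ENNReal.rpow_le_rpow (mul_le_mul_left hx _) (by positivity)

theorem weightedNorm_const_mul {X : Type*} [MeasurableSpace X] {μ : Measure X} {r : ℝ} (hr : 0 < r)
    {W g : X → ℝ≥0∞} (hW : Measurable W) (hg : Measurable g) (c : ℝ≥0∞) :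
    weightedNorm μ r W (fun x => c * g x) = c * weightedNorm μ r W g := by
  unfold weightedNorm
  simp_rw [mul_assoc, ENNReal.mul_rpow_of_nonneg _ _ (one_div_nonneg.2 hr.le)]
  rw [lintegral_const_mul _ (by fun_prop), ENNReal.mul_rpow_of_nonneg _ _ hr.le, ← ENNReal.rpow_mul,
    one_div_mul_cancel hr.ne', ENNReal.rpow_one]

theorem weightedNorm_finset_sum_le {X ι : Type*} [MeasurableSpace X] {μ : Measure X} {r : ℝ}
    (hr : 0 < r) (hr1 : r ≤ 1) {W : X → ℝ≥0∞} (hW : Measurable W) {g : ι → X → ℝ≥0∞}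
    (hg : ∀ i, Measurable (g i)) (s : Finset ι) :
    weightedNorm μ r W (fun x => ∑ i ∈ s, g i x) ≤ ∑ i ∈ s, weightedNorm μ r W (g i) := by
  classical
  induction s using Finset.induction_on with
  | empty => simp [weightedNorm, hr]
  | insert i s hi ih =>
    simp_rw [Finset.sum_insert hi]
    refine le_trans ?_ (add_le_add_right ih _)
    have := ENNReal.lintegral_Lp_add_le (μ := μ) (p := 1 / r) (f := fun x => g i x * W x)
      (g := fun x => (∑ i ∈ s, g i x) * W x) ((hg i).mul hW).aemeasurable
      ((Finset.measurable_fun_sum s fun i _ => hg i).mul hW).aemeasurable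
      (by rw [le_div_iff₀ hr]; linarith)
    simp only [Pi.add_apply, one_div_one_div, ← add_mul] at this
    exact this

namespace NestedFamily

variable {X J : Type*} [MeasurableSpace X]

/-- The two-exponent Muckenhoupt condition for the weight `W` over the cells, with constant `K` and
exponents `1/a` and `1/b`. -/
def MuckenhouptBound (N : NestedFamily X J) (μ : Measure X) (a b : ℝ) (W : X → ℝ≥0∞)
    (K : ℝ≥0∞) : Prop :=
  ∀ i, (∫⁻ x in N.cell i, W x ^ (1 / b) ∂μ) * (∫⁻ x in N.cell i, W x ^ (-(1 / a)) ∂μ) ^ (a / b) ≤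
    K * μ (N.cell i) ^ (1 + a / b)

theorem lintegral_rpow_interpolate_le {μ : Measure X} {U V : X → ℝ≥0∞} (hU : Measurable U)
    (hV : Measurable V) (hU1 : ∀ x, U x ≠ ∞)
    (hV1 : ∀ x, V x ≠ ∞) {t u : ℝ} (ht : 0 ≤ t) (hu : 0 ≤ u) (htu : t + u = 1) (e : ℝ) :
    ∫⁻ x, (U x ^ t * V x ^ u) ^ e ∂μ ≤ (∫⁻ x, U x ^ e ∂μ) ^ t * (∫⁻ x, V x ^ e ∂μ) ^ u := by
  refine le_trans (le_of_eq ?_) (ENNReal.lintegral_mul_norm_pow_le (μ := μ) (f := fun x => U x ^ e)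
    (g := fun x => V x ^ e) (hU.pow_const _).aemeasurable (hV.pow_const _).aemeasurable ht hu htu)
  refine lintegral_congr fun x => ?_
  rw [ENNReal.mul_rpow_of_ne_top (ENNReal.rpow_ne_top_of_nonneg ht (hU1 x))
    (ENNReal.rpow_ne_top_of_nonneg hu (hV1 x)), ← ENNReal.rpow_mul, ← ENNReal.rpow_mul,
    ← ENNReal.rpow_mul, ← ENNReal.rpow_mul, mul_comm t, mul_comm u]

/-- The constants in the Muckenhoupt condition over a set are logarithmically convex. -/
theorem muckenhoupt_interpolate_le {μ : Measure X} {a b e : ℝ} (ha : 0 < a) (hb : 0 < b)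
    {U V : X → ℝ≥0∞} {K L : ℝ≥0∞} {s : Set X}
    (hK : (∫⁻ x in s, U x ^ (1 / b) ∂μ) * (∫⁻ x in s, U x ^ (-(1 / a)) ∂μ) ^ (a / b) ≤
      K * μ s ^ e)
    (hL : (∫⁻ x in s, V x ^ (1 / b) ∂μ) * (∫⁻ x in s, V x ^ (-(1 / a)) ∂μ) ^ (a / b) ≤
      L * μ s ^ e)
    (hU : Measurable U) (hV : Measurable V) (hU1 : ∀ x, U x ≠ ∞) (hV1 : ∀ x, V x ≠ ∞) {t u : ℝ}
    (ht : 0 ≤ t) (hu : 0 ≤ u) (htu : t + u = 1) :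
    (∫⁻ x in s, (U x ^ t * V x ^ u) ^ (1 / b) ∂μ) *
      (∫⁻ x in s, (U x ^ t * V x ^ u) ^ (-(1 / a)) ∂μ) ^ (a / b) ≤ K ^ t * L ^ u * μ s ^ e := by
  have hr : 0 ≤ a / b := by positivity
  set r := a / b
  set U1 := ∫⁻ x in s, U x ^ (1 / b) ∂μ
  set U2 := ∫⁻ x in s, U x ^ (-(1 / a)) ∂μ
  set V1 := ∫⁻ x in s, V x ^ (1 / b) ∂μ
  set V2 := ∫⁻ x in s, V x ^ (-(1 / a)) ∂μ
  calc _ ≤ (U1 ^ t * V1 ^ u) * (U2 ^ t * V2 ^ u) ^ r :=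
        mul_le_mul' (lintegral_rpow_interpolate_le hU hV hU1 hV1 ht hu htu _)
          (ENNReal.rpow_le_rpow (lintegral_rpow_interpolate_le hU hV hU1 hV1 ht hu htu _) hr)
    _ = (U1 * U2 ^ r) ^ t * (V1 * V2 ^ r) ^ u := by
        rw [ENNReal.mul_rpow_of_nonneg _ _ hr, ENNReal.mul_rpow_of_nonneg _ _ ht,
          ENNReal.mul_rpow_of_nonneg _ _ hu, ← ENNReal.rpow_mul, ← ENNReal.rpow_mul,
          ← ENNReal.rpow_mul, ← ENNReal.rpow_mul, mul_comm t, mul_comm u]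
        ring
    _ ≤ (K * μ s ^ e) ^ t * (L * μ s ^ e) ^ u :=
        mul_le_mul' (ENNReal.rpow_le_rpow hK ht) (ENNReal.rpow_le_rpow hL hu)
    _ = K ^ t * L ^ u * ((μ s ^ e) ^ t * (μ s ^ e) ^ u) := by
        rw [ENNReal.mul_rpow_of_nonneg _ _ ht, ENNReal.mul_rpow_of_nonneg _ _ hu]
        ring
    _ = _ := by
        rw [← ENNReal.rpow_add_of_nonneg _ _ ht hu, htu, ENNReal.rpow_one]

/-- A sequence of weights with constant ratio `η`. -/
structure IsGeometric (W : ℕ → X → ℝ≥0∞) (η : X → ℝ≥0∞) : Prop where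
  measurable : ∀ j, Measurable (W j)
  measurable_ratio : Measurable η
  ne_zero : ∀ j x, W j x ≠ 0
  ne_top : ∀ j x, W j x ≠ ∞
  succ : ∀ j x, W (j + 1) x = η x * W j x

section Chain

variable {μ : Measure X} {W : ℕ → X → ℝ≥0∞} {η : X → ℝ≥0∞}

theorem IsGeometric.weightedNorm_mul (hW : IsGeometric W η) (r : ℝ) (j : ℕ) (g : X → ℝ≥0∞) :
    weightedNorm μ r (W j) (fun x => η x * g x) = weightedNorm μ r (W (j + 1)) g := by
  unfold weightedNorm
  simp_rw [hW.succ]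
  congr 2
  ext x
  congr 1
  ring

variable {N : NestedFamily X J} {C e r : ℝ≥0∞} {b : ℝ} {K : ℕ → ℝ≥0∞}

theorem weightedNorm_opMulRight_iterate_le [Countable J] (hW : IsGeometric W η)
    {m : ℕ} (hA : ∀ j ≤ m, ∀ φ, Measurable φ →
      weightedNorm μ b (W j) (N.sparseOp μ 1 φ) ≤ C * K j * weightedNorm μ b (W j) φ)
    {k : ℕ} (hk : k ≤ m) {g : X → ℝ≥0∞} (hg : Measurable g) :
    weightedNorm μ b (W 0) ((N.opMulRight μ η)^[k] g) ≤
      C ^ k * (∏ j ∈ Finset.range k, K j) * weightedNorm μ b (W k) g := by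
  induction k generalizing g with
  | zero => simp
  | succ k ih =>
    rw [Function.iterate_succ_apply]
    calc _ ≤ C ^ k * (∏ j ∈ Finset.range k, K j) * weightedNorm μ b (W k) (N.opMulRight μ η g) :=
          ih (by omega) (N.measurable_sparseOp _ _ _)
      _ ≤ C ^ k * (∏ j ∈ Finset.range k, K j) *
          (C * K k * weightedNorm μ b (W (k + 1)) g) := by
          refine mul_le_mul_right ?_ _
          rw [← hW.weightedNorm_mul]
          exact hA k (by omega) _ (hW.measurable_ratio.mul hg)
      _ = _ := by rw [Finset.prod_range_succ, pow_succ]; ring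

theorem weightedNorm_opMulLeft_iterate_le [Countable J] (hW : IsGeometric W η)
    {m : ℕ} (hA : ∀ j ≤ m, ∀ φ, Measurable φ →
      weightedNorm μ b (W j) (N.sparseOp μ 1 φ) ≤ C * K j * weightedNorm μ b (W j) φ)
    {j h : ℕ} (hjh : j + h ≤ m) {g : X → ℝ≥0∞} (hg : Measurable g) :
    weightedNorm μ b (W j) ((N.opMulLeft μ η)^[h] g) ≤
      C ^ h * (∏ i ∈ Finset.range h, K (j + h - i)) * weightedNorm μ b (W (j + h)) g := by
  induction h generalizing g with
  | zero => simp
  | succ h ih =>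
    rw [Function.iterate_succ_apply]
    have hm : Measurable (N.opMulLeft μ η g) :=
      hW.measurable_ratio.mul (N.measurable_sparseOp _ _ _)
    calc _ ≤ C ^ h * (∏ i ∈ Finset.range h, K (j + h - i)) *
          weightedNorm μ b (W (j + h)) (N.opMulLeft μ η g) := ih (by omega) hm
      _ ≤ C ^ h * (∏ i ∈ Finset.range h, K (j + h - i)) *
          (C * K (j + h + 1) * weightedNorm μ b (W (j + h + 1)) g) := by
          refine mul_le_mul_right ?_ _
          refine le_trans (le_of_eq ?_) (hA (j + h + 1) (by omega) g hg)
          rw [← hW.weightedNorm_mul]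
          rfl
      _ = _ := by
          rw [Finset.prod_range_succ', pow_succ]
          have (i : ℕ) : j + (h + 1) - (i + 1) = j + h - i := by omega
          simp_rw [this]
          rw [Nat.sub_zero, ← add_assoc]
          ring

end Chain

/-- The weighted bound for the composition of `m - h` averaging operators, a fractional sparse
operator, and `h` further averaging operators. Each factor `η` changes the weight, so that every
operator acts on the weights of its own position. -/
theorem weightedNorm_iterate_le {β γ : ℝ} (hγ : 0 < γ) (hγβ : γ ≤ β) (hβ : β < 1) (m : ℕ) :
    ∃ C : ℝ≥0∞, C ≠ ∞ ∧
    ∀ {X J : Type*} [MeasurableSpace X] [Countable J] {N : NestedFamily X J} {E : J → Set X}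
      {μ : Measure X} [SigmaFinite μ] (_ : N.IsSparse μ E) (_ : ∀ i, μ (N.cell i) ≠ 0)
      (_ : ∀ i, μ (N.cell i) ≠ ∞) {W : ℕ → X → ℝ≥0∞} {η : X → ℝ≥0∞} (_ : IsGeometric W η)
      {Kq Ks Kp : ℕ → ℝ≥0∞} (_ : ∀ j ≤ m, Kq j ≠ ∞) (_ : ∀ j ≤ m, Ks j ≠ ∞)
      (_ : ∀ j ≤ m, Kp j ≠ ∞)
      (_ : ∀ j ≤ m, N.MuckenhouptBound μ (1 - γ) γ (W j) (Kq j))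
      (_ : ∀ j ≤ m, N.MuckenhouptBound μ (1 - β) γ (W j) (Ks j))
      (_ : ∀ j ≤ m, N.MuckenhouptBound μ (1 - β) β (W j) (Kp j))
      {h : ℕ} (_ : h ≤ m) {f : X → ℝ≥0∞} (_ : Measurable f),
    weightedNorm μ γ (W 0) ((N.opMulRight μ η)^[m - h] (N.sparseOp μ (1 - β + γ)
        ((N.opMulLeft μ η)^[h] f))) ≤
      C * (∏ j ∈ Finset.range (m - h), Kq j) ^ max 1 (γ / (1 - γ)) *
        Ks (m - h) ^ ((1 - β + γ) * max 1 (γ / (1 - β))) *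
        (∏ i ∈ Finset.range h, Kp (m - i)) ^ max 1 (β / (1 - β)) * weightedNorm μ β (W m) f := by
  obtain ⟨C1, hC1, H1⟩ := lintegral_sparseOp_rpow_le (a := 1 - γ) (b := γ) (by linarith) hγ
    (by linarith)
  obtain ⟨C2, hC2, H2⟩ := lintegral_sparseOp_rpow_le (a := 1 - β) (b := γ) (by linarith) hγ
    (by linarith)
  obtain ⟨C3, hC3, H3⟩ := lintegral_sparseOp_rpow_le (a := 1 - β) (b := β) (by linarith)
    (by linarith) (by linarith)
  refine ⟨(C1 + 1) ^ m * C2 * (C3 + 1) ^ m, by finiteness, ?_⟩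
  intro X J _ _ N E μ _ hE hμ0 hμ1 W η hW Kq Ks Kp hKq hKs hKp hWq hWs hWp h hh f hf
  set e1 := max 1 (γ / (1 - γ)) with he1
  set e2 := (1 - β + γ) * max 1 (γ / (1 - β)) with he2
  set e3 := max 1 (β / (1 - β)) with he3
  have h1 : ∀ j ≤ m, ∀ φ, Measurable φ → weightedNorm μ γ (W j) (N.sparseOp μ 1 φ) ≤
      (C1 + 1) * Kq j ^ e1 * weightedNorm μ γ (W j) φ := by
    intro j hj φ hφ
    have := H1 hE hμ0 hμ1 (hW.measurable j) (hW.ne_zero j) (hW.ne_top j) (hKq j hj)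
      (hWq j hj) hφ
    rw [sub_sub_cancel, sub_add_cancel, one_mul] at this
    refine this.trans (mul_le_mul_left (mul_le_mul_left le_self_add _) _)
  have h3 : ∀ j ≤ m, ∀ φ, Measurable φ → weightedNorm μ β (W j) (N.sparseOp μ 1 φ) ≤
      (C3 + 1) * Kp j ^ e3 * weightedNorm μ β (W j) φ := by
    intro j hj φ hφ
    have := H3 hE hμ0 hμ1 (hW.measurable j) (hW.ne_zero j) (hW.ne_top j) (hKp j hj)
      (hWp j hj) hφ
    rw [sub_sub_cancel, sub_add_cancel, one_mul] at this
    refine this.trans (mul_le_mul_left (mul_le_mul_left le_self_add _) _)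
  have h2 : ∀ φ, Measurable φ → weightedNorm μ γ (W (m - h)) (N.sparseOp μ (1 - β + γ) φ) ≤
      C2 * Ks (m - h) ^ e2 * weightedNorm μ β (W (m - h)) φ := by
    intro φ hφ
    have := H2 hE hμ0 hμ1 (hW.measurable _) (hW.ne_zero _) (hW.ne_top _)
      (hKs (m - h) (Nat.sub_le _ _))
      (hWs (m - h) (Nat.sub_le _ _)) hφ
    rwa [sub_sub_cancel] at this
  have hmh : m - h + h = m := Nat.sub_add_cancel hh
  have hg := measurable_opMulLeft_iterate (N := N) (μ := μ) hW.measurable_ratio h hf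
  have hpow (C : ℝ≥0∞) {k : ℕ} (hk : k ≤ m) : (C + 1) ^ k ≤ (C + 1) ^ m :=
    pow_le_pow_right₀ le_add_self hk
  calc _ ≤ (C1 + 1) ^ (m - h) * (∏ j ∈ Finset.range (m - h), Kq j ^ e1) *
        weightedNorm μ γ (W (m - h)) (N.sparseOp μ (1 - β + γ) ((N.opMulLeft μ η)^[h] f)) :=
        weightedNorm_opMulRight_iterate_le hW h1 (Nat.sub_le _ _) (N.measurable_sparseOp _ _ _)
    _ ≤ (C1 + 1) ^ (m - h) * (∏ j ∈ Finset.range (m - h), Kq j ^ e1) *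
        (C2 * Ks (m - h) ^ e2 * ((C3 + 1) ^ h * (∏ i ∈ Finset.range h, Kp (m - i) ^ e3) *
          weightedNorm μ β (W m) f)) := by
        refine mul_le_mul_right ((h2 _ hg).trans (mul_le_mul_right ?_ _)) _
        have := weightedNorm_opMulLeft_iterate_le hW h3 hmh.le hf
        rwa [hmh] at this
    _ ≤ (C1 + 1) ^ m * (∏ j ∈ Finset.range (m - h), Kq j ^ e1) *
        (C2 * Ks (m - h) ^ e2 * ((C3 + 1) ^ m * (∏ i ∈ Finset.range h, Kp (m - i) ^ e3) *
          weightedNorm μ β (W m) f)) := by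
        refine mul_le_mul' (mul_le_mul_left (hpow C1 (Nat.sub_le _ _)) _) (mul_le_mul_right ?_ _)
        exact mul_le_mul_left (mul_le_mul_left (hpow C3 hh) _) _
    _ = _ := by
        rw [ENNReal.prod_rpow_of_nonneg (le_max_of_le_left zero_le_one),
          ENNReal.prod_rpow_of_nonneg (le_max_of_le_left zero_le_one)]
        ring

end NestedFamily

theorem NestedFamily.MuckenhouptBound.restrict {X J : Type*} [MeasurableSpace X]
    {N : NestedFamily X J} {μ : Measure X} {a b : ℝ} {W : X → ℝ≥0∞} {K : ℝ≥0∞}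
    (h : N.MuckenhouptBound μ a b W K) (S : Set J) : (N.restrict S).MuckenhouptBound μ a b W K :=
  fun i => h i

/-- The weighted bound for the sums that dominate commutators of fractional integrals. -/
theorem Grid.weightedNorm_tsum_le {β γ : ℝ} (hγ : 0 < γ) (hγβ : γ ≤ β) (hβ : β < 1) (m : ℕ) :
    ∃ C : ℝ≥0∞, C ≠ ∞ ∧
    ∀ {X Z : Type*} [MeasurableSpace X] [Countable Z] {G : Grid X Z} {μ : Measure X}
      [SigmaFinite μ] (_ : ∀ i, μ (G.family.cell i) ≠ 0) (_ : ∀ i, μ (G.family.cell i) ≠ ∞)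
      {D : ℝ≥0∞} (_ : ∀ k z, μ (G.family.cell (k, G.par z)) ≤ D * μ (G.family.cell (k + 1, z)))
      {b : X → ℝ} (_ : Measurable b) (_ : ∀ i, IntegrableOn b (G.family.cell i) μ)
      (_ : ∀ᵐ x ∂μ, Filter.Tendsto (fun k => ⨍ y in G.family.cell (G.at' k x), b y ∂μ)
        Filter.atTop (nhds (b x)))
      {c : ℕ → ℝ≥0∞} {Cc : ℝ≥0∞} (_ : ∀ l, ∑' k, {k | l ≤ k}.indicator c k ≤ Cc * c l)
      (_ : ∀ i : ℕ × Z, c i.1 * (μ (G.family.cell i))⁻¹ ≤ μ (G.family.cell i) ^ (-(1 - β + γ)))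
      {W : ℕ → X → ℝ≥0∞} {η : X → ℝ≥0∞} (_ : NestedFamily.IsGeometric W η) {B : ℝ≥0∞}
      (_ : ∀ i, G.family.avg μ (G.osc μ b i) i ≤ B * G.family.avg μ η i)
      {Kq Ks Kp : ℕ → ℝ≥0∞} (_ : ∀ j ≤ m, Kq j ≠ ∞) (_ : ∀ j ≤ m, Ks j ≠ ∞)
      (_ : ∀ j ≤ m, Kp j ≠ ∞)
      (_ : ∀ j ≤ m, G.family.MuckenhouptBound μ (1 - γ) γ (W j) (Kq j))
      (_ : ∀ j ≤ m, G.family.MuckenhouptBound μ (1 - β) γ (W j) (Ks j))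
      (_ : ∀ j ≤ m, G.family.MuckenhouptBound μ (1 - β) β (W j) (Kp j))
      {f : X → ℝ≥0∞} (_ : Measurable f),
    weightedNorm μ γ (W 0) (fun x => ∑' k, c k *
        G.family.avg μ (fun y => ENNReal.ofReal |b x - b y| ^ m * f y) (G.at' k x)) ≤
      C * Cc * (1 + D) ^ m * B ^ m * (∑ h ∈ Finset.range (m + 1), (m.choose h : ℝ≥0∞) *
        ((∏ j ∈ Finset.range (m - h), Kq j) ^ max 1 (γ / (1 - γ)) *
        Ks (m - h) ^ ((1 - β + γ) * max 1 (γ / (1 - β))) *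
        (∏ i ∈ Finset.range h, Kp (m - i)) ^ max 1 (β / (1 - β)))) *
        weightedNorm μ β (W m) f := by
  obtain ⟨C, hC, H⟩ := NestedFamily.weightedNorm_iterate_le hγ hγβ hβ m
  refine ⟨(2 * (m + 2 : ℕ)) * (2 * (m + 2 : ℕ)) ^ m * 2 ^ (2 * m * m) * C, by finiteness, ?_⟩
  intro X Z _ _ G μ _ hμ0 hμ1 D hD b hb hint hlim c Cc hc hcs W η hW B hB Kq Ks Kp hKq hKs hKp
    hWq hWs hWp f hf
  set N := G.stopFamily μ b m f with hN
  set A : ℝ≥0∞ := Cc * (2 * (m + 2 : ℕ)) * ((1 + D) * (2 * (m + 2 : ℕ)) * B) ^ m *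
    2 ^ (2 * m * m) with hA
  set g : ℕ → X → ℝ≥0∞ := fun h => (N.opMulRight μ η)^[m - h] (N.sparseOp μ (1 - β + γ)
        ((N.opMulLeft μ η)^[h] f)) with hg
  have hgm (h : ℕ) : Measurable (g h) :=
    NestedFamily.measurable_opMulRight_iterate _ (N.measurable_sparseOp _ _ _)
  have hgm' (h : ℕ) : Measurable fun x => (m.choose h : ℝ≥0∞) * g h x := (hgm h).const_mul _
  calc _ ≤ weightedNorm μ γ (W 0) (fun x => A * ∑ h ∈ Finset.range (m + 1),
        (m.choose h : ℝ≥0∞) * g h x) := by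
        refine weightedNorm_mono hγ.le ?_
        filter_upwards [hlim] with x hx
        exact Grid.tsum_mul_avg_le hμ0 hμ1 hD hb hint hW.measurable_ratio hB hlim hf hc hcs hx
    _ = A * weightedNorm μ γ (W 0) (fun x => ∑ h ∈ Finset.range (m + 1),
        (m.choose h : ℝ≥0∞) * g h x) :=
        weightedNorm_const_mul hγ (hW.measurable 0)
          (Finset.measurable_fun_sum _ fun h _ => hgm' h) _
    _ ≤ A * ∑ h ∈ Finset.range (m + 1), (m.choose h : ℝ≥0∞) * weightedNorm μ γ (W 0) (g h) := by
        refine mul_le_mul_right ((weightedNorm_finset_sum_le hγ (by linarith) (hW.measurable 0)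
          hgm' _).trans (le_of_eq ?_)) _
        refine Finset.sum_congr rfl fun h _ => ?_
        exact weightedNorm_const_mul hγ (hW.measurable 0) (hgm h) _
    _ ≤ A * ∑ h ∈ Finset.range (m + 1), (m.choose h : ℝ≥0∞) *
        (C * (∏ j ∈ Finset.range (m - h), Kq j) ^ max 1 (γ / (1 - γ)) *
        Ks (m - h) ^ ((1 - β + γ) * max 1 (γ / (1 - β))) *
        (∏ i ∈ Finset.range h, Kp (m - i)) ^ max 1 (β / (1 - β)) * weightedNorm μ β (W m) f) := by
        refine mul_le_mul_right (Finset.sum_le_sum fun h hh => mul_le_mul_right ?_ _) _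
        exact H (Grid.isSparse_stopping (G := G) (μ := μ) (Φ := G.stopFun μ b m f) hμ1)
          (fun i => hμ0 i) (fun i => hμ1 i) hW hKq hKs hKp (fun j hj => (hWq j hj).restrict _)
          (fun j hj => (hWs j hj).restrict _) (fun j hj => (hWp j hj).restrict _)
          (Nat.lt_succ_iff.1 (Finset.mem_range.1 hh)) hf
    _ = _ := by
        rw [hA, mul_pow, mul_pow, Finset.mul_sum, Finset.mul_sum, Finset.sum_mul]
        exact Finset.sum_congr rfl fun h _ => by ring

/-! ### The factors in the constant -/

theorem prod_rpow_mul_rpow_eq {ι : Type*} (s : Finset ι) {x y : ι → ℝ} (hx : ∀ i ∈ s, 0 ≤ x i)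
    (hy : ∀ i ∈ s, 0 ≤ y i) (L M : ℝ≥0∞) :
    ∏ i ∈ s, L ^ x i * M ^ y i = L ^ (∑ i ∈ s, x i) * M ^ (∑ i ∈ s, y i) := by
  classical
  induction s using Finset.induction_on with
  | empty => simp
  | insert i s hi ih =>
    rw [Finset.prod_insert hi, Finset.sum_insert hi, Finset.sum_insert hi,
      ih (fun j hj => hx j (Finset.mem_insert_of_mem hj))
        (fun j hj => hy j (Finset.mem_insert_of_mem hj)),
      ENNReal.rpow_add_of_nonneg _ _ (hx i (Finset.mem_insert_self i s))
        (Finset.sum_nonneg fun j hj => hx j (Finset.mem_insert_of_mem hj)),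
      ENNReal.rpow_add_of_nonneg _ _ (hy i (Finset.mem_insert_self i s))
        (Finset.sum_nonneg fun j hj => hy j (Finset.mem_insert_of_mem hj))]
    ring

theorem sum_range_natCast (k : ℕ) : ∑ j ∈ Finset.range k, (j : ℝ) = k * (k - 1) / 2 := by
  induction k with
  | zero => simp
  | succ k ih => rw [Finset.sum_range_succ, ih]; push_cast; ring

/-- The interpolated constant of the `j`-th weight between `λ` and `μ`. -/
noncomputable def interpConst (m : ℕ) (L M : ℝ≥0∞) (j : ℕ) : ℝ≥0∞ :=
  L ^ (((m : ℝ) - j) / m) * M ^ ((j : ℝ) / m)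

theorem prod_interpConst_rpow_eq_factorP {q : ℝ} {m h : ℕ} (hm : 1 ≤ m) (hh : h ≤ m)
    (L M : ℝ≥0∞) : (∏ j ∈ Finset.range (m - h), interpConst m L M j) ^ max 1 (1 / (q - 1)) =
      factorP q m h L M := by
  have hm0 : (0 : ℝ) < m := by exact_mod_cast hm
  have hh' : (h : ℝ) ≤ m := by exact_mod_cast hh
  unfold interpConst factorP
  rw [prod_rpow_mul_rpow_eq _ (fun j hj => ?_) (fun j _ => by positivity),
    ENNReal.rpow_mul (_ * _), ENNReal.mul_rpow_of_nonneg _ _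
      (div_nonneg (sub_nonneg.2 hh') hm0.le), ← ENNReal.rpow_mul, ← ENNReal.rpow_mul,
    ← Finset.sum_div, ← Finset.sum_div, Finset.sum_sub_distrib, sum_range_natCast]
  · simp only [Finset.sum_const, Finset.card_range, nsmul_eq_mul, Nat.cast_sub hh]
    congr 3 <;> · field_simp; ring
  · have : (j : ℝ) ≤ m := by
      have := Finset.mem_range.1 hj
      exact_mod_cast (by omega : j ≤ m)
    exact div_nonneg (sub_nonneg.2 this) hm0.le

theorem prod_interpConst_rpow_eq_factorQ {p : ℝ} {m h : ℕ} (hm : 1 ≤ m) (hh : h ≤ m)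
    (L M : ℝ≥0∞) : (∏ i ∈ Finset.range h, interpConst m L M (m - i)) ^ max 1 (1 / (p - 1)) =
      factorQ p m h L M := by
  have hm0 : (0 : ℝ) < m := by exact_mod_cast hm
  have hh' : (h : ℝ) ≤ m := by exact_mod_cast hh
  have hle {i : ℕ} (hi : i ∈ Finset.range h) : i ≤ m := by
    have := Finset.mem_range.1 hi; omega
  have hprod : ∏ i ∈ Finset.range h, interpConst m L M (m - i) =
      ∏ i ∈ Finset.range h, L ^ ((i : ℝ) / m) * M ^ (((m : ℝ) - i) / m) := by
    refine Finset.prod_congr rfl fun i hi => ?_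
    rw [interpConst, Nat.cast_sub (hle hi), sub_sub_cancel]
  unfold factorQ
  rw [hprod, prod_rpow_mul_rpow_eq _ (fun j _ => by positivity) (fun j hj => ?_),
    ENNReal.rpow_mul (_ * _), ENNReal.mul_rpow_of_nonneg _ _ (show 0 ≤ (h : ℝ) / m by positivity),
    ← ENNReal.rpow_mul, ← ENNReal.rpow_mul, ← Finset.sum_div, ← Finset.sum_div, Finset.sum_sub_distrib,
    sum_range_natCast]
  · simp only [Finset.sum_const, Finset.card_range, nsmul_eq_mul]
    congr 3 <;> · field_simp
  · have : (j : ℝ) ≤ m := by exact_mod_cast hle hj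
    exact div_nonneg (sub_nonneg.2 this) hm0.le

/-! ### Cubes and dyadic grids -/

section Cubes

variable {n : ℕ}

theorem cube_eq_preimage (a : Rn n) (l : ℝ) :
    cube a l = (WithLp.ofLp : Rn n → Fin n → ℝ) ⁻¹'
      (Set.univ.pi fun i => Set.Ico (a i) (a i + l)) := by
  ext x
  simp [cube, Set.mem_pi]

theorem measurableSet_cube (a : Rn n) (l : ℝ) : MeasurableSet (cube a l) := by
  rw [cube_eq_preimage]
  exact (PiLp.volume_preserving_ofLp (Fin n)).measurable
    (MeasurableSet.univ_pi fun i => measurableSet_Ico)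

theorem volume_cube (a : Rn n) (l : ℝ) : volume (cube a l) = ENNReal.ofReal l ^ n := by
  rw [cube_eq_preimage, (PiLp.volume_preserving_ofLp (Fin n)).measure_preimage
    (MeasurableSet.univ_pi fun i => measurableSet_Ico).nullMeasurableSet, Real.volume_pi_Ico]
  simp

theorem volume_cube_ne_zero (a : Rn n) {l : ℝ} (hl : 0 < l) : volume (cube a l) ≠ 0 := by
  rw [volume_cube]
  exact pow_ne_zero _ (by simpa using hl)

theorem volume_cube_ne_top (a : Rn n) (l : ℝ) : volume (cube a l) ≠ ∞ := by
  rw [volume_cube]; finiteness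

theorem norm_sub_le_of_mem_cube {a : Rn n} {l : ℝ} (hl : 0 ≤ l) {x y : Rn n} (hx : x ∈ cube a l)
    (hy : y ∈ cube a l) : ‖x - y‖ ≤ n * l := by
  refine abs_le_of_sq_le_sq' ?_ (by positivity) |>.2
  rw [EuclideanSpace.norm_sq_eq]
  have h1 : ∀ i ∈ Finset.univ, ‖(x - y) i‖ ^ 2 ≤ l ^ 2 := by
    intro i _
    have h2 := hx i
    have h3 := hy i
    rw [Real.norm_eq_abs, sq_abs]
    refine sq_le_sq' ?_ ?_ <;> simp only [PiLp.sub_apply] <;> linarith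
  refine (Finset.sum_le_sum h1).trans ?_
  rw [Finset.sum_const, Finset.card_univ, Fintype.card_fin, nsmul_eq_mul, mul_pow]
  refine mul_le_mul_of_nonneg_right ?_ (by positivity)
  exact_mod_cast Nat.le_self_pow two_ne_zero n

theorem cube_subset_closedBall {a : Rn n} {l : ℝ} (hl : 0 ≤ l) {x : Rn n} (hx : x ∈ cube a l) :
    cube a l ⊆ Metric.closedBall x ((n + 1) * l) := fun y hy => by
  rw [Metric.mem_closedBall, dist_eq_norm]
  have := norm_sub_le_of_mem_cube hl hy hx
  linarith

theorem integrableOn_cube {b : Rn n → ℝ} (hb : LocallyIntegrable b volume) (a : Rn n) {l : ℝ}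
    (hl : 0 < l) : IntegrableOn b (cube a l) := by
  have ha : a ∈ cube a l := fun i => ⟨le_rfl, by linarith⟩
  exact (hb.integrableOn_isCompact (isCompact_closedBall a _)).mono_set
    (cube_subset_closedBall hl.le ha)

end Cubes

section Grid

variable (n : ℕ)

/-- The grid of the cubes with side lengths `L / 2 ^ k`, whose corners are the points of a lattice
that is translated by `v`. -/
noncomputable def dyadicGrid {L : ℝ} (hL : 0 < L) (v : Fin n → ℝ) : Grid (Rn n) (Fin n → ℤ) where
  idx k x i := ⌊(x i - v i) / (L / 2 ^ k)⌋
  par z i := z i / 2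
  idx_par k x := by
    ext i
    have h : (x i - v i) / (L / 2 ^ k) = (x i - v i) / (L / 2 ^ (k + 1)) / (2 : ℕ) := by
      rw [pow_succ]; push_cast; field_simp
    rw [h, Int.floor_div_natCast]
    rfl
  measurableSet k z := by
    refine measurableSet_eq_fun (measurable_pi_lambda _ fun i => ?_) measurable_const
    exact Int.measurable_floor.comp (by fun_prop)
  nonempty k z := by
    refine ⟨WithLp.toLp 2 fun i => v i + z i * (L / 2 ^ k), ?_⟩
    ext i
    have : (0 : ℝ) < L / 2 ^ k := by positivity
    simp [this.ne']

variable {n} {L : ℝ} (hL : 0 < L) (v : Fin n → ℝ)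

theorem dyadicGrid_cell (i : ℕ × (Fin n → ℤ)) : (dyadicGrid n hL v).family.cell i =
    cube (WithLp.toLp 2 fun j => v j + i.2 j * (L / 2 ^ i.1)) (L / 2 ^ i.1) := by
  ext x
  have h : (0 : ℝ) < L / 2 ^ i.1 := by positivity
  rw [Grid.mem_cell_iff]
  simp only [dyadicGrid, cube, Set.mem_ofPred_eq, funext_iff, Int.floor_eq_iff, le_div_iff₀ h,
    div_lt_iff₀ h]
  refine forall_congr' fun j => ⟨fun ⟨h1, h2⟩ => ⟨by linarith, by linarith⟩,
    fun ⟨h1, h2⟩ => ⟨by linarith, by linarith⟩⟩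

theorem volume_dyadicGrid_cell (i : ℕ × (Fin n → ℤ)) :
    volume ((dyadicGrid n hL v).family.cell i) = ENNReal.ofReal (L / 2 ^ i.1) ^ n := by
  rw [dyadicGrid_cell, volume_cube]

theorem volume_dyadicGrid_cell_ne_zero (i : ℕ × (Fin n → ℤ)) :
    volume ((dyadicGrid n hL v).family.cell i) ≠ 0 := by
  rw [dyadicGrid_cell]
  exact volume_cube_ne_zero _ (by positivity)

theorem volume_dyadicGrid_cell_ne_top (i : ℕ × (Fin n → ℤ)) :
    volume ((dyadicGrid n hL v).family.cell i) ≠ ∞ := by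
  rw [dyadicGrid_cell]
  exact volume_cube_ne_top _ _

theorem volume_dyadicGrid_cell_par_le (k : ℕ) (z : Fin n → ℤ) :
    volume ((dyadicGrid n hL v).family.cell (k, (dyadicGrid n hL v).par z)) ≤
      2 ^ n * volume ((dyadicGrid n hL v).family.cell (k + 1, z)) := by
  have h : L / 2 ^ k = 2 * (L / 2 ^ (k + 1)) := by simp only [pow_succ]; field_simp
  rw [volume_dyadicGrid_cell, volume_dyadicGrid_cell, ← mul_pow]
  refine pow_le_pow_left' (le_of_eq ?_) n
  simp only [h]
  rw [ENNReal.ofReal_mul (by norm_num), ENNReal.ofReal_ofNat]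

/-- Lebesgue differentiation along the cells of a grid. -/
theorem ae_tendsto_average_dyadicGrid {b : Rn n → ℝ} (hb : LocallyIntegrable b volume) :
    ∀ᵐ x ∂(volume : Measure (Rn n)), Filter.Tendsto
      (fun k => ⨍ y in (dyadicGrid n hL v).family.cell ((dyadicGrid n hL v).at' k x), b y)
      Filter.atTop (nhds (b x)) := by
  set G := dyadicGrid n hL v with hG
  have hside (k : ℕ) : 0 < L / 2 ^ k := by positivity
  set δ : ℕ → ℝ := fun k => (n + 1) * (L / 2 ^ k) with hδ
  have hδpos (k : ℕ) : 0 < δ k := by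
    have := hside k
    positivity
  have hδlim : Filter.Tendsto δ Filter.atTop (nhdsWithin 0 (Set.Ioi 0)) := by
    refine tendsto_nhdsWithin_iff.2 ⟨?_, Filter.Eventually.of_forall hδpos⟩
    have h := (tendsto_pow_atTop_nhds_zero_of_lt_one (r := (1 / 2 : ℝ)) (by norm_num)
      (by norm_num)).const_mul ((n + 1) * L)
    rw [mul_zero] at h
    refine h.congr fun k => ?_
    rw [hδ]; simp only [one_div, inv_pow]; ring
  set K : ℝ := (n + 1) ^ n * (volume (Metric.ball (0 : Rn n) 1)).toReal with hK
  have hω : 0 < (volume (Metric.ball (0 : Rn n) 1)).toReal :=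
    ENNReal.toReal_pos (Metric.measure_ball_pos _ _ one_pos).ne' measure_ball_lt_top.ne
  filter_upwards [IsUnifLocDoublingMeasure.ae_tendsto_average_norm_sub volume hb 1] with x hx
  have h1 := (hx (fun _ => x) δ hδlim (Filter.Eventually.of_forall fun k =>
    Metric.mem_closedBall_self (by have := hδpos k; linarith))).const_mul K
  rw [mul_zero] at h1
  rw [tendsto_iff_norm_sub_tendsto_zero]
  refine squeeze_zero (fun _ => norm_nonneg _) (fun k => ?_) h1
  set Q := G.family.cell (G.at' k x) with hQ
  have hxQ : x ∈ Q := Grid.mem_cell_at k x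
  have hQB : Q ⊆ Metric.closedBall x (δ k) := by
    rw [hQ, hG, dyadicGrid_cell] at hxQ ⊢
    exact cube_subset_closedBall (hside k).le hxQ
  have hQ0 : volume Q ≠ 0 := volume_dyadicGrid_cell_ne_zero hL v _
  have hQ1 : volume Q ≠ ∞ := volume_dyadicGrid_cell_ne_top hL v _
  have hintB : IntegrableOn (fun y => b y - b x) (Metric.closedBall x (δ k)) :=
    (hb.integrableOn_isCompact (isCompact_closedBall x _)).sub
      (by rw [integrableOn_const_iff]; right; exact measure_closedBall_lt_top)
  have hvolQ : volume.real Q = (L / 2 ^ k) ^ n := by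
    rw [Measure.real, hQ, hG, volume_dyadicGrid_cell, ENNReal.toReal_pow]
    exact congrArg (· ^ n) (ENNReal.toReal_ofReal (hside k).le)
  have hvolB : volume.real (Metric.closedBall x (δ k)) = K * (L / 2 ^ k) ^ n := by
    rw [Measure.real, Measure.addHaar_closedBall _ _ (hδpos k).le, finrank_euclideanSpace_fin,
      ENNReal.toReal_mul, ENNReal.toReal_ofReal (by have := hδpos k; positivity), hK, hδ, mul_pow]
    ring
  have hc : IntegrableOn (fun _ : Rn n => b x) Q := by
    rw [integrableOn_const_iff]; right; exact hQ1.lt_top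
  have hbQ : IntegrableOn b Q := (hb.integrableOn_isCompact (isCompact_closedBall x _)).mono_set hQB
  have h2 : (⨍ y in Q, b y) - b x = ⨍ y in Q, (b y - b x) := by
    rw [setAverage_eq, setAverage_eq, integral_sub hbQ hc, smul_sub,
      ← setAverage_eq _ (fun _ => b x), setAverage_const hQ0 hQ1]
  rw [h2, setAverage_eq, setAverage_eq, norm_smul, hvolQ, hvolB, smul_eq_mul, norm_inv,
    Real.norm_of_nonneg (by have := hside k; positivity), mul_inv, ← mul_assoc, ← mul_assoc,
    mul_inv_cancel₀ (by positivity), one_mul]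
  refine mul_le_mul_of_nonneg_left ?_ (by have := hside k; positivity)
  exact (norm_integral_le_integral_norm _).trans (setIntegral_mono_set hintB.norm
    (ae_of_all _ fun _ => norm_nonneg _) (ae_of_all _ hQB))

/-- The one-third trick: two points at distance at most `1 / 3` lie in a common interval of the grid of
unit intervals, or of its translate by `2 ^ k / 3`. -/
theorem floor_eq_or_floor_sub_eq {u w : ℝ} (k : ℕ) (h : |u - w| ≤ 1 / 3) :
    ⌊u⌋ = ⌊w⌋ ∨ ⌊u - 2 ^ k / 3⌋ = ⌊w - 2 ^ k / 3⌋ := by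
  wlog huw : u ≤ w generalizing u w
  · rw [abs_sub_comm] at h
    exact (this h (le_of_not_ge huw)).imp Eq.symm Eq.symm
  by_contra! hcon
  obtain ⟨h1, h2⟩ := hcon
  have h1' : u < ⌊w⌋ := Int.floor_lt.1 (lt_of_le_of_ne (Int.floor_mono huw) h1)
  have h2' : u - 2 ^ k / 3 < ⌊w - 2 ^ k / 3⌋ :=
    Int.floor_lt.1 (lt_of_le_of_ne (Int.floor_mono (by linarith)) h2)
  have h3 := Int.floor_le w
  have h4 := Int.floor_le (w - 2 ^ k / 3)
  set a := ⌊w⌋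
  set c := ⌊w - 2 ^ k / 3⌋
  have h5 : w - u ≤ 1 / 3 := by rw [abs_le] at h; linarith [h.1]
  -- the distance of two break points is a multiple of `1 / 3` which is not zero
  have h6 : (3 * (a - c) : ℤ) < 2 ^ k + 1 := by
    have : (3 * (a - c) : ℝ) < 2 ^ k + 1 := by linarith
    exact_mod_cast this
  have h7 : (2 ^ k - 1 : ℤ) < 3 * (a - c) := by
    have : (2 ^ k - 1 : ℝ) < 3 * (a - c) := by linarith
    exact_mod_cast this
  have h8 : (3 : ℤ) ∣ 2 ^ k := ⟨a - c, by omega⟩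
  have h9 : (3 : ℤ) ∣ 2 := Int.prime_three.dvd_of_dvd_pow h8
  norm_num at h9

/-- Two points at a small distance lie in a common cube of comparable side, for one of two
translates in each coordinate. -/
theorem exists_idx_eq {x y : Rn n} (hxy : x ≠ y) (h : ‖x - y‖ < L / 3) :
    ∃ (t : Fin n → Fin 2) (k : ℕ), L / 2 ^ k ≤ 6 * ‖x - y‖ ∧
      (dyadicGrid n hL fun i => (t i : ℕ) * (L / 3)).idx k x =
      (dyadicGrid n hL fun i => (t i : ℕ) * (L / 3)).idx k y := by
  have hd : 0 < ‖x - y‖ := norm_pos_iff.2 (sub_ne_zero.2 hxy)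
  obtain ⟨k, hk1, hk2⟩ := exists_nat_pow_near (x := L / (3 * ‖x - y‖)) (y := (2 : ℝ))
    (by rw [le_div_iff₀ (by positivity)]; linarith) one_lt_two
  rw [le_div_iff₀ (by positivity)] at hk1
  rw [div_lt_iff₀ (by positivity)] at hk2
  have hℓ : 0 < L / 2 ^ k := by positivity
  have h3 : ‖x - y‖ ≤ L / 2 ^ k / 3 := by
    rw [div_div, le_div_iff₀ (by positivity)]
    linarith
  refine ⟨fun i => if ⌊x i / (L / 2 ^ k)⌋ = ⌊y i / (L / 2 ^ k)⌋ then 0 else 1, k, ?_, ?_⟩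
  · rw [div_le_iff₀ (by positivity)]
    rw [pow_succ] at hk2
    linarith
  · ext i
    have hshift (u : ℝ) : (u - L / 3) / (L / 2 ^ k) = u / (L / 2 ^ k) - 2 ^ k / 3 := by
      field_simp
    have hcoord : |x i / (L / 2 ^ k) - y i / (L / 2 ^ k)| ≤ 1 / 3 := by
      rw [← sub_div, abs_div, abs_of_pos hℓ, div_le_iff₀ hℓ]
      have := PiLp.norm_apply_le (x - y) i
      rw [Real.norm_eq_abs, PiLp.sub_apply] at this
      linarith
    simp only [dyadicGrid]
    split_ifs with hi
    · simpa using hi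
    · simp only [Fin.val_one, Nat.cast_one, one_mul, hshift]
      exact (floor_eq_or_floor_sub_eq k hcoord).resolve_left hi

end Grid

/-! ### The fractional integral and sums over cells -/

theorem Grid.measurable_avg_at {X Z : Type*} [MeasurableSpace X] [Countable Z] (G : Grid X Z)
    {μ : Measure X} [SigmaFinite μ] {F : X → X → ℝ≥0∞} (hF : Measurable (Function.uncurry F))
    (k : ℕ) : Measurable fun x => G.family.avg μ (F x) (G.at' k x) := by
  let : MeasurableSpace Z := ⊤
  have hidx : Measurable (G.idx k) := measurable_to_countable' fun z => G.measurableSet k z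
  have h : Measurable fun p : X × Z => G.family.avg μ (F p.1) (k, p.2) := by
    refine measurable_from_prod_countable_left fun z => ?_
    unfold NestedFamily.avg
    simp only
    exact (Measurable.lintegral_prod_right' hF).div_const _
  exact h.comp (measurable_id.prodMk hidx)

theorem weightedNorm_iSup {X : Type*} [MeasurableSpace X] {μ : Measure X} {r : ℝ} (hr : 0 < r)
    {W : X → ℝ≥0∞} (hW : Measurable W) {T : ℕ → X → ℝ≥0∞} (hT : ∀ N, Measurable (T N))
    (hmono : Monotone T) :
    weightedNorm μ r W (fun x => ⨆ N, T N x) = ⨆ N, weightedNorm μ r W (T N) := by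
  have hpow {e : ℝ} (he : 0 < e) (u : ℕ → ℝ≥0∞) : (⨆ N, u N) ^ e = ⨆ N, u N ^ e :=
    (ENNReal.orderIsoRpow e he).map_iSup u
  have hr' : 0 < 1 / r := one_div_pos.2 hr
  unfold weightedNorm
  simp_rw [ENNReal.iSup_mul, hpow hr']
  rw [lintegral_iSup (f := fun N x => (T N x * W x) ^ (1 / r))
    (fun N => ((hT N).mul hW).pow_const _) fun N M hNM x =>
    ENNReal.rpow_le_rpow (mul_le_mul_left (hmono hNM x) _) hr'.le, hpow hr]

section Euclidean

variable {n : ℕ}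

/-- The kernel of the fractional integral. -/
noncomputable def rieszKernel (α : ℝ) (x y : Rn n) : ℝ≥0∞ :=
  ENNReal.ofReal (‖x - y‖ ^ ((n : ℝ) - α))⁻¹

theorem measurable_rieszKernel (α : ℝ) :
    Measurable (Function.uncurry (rieszKernel α : Rn n → Rn n → ℝ≥0∞)) := by
  unfold rieszKernel Function.uncurry
  fun_prop

theorem rieszKernel_self {α : ℝ} (hαn : α < n) (x : Rn n) : rieszKernel α x x = 0 := by
  simp [rieszKernel, Real.zero_rpow (sub_pos.2 hαn).ne']

/-- The side lengths of the cubes of a grid decay geometrically. -/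
theorem tsum_side_rpow_le {α : ℝ} (hα : 0 < α) : ∃ C : ℝ≥0∞, C ≠ ∞ ∧ ∀ {L : ℝ}, 0 < L → ∀ l : ℕ,
    ∑' k, {k | l ≤ k}.indicator (fun k : ℕ => ENNReal.ofReal (L / 2 ^ k) ^ α) k ≤
      C * ENNReal.ofReal (L / 2 ^ l) ^ α := by
  set r : ℝ≥0∞ := ENNReal.ofReal (1 / 2) ^ α with hr
  have hr1 : r < 1 := ENNReal.rpow_lt_one (by rw [ENNReal.ofReal_lt_one]; norm_num) hα
  refine ⟨(1 - r)⁻¹, ENNReal.inv_ne_top.2 (tsub_pos_of_lt hr1).ne', fun {L} hL l => ?_⟩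
  rw [← Summable.sum_add_tsum_nat_add' (k := l) ENNReal.summable]
  have h1 : ∑ i ∈ Finset.range l, {k | l ≤ k}.indicator
      (fun k : ℕ => ENNReal.ofReal (L / 2 ^ k) ^ α) i = 0 := by
    refine Finset.sum_eq_zero fun i hi => Set.indicator_of_notMem ?_ _
    have := Finset.mem_range.1 hi
    simp only [Set.mem_ofPred_eq]
    omega
  have h2 (i : ℕ) : {k | l ≤ k}.indicator (fun k : ℕ => ENNReal.ofReal (L / 2 ^ k) ^ α) (i + l) =
      r ^ i * ENNReal.ofReal (L / 2 ^ l) ^ α := by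
    rw [Set.indicator_of_mem (by exact Nat.le_add_left l i)]
    have h3 : L / 2 ^ (i + l) = (1 / 2) ^ i * (L / 2 ^ l) := by
      rw [pow_add, one_div, inv_pow]; field_simp
    rw [h3, ENNReal.ofReal_mul (by positivity), ENNReal.mul_rpow_of_nonneg _ _ hα.le,
      ENNReal.ofReal_pow (by norm_num), hr, ← ENNReal.rpow_natCast, ← ENNReal.rpow_natCast,
      ← ENNReal.rpow_mul, ← ENNReal.rpow_mul, mul_comm]
    ring_nf
  simp_rw [h1, h2, ENNReal.tsum_mul_right, ENNReal.tsum_geometric, zero_add]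
  exact le_rfl

theorem rieszKernel_le_of_side_le {α : ℝ} (hαn : α < n) {x y : Rn n} (hxy : x ≠ y) {s : ℝ}
    (hs : 0 < s) (h : s ≤ 6 * ‖x - y‖) :
    rieszKernel α x y ≤ ENNReal.ofReal (6 ^ (n - α)) * ENNReal.ofReal s ^ (α - n) := by
  have hd : 0 < ‖x - y‖ := norm_pos_iff.2 (sub_ne_zero.2 hxy)
  have hn : 0 < n - α := sub_pos.2 hαn
  rw [rieszKernel, ENNReal.ofReal_rpow_of_pos hs, ← ENNReal.ofReal_mul (by positivity)]
  refine ENNReal.ofReal_le_ofReal ?_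
  rw [show α - n = -(n - α) by ring, Real.rpow_neg hs.le, ← div_eq_mul_inv, ← one_div,
    div_le_div_iff₀ (by positivity) (by positivity), one_mul, ← Real.mul_rpow (by norm_num) hd.le]
  exact Real.rpow_le_rpow hs.le h hn.le

/-- The fractional integral, restricted to short distances, is dominated by a sum of averages over
the cubes of finitely many grids. -/
theorem lintegral_ball_rieszKernel_mul_le {α : ℝ} (hαn : α < n) {L : ℝ} (hL : 0 < L)
    {F : Rn n → ℝ≥0∞} (hF : Measurable F) (x : Rn n) :
    ∫⁻ y in Metric.ball x (L / 3), rieszKernel α x y * F y ≤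
      ENNReal.ofReal (6 ^ (n - α)) * ∑ t : Fin n → Fin 2, ∑' k : ℕ,
        ENNReal.ofReal (L / 2 ^ k) ^ α *
          (dyadicGrid n hL fun i => (t i : ℕ) * (L / 3)).family.avg volume F
            ((dyadicGrid n hL fun i => (t i : ℕ) * (L / 3)).at' k x) := by
  set G : (Fin n → Fin 2) → Grid (Rn n) (Fin n → ℤ) :=
    fun t => dyadicGrid n hL fun i => (t i : ℕ) * (L / 3) with hG
  set A := ENNReal.ofReal (6 ^ (n - α)) with hA
  have hside (k : ℕ) : 0 < L / 2 ^ k := by positivity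
  have hmeas (t : Fin n → Fin 2) (k : ℕ) : Measurable fun y =>
      ((G t).family.cell ((G t).at' k x)).indicator
        (fun y => ENNReal.ofReal (L / 2 ^ k) ^ (α - n) * F y) y :=
    (hF.const_mul _).indicator ((G t).family.measurableSet_cell _)
  have hpt : ∀ y ∈ Metric.ball x (L / 3), rieszKernel α x y * F y ≤
      A * ∑ t : Fin n → Fin 2, ∑' k : ℕ, ((G t).family.cell ((G t).at' k x)).indicator
        (fun y => ENNReal.ofReal (L / 2 ^ k) ^ (α - n) * F y) y := by
    intro y hy
    rcases eq_or_ne x y with rfl | hxy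
    · rw [rieszKernel_self hαn, zero_mul]; exact zero_le
    have hd : ‖x - y‖ < L / 3 := by
      rwa [Metric.mem_ball, dist_comm, dist_eq_norm] at hy
    obtain ⟨t, k, hk, hidx⟩ := exists_idx_eq hL hxy hd
    have hmem : y ∈ (G t).family.cell ((G t).at' k x) := hidx.symm
    calc rieszKernel α x y * F y
        ≤ A * ENNReal.ofReal (L / 2 ^ k) ^ (α - n) * F y :=
          mul_le_mul_left (rieszKernel_le_of_side_le hαn hxy (hside k) hk) _
      _ = A * ((G t).family.cell ((G t).at' k x)).indicator
        (fun y => ENNReal.ofReal (L / 2 ^ k) ^ (α - n) * F y) y := by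
          rw [Set.indicator_of_mem hmem, mul_assoc]
      _ ≤ _ := by
          refine mul_le_mul_right ?_ _
          refine le_trans (ENNReal.le_tsum k) (Finset.single_le_sum
            (f := fun t => ∑' k : ℕ, ((G t).family.cell ((G t).at' k x)).indicator
              (fun y => ENNReal.ofReal (L / 2 ^ k) ^ (α - n) * F y) y)
            (fun _ _ => zero_le) (Finset.mem_univ t))
  calc _ ≤ ∫⁻ y in Metric.ball x (L / 3), A * ∑ t : Fin n → Fin 2, ∑' k : ℕ,
        ((G t).family.cell ((G t).at' k x)).indicator
        (fun y => ENNReal.ofReal (L / 2 ^ k) ^ (α - n) * F y) y :=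
        setLIntegral_mono' measurableSet_ball hpt
    _ ≤ ∫⁻ y, A * ∑ t : Fin n → Fin 2, ∑' k : ℕ,
        ((G t).family.cell ((G t).at' k x)).indicator
        (fun y => ENNReal.ofReal (L / 2 ^ k) ^ (α - n) * F y) y := setLIntegral_le_lintegral _ _
    _ = A * ∑ t : Fin n → Fin 2, ∑' k : ℕ, ENNReal.ofReal (L / 2 ^ k) ^ (α - n) *
          ∫⁻ y in (G t).family.cell ((G t).at' k x), F y := by
        rw [lintegral_const_mul _ (Finset.measurable_fun_sum _ fun t _ =>
          Measurable.tsum fun k => hmeas t k), lintegral_finsetSum _ fun t _ =>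
          Measurable.tsum fun k => hmeas t k]
        congr 1
        refine Finset.sum_congr rfl fun t _ => ?_
        rw [lintegral_tsum fun k => (hmeas t k).aemeasurable]
        refine tsum_congr fun k => ?_
        rw [lintegral_indicator ((G t).family.measurableSet_cell _), lintegral_const_mul _ hF]
    _ = _ := by
        congr 1
        refine Finset.sum_congr rfl fun t _ => tsum_congr fun k => ?_
        have h0 : ENNReal.ofReal (L / 2 ^ k) ≠ 0 := by simpa using hside k
        rw [NestedFamily.avg, volume_dyadicGrid_cell, ENNReal.div_eq_inv_mul, ← mul_assoc,
          sub_eq_add_neg, ENNReal.rpow_add _ _ h0 ENNReal.ofReal_ne_top, ENNReal.rpow_neg,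
          ENNReal.rpow_natCast]
        rfl

/-- The Muckenhoupt condition over all cubes for the weight `W`, with constant `K` and exponents
`1/a` and `1/b`. -/
def CubeMuckenhoupt (a b : ℝ) (W : Rn n → ℝ≥0∞) (K : ℝ≥0∞) : Prop :=
  ∀ (x : Rn n) (l : ℝ), 0 < l →
    (∫⁻ y in cube x l, W y ^ (1 / b)) * (∫⁻ y in cube x l, W y ^ (-(1 / a))) ^ (a / b) ≤
      K * volume (cube x l) ^ (1 + a / b)

theorem CubeMuckenhoupt.muckenhouptBound {a b : ℝ} {W : Rn n → ℝ≥0∞} {K : ℝ≥0∞}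
    (h : CubeMuckenhoupt a b W K) {L : ℝ} (hL : 0 < L) (v : Fin n → ℝ) :
    (dyadicGrid n hL v).family.MuckenhouptBound volume a b W K := by
  intro i
  rw [dyadicGrid_cell]
  exact h _ _ (by positivity)

/-- The weighted bound for the positive operator that dominates the commutator. -/
theorem weightedNorm_lintegral_rieszKernel_le {α β γ : ℝ} (hα : 0 < α) (hαn : α < n) (hγ : 0 < γ)
    (hβγ : γ + α / n = β) (hβ : β < 1) (m : ℕ) :
    ∃ C : ℝ≥0∞, C ≠ ∞ ∧
    ∀ {b : Rn n → ℝ} (_ : Measurable b) (_ : LocallyIntegrable b volume)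
      {W : ℕ → Rn n → ℝ≥0∞} {η : Rn n → ℝ≥0∞} (_ : NestedFamily.IsGeometric W η) {B : ℝ≥0∞}
      (_ : ∀ (a : Rn n) (l : ℝ), 0 < l →
        ∫⁻ x in cube a l, ENNReal.ofReal |b x - ⨍ y in cube a l, b y| ≤ B * ∫⁻ x in cube a l, η x)
      {Kq Ks Kp : ℕ → ℝ≥0∞} (_ : ∀ j ≤ m, Kq j ≠ ∞) (_ : ∀ j ≤ m, Ks j ≠ ∞)
      (_ : ∀ j ≤ m, Kp j ≠ ∞)
      (_ : ∀ j ≤ m, CubeMuckenhoupt (1 - γ) γ (W j) (Kq j))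
      (_ : ∀ j ≤ m, CubeMuckenhoupt (1 - β) γ (W j) (Ks j))
      (_ : ∀ j ≤ m, CubeMuckenhoupt (1 - β) β (W j) (Kp j))
      {f : Rn n → ℝ≥0∞} (_ : Measurable f),
    weightedNorm volume γ (W 0) (fun x => ∫⁻ y, rieszKernel α x y *
        (ENNReal.ofReal |b x - b y| ^ m * f y)) ≤
      C * B ^ m * (∑ h ∈ Finset.range (m + 1), (m.choose h : ℝ≥0∞) *
        ((∏ j ∈ Finset.range (m - h), Kq j) ^ max 1 (γ / (1 - γ)) *
        Ks (m - h) ^ ((1 - β + γ) * max 1 (γ / (1 - β))) *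
        (∏ i ∈ Finset.range h, Kp (m - i)) ^ max 1 (β / (1 - β)))) *
        weightedNorm volume β (W m) f := by
  have hn : (0 : ℝ) < n := hα.trans hαn
  have hγβ : γ ≤ β := by rw [← hβγ]; linarith [div_pos hα hn]
  obtain ⟨C1, hC1, H⟩ := Grid.weightedNorm_tsum_le hγ hγβ hβ m
  obtain ⟨C2, hC2, H2⟩ := tsum_side_rpow_le hα
  refine ⟨ENNReal.ofReal (6 ^ (n - α)) * 2 ^ n * C1 * C2 * (1 + 2 ^ n) ^ m, by finiteness, ?_⟩
  intro b hb hbloc W η hW B hB Kq Ks Kp hKq hKs hKp hWq hWs hWp f hf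
  set A := ENNReal.ofReal (6 ^ (n - α)) with hA
  set S := ∑ h ∈ Finset.range (m + 1), (m.choose h : ℝ≥0∞) *
        ((∏ j ∈ Finset.range (m - h), Kq j) ^ max 1 (γ / (1 - γ)) *
        Ks (m - h) ^ ((1 - β + γ) * max 1 (γ / (1 - β))) *
        (∏ i ∈ Finset.range h, Kp (m - i)) ^ max 1 (β / (1 - β))) with hS
  set F : Rn n → Rn n → ℝ≥0∞ := fun x y => ENNReal.ofReal |b x - b y| ^ m * f y with hF
  have hFm : Measurable (Function.uncurry F) := by
    rw [hF]; unfold Function.uncurry; fun_prop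
  have hFx (x : Rn n) : Measurable (F x) := hFm.of_uncurry_left
  have hstep (L : ℝ) (hL : 0 < L) : weightedNorm volume γ (W 0) (fun x =>
      ∫⁻ y in Metric.ball x (L / 3), rieszKernel α x y * F x y) ≤
      A * (2 ^ n * (C1 * C2 * (1 + 2 ^ n) ^ m * B ^ m * S * weightedNorm volume β (W m) f)) := by
    set G : (Fin n → Fin 2) → Grid (Rn n) (Fin n → ℤ) :=
      fun t => dyadicGrid n hL fun i => (t i : ℕ) * (L / 3) with hG
    have hm (t : Fin n → Fin 2) : Measurable fun x => ∑' k : ℕ, ENNReal.ofReal (L / 2 ^ k) ^ α *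
        (G t).family.avg volume (F x) ((G t).at' k x) :=
      Measurable.tsum fun k => ((G t).measurable_avg_at hFm k).const_mul _
    calc _ ≤ weightedNorm volume γ (W 0) (fun x => A * ∑ t : Fin n → Fin 2, ∑' k : ℕ,
          ENNReal.ofReal (L / 2 ^ k) ^ α * (G t).family.avg volume (F x) ((G t).at' k x)) :=
          weightedNorm_mono hγ.le (ae_of_all _ fun x =>
            lintegral_ball_rieszKernel_mul_le hαn hL (hFx x) x)
      _ = A * weightedNorm volume γ (W 0) (fun x => ∑ t : Fin n → Fin 2, ∑' k : ℕ,
          ENNReal.ofReal (L / 2 ^ k) ^ α * (G t).family.avg volume (F x) ((G t).at' k x)) :=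
          weightedNorm_const_mul hγ (hW.measurable 0)
            (Finset.measurable_fun_sum _ fun t _ => hm t) _
      _ ≤ A * ∑ t : Fin n → Fin 2, weightedNorm volume γ (W 0) (fun x => ∑' k : ℕ,
          ENNReal.ofReal (L / 2 ^ k) ^ α * (G t).family.avg volume (F x) ((G t).at' k x)) :=
          mul_le_mul_right (weightedNorm_finset_sum_le hγ (hγβ.trans hβ.le) (hW.measurable 0)
            hm _) _
      _ ≤ A * ∑ _t : Fin n → Fin 2,
          (C1 * C2 * (1 + 2 ^ n) ^ m * B ^ m * S * weightedNorm volume β (W m) f) := by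
          refine mul_le_mul_right (Finset.sum_le_sum fun t _ => ?_) _
          refine H (volume_dyadicGrid_cell_ne_zero hL _) (volume_dyadicGrid_cell_ne_top hL _)
            (volume_dyadicGrid_cell_par_le hL _) hb (fun i => ?_)
            (ae_tendsto_average_dyadicGrid hL _ hbloc) (H2 hL) (fun i => ?_) hW (B := B)
            (fun i => ?_) hKq hKs hKp
            (fun j hj => (hWq j hj).muckenhouptBound hL _)
            (fun j hj => (hWs j hj).muckenhouptBound hL _)
            (fun j hj => (hWp j hj).muckenhouptBound hL _) hf
          · rw [dyadicGrid_cell]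
            exact integrableOn_cube hbloc _ (by positivity)
          · have hside : 0 < L / 2 ^ i.1 := by positivity
            have h0 : ENNReal.ofReal (L / 2 ^ i.1) ≠ 0 := by simpa using hside
            rw [volume_dyadicGrid_cell, ← ENNReal.rpow_natCast, ← ENNReal.rpow_neg,
              ← ENNReal.rpow_add _ _ h0 ENNReal.ofReal_ne_top, ← ENNReal.rpow_mul]
            refine le_of_eq (congrArg _ ?_)
            rw [← hβγ]
            field_simp
            ring
          · unfold NestedFamily.avg
            rw [← mul_div_assoc]
            refine ENNReal.div_le_div_right ?_ _
            unfold Grid.osc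
            rw [dyadicGrid_cell]
            exact hB _ _ (by positivity)
      _ = _ := by simp
  -- exhaust the space by balls
  set T : ℕ → Rn n → ℝ≥0∞ := fun N x =>
    ∫⁻ y in Metric.ball x ((3 * (N + 1) : ℝ) / 3), rieszKernel α x y * F x y with hT
  have hkF : Measurable (Function.uncurry fun x y => rieszKernel α x y * F x y) :=
    (measurable_rieszKernel α).mul hFm
  have hTm (N : ℕ) : Measurable (T N) := by
    have h1 : MeasurableSet {p : Rn n × Rn n | dist p.2 p.1 < (3 * (N + 1) : ℝ) / 3} :=
      measurableSet_lt (by fun_prop) measurable_const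
    have h2 := Measurable.lintegral_prod_right' (ν := volume) (hkF.indicator h1)
    convert h2 using 1
    ext x
    rw [hT]
    simp only
    rw [← lintegral_indicator measurableSet_ball]
    rfl
  have hTmono : Monotone T := fun N M hNM x => by
    refine lintegral_mono_set (Metric.ball_subset_ball ?_)
    have : (N : ℝ) ≤ M := by exact_mod_cast hNM
    linarith
  have hTsup (x : Rn n) : ⨆ N, T N x = ∫⁻ y, rieszKernel α x y * F x y := by
    have h1 : ⋃ N : ℕ, Metric.ball x ((3 * (N + 1) : ℝ) / 3) = Set.univ := by
      refine Set.eq_univ_of_forall fun y => Set.mem_iUnion.2 ?_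
      obtain ⟨N, hN⟩ := exists_nat_gt (dist y x)
      exact ⟨N, by rw [Metric.mem_ball]; linarith⟩
    have h2 : Monotone fun N : ℕ => Metric.ball x ((3 * (N + 1) : ℝ) / 3) := fun N M hNM => by
      refine Metric.ball_subset_ball ?_
      have : (N : ℝ) ≤ M := by exact_mod_cast hNM
      linarith
    rw [← setLIntegral_univ, ← h1, setLIntegral_iUnion_of_directed _ h2.directed_le]
  have hlim : weightedNorm volume γ (W 0) (fun x => ∫⁻ y, rieszKernel α x y * F x y) =
      ⨆ N, weightedNorm volume γ (W 0) (T N) := by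
    simp_rw [← hTsup]
    exact weightedNorm_iSup hγ (hW.measurable 0) hTm hTmono
  rw [hlim]
  refine iSup_le fun N => ?_
  refine (hstep (3 * (N + 1)) (by positivity)).trans (le_of_eq ?_)
  ring

/-! ### Weights -/

/-- `W` is a measurable, everywhere positive and finite version of the weight `w`. -/
structure IsVersion (W : Rn n → ℝ≥0∞) (w : Rn n → ℝ) : Prop where
  measurable : Measurable W
  ne_zero : ∀ x, W x ≠ 0
  ne_top : ∀ x, W x ≠ ∞
  ae_pos : ∀ᵐ x, 0 < w x
  ae_eq : ∀ᵐ x, W x = ENNReal.ofReal (w x)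

theorem IsWeight.exists_isVersion {w : Rn n → ℝ} (hw : IsWeight w) : ∃ W, IsVersion W w := by
  set w' := hw.aemeasurable.mk w with hw'
  have hm : Measurable w' := hw.aemeasurable.measurable_mk
  refine ⟨fun x => if 0 < w' x then ENNReal.ofReal (w' x) else 1,
    Measurable.ite (measurableSet_lt measurable_const hm) hm.ennreal_ofReal measurable_const,
    fun x => ?_, fun x => ?_, hw.pos, ?_⟩
  · split_ifs with h
    · simpa using h
    · exact one_ne_zero
  · split_ifs <;> finiteness
  · filter_upwards [hw.pos, hw.aemeasurable.ae_eq_mk] with x h1 h2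
    have h3 : w' x = w x := h2.symm
    rw [h3, if_pos h1]

theorem IsVersion.ae_rpow_eq {W : Rn n → ℝ≥0∞} {w : Rn n → ℝ} (h : IsVersion W w) (r : ℝ) :
    ∀ᵐ x, ENNReal.ofReal (w x ^ r) = W x ^ r := by
  filter_upwards [h.ae_pos, h.ae_eq] with x h1 h2
  rw [h2, ENNReal.ofReal_rpow_of_pos h1]

theorem cubeAvg_congr {f g : Rn n → ℝ≥0∞} (h : ∀ᵐ x, f x = g x) (a : Rn n) (l : ℝ) :
    cubeAvg a l f = cubeAvg a l g := by
  unfold cubeAvg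
  rw [lintegral_congr_ae (ae_restrict_of_ae h)]

theorem mul_rpow_div_le_iff {A B K v : ℝ≥0∞} (hv0 : v ≠ 0) (hv1 : v ≠ ∞) {r : ℝ} (hr : 0 ≤ r) :
    A / v * (B / v) ^ r ≤ K ↔ A * B ^ r ≤ K * v ^ (1 + r) := by
  have h0 : v ^ (1 + r) ≠ 0 := (ENNReal.rpow_pos (pos_iff_ne_zero.2 hv0) hv1).ne'
  have h1 : v ^ (1 + r) ≠ ∞ := ENNReal.rpow_ne_top_of_nonneg (by positivity) hv1
  rw [← ENNReal.div_le_iff_le_mul (Or.inl h0) (Or.inl h1), ENNReal.div_rpow_of_nonneg _ _ hr,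
    ENNReal.rpow_add _ _ hv0 hv1, ENNReal.rpow_one, div_eq_mul_inv, div_eq_mul_inv, div_eq_mul_inv,
    ENNReal.mul_inv (Or.inl hv0) (Or.inl hv1)]
  exact iff_of_eq (by congr 1; ring)

theorem one_sub_one_div_eq {p : ℝ} (hp : 1 < p) : 1 - 1 / p = 1 / p.conjExponent := by
  have h := (Real.HolderConjugate.conjExponent hp).inv_add_inv_eq_one
  rw [one_div, one_div]
  linarith

theorem conjExponent_pos {p : ℝ} (hp : 1 < p) : 0 < p.conjExponent :=
  (Real.HolderConjugate.conjExponent hp).symm.pos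

theorem apqConst_le_iff {p q : ℝ} (hp : 1 < p) (hq : 0 < q) {w : Rn n → ℝ} {W : Rn n → ℝ≥0∞}
    (hW : IsVersion W w) {K : ℝ≥0∞} :
    apqConst p q w ≤ K ↔ CubeMuckenhoupt (1 - 1 / p) (1 / q) W K := by
  have hp' := conjExponent_pos hp
  unfold apqConst CubeMuckenhoupt
  simp only [iSup_le_iff]
  refine forall_congr' fun a => forall_congr' fun l => forall_congr' fun hl => ?_
  have h : 1 / p.conjExponent / (1 / q) = q / p.conjExponent := by field_simp
  rw [cubeAvg_congr (hW.ae_rpow_eq q), cubeAvg_congr (hW.ae_rpow_eq _), cubeAvg, cubeAvg,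
    mul_rpow_div_le_iff (volume_cube_ne_zero a hl) (volume_cube_ne_top a l) (by positivity),
    one_sub_one_div_eq hp, one_div_one_div, one_div_one_div, h]

theorem apConst_le_iff {r : ℝ} (hr : 1 < r) {w : Rn n → ℝ} {W : Rn n → ℝ≥0∞}
    (hW : IsVersion W w) {K : ℝ≥0∞} :
    apConst r (fun x => w x ^ r) ≤ K ↔ CubeMuckenhoupt (1 - 1 / r) (1 / r) W K := by
  have hr0 : 0 < r := by linarith
  rw [← apqConst_le_iff hr hr0 hW]
  unfold apConst apqConst
  simp only [iSup_le_iff]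
  refine forall_congr' fun a => forall_congr' fun l => forall_congr' fun hl => ?_
  have h : ∀ᵐ x, ENNReal.ofReal ((w x ^ r) ^ (-(r.conjExponent / r))) =
      ENNReal.ofReal (w x ^ (-r.conjExponent)) := by
    filter_upwards [hW.ae_pos] with x hx
    rw [← Real.rpow_mul hx.le]
    congr 2
    field_simp
  rw [cubeAvg_congr h]

/-- Jensen's inequality for the power `1 / θ`. -/
theorem lintegral_rpow_le_of_le {X : Type*} [MeasurableSpace X] {μ : Measure X} {f : X → ℝ≥0∞}
    (hf : Measurable f) {s t : ℝ} (hs : 0 < s) (hst : s ≤ t) :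
    ∫⁻ x, f x ^ s ∂μ ≤ (∫⁻ x, f x ^ t ∂μ) ^ (s / t) * μ Set.univ ^ (1 - s / t) := by
  have ht : 0 < t := hs.trans_le hst
  rcases hst.eq_or_lt with rfl | hlt
  · simp [hs.ne']
  have h := lintegral_mul_le_rpow (μ := μ) (θ := s / t) (by positivity)
    (by rwa [div_lt_one ht]) (f := fun x => f x ^ s) (g := fun _ => 1)
    (hf.pow_const _).aemeasurable aemeasurable_const
  simp only [mul_one, ENNReal.one_rpow, lintegral_const, one_mul, ← ENNReal.rpow_mul] at h
  rwa [show s * (1 / (s / t)) = t by field_simp] at h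

/-- By Jensen's inequality in the second factor, the condition becomes weaker as `a` increases. -/
theorem CubeMuckenhoupt.mono_left {a a' b : ℝ} (ha : 0 < a) (haa : a ≤ a') (hb : 0 < b)
    {W : Rn n → ℝ≥0∞} (hW : Measurable W) {K : ℝ≥0∞} (h : CubeMuckenhoupt a b W K) :
    CubeMuckenhoupt a' b W K := by
  have ha' : 0 < a' := ha.trans_le haa
  intro x l hl
  set v := volume (cube x l) with hv
  have hv0 : v ≠ 0 := volume_cube_ne_zero x hl
  have hv1 : v ≠ ∞ := volume_cube_ne_top x l
  have h1 := lintegral_rpow_le_of_le (μ := volume.restrict (cube x l)) (f := fun y => (W y)⁻¹)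
    hW.inv (s := 1 / a') (t := 1 / a) (by positivity) (one_div_le_one_div_of_le ha haa)
  simp only [ENNReal.inv_rpow, ← ENNReal.rpow_neg, Measure.restrict_apply_univ] at h1
  rw [show 1 / a' / (1 / a) = a / a' by field_simp, ← hv] at h1
  have h2 : a / a' ≤ 1 := (div_le_one ha').2 haa
  calc _ ≤ (∫⁻ y in cube x l, W y ^ (1 / b)) *
        ((∫⁻ y in cube x l, W y ^ (-(1 / a))) ^ (a / a') * v ^ (1 - a / a')) ^ (a' / b) :=
        mul_le_mul_right (ENNReal.rpow_le_rpow h1 (by positivity)) _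
    _ = (∫⁻ y in cube x l, W y ^ (1 / b)) * (∫⁻ y in cube x l, W y ^ (-(1 / a))) ^ (a / b) *
          v ^ ((a' - a) / b) := by
        rw [ENNReal.mul_rpow_of_nonneg _ _ (by positivity), ← ENNReal.rpow_mul, ← ENNReal.rpow_mul,
          mul_assoc]
        congr 3 <;> field_simp
    _ ≤ K * v ^ (1 + a / b) * v ^ ((a' - a) / b) := mul_le_mul_left (h x l hl) _
    _ = _ := by
        rw [mul_assoc, ← ENNReal.rpow_add _ _ hv0 hv1]
        congr 2
        field_simp
        ring

/-- By Jensen's inequality in the first factor, the condition becomes weaker as `b` increases. -/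
theorem CubeMuckenhoupt.mono_right {a b b' : ℝ} (ha : 0 < a) (hb : 0 < b) (hbb : b ≤ b')
    {W : Rn n → ℝ≥0∞} (hW : Measurable W) {K : ℝ≥0∞} (h : CubeMuckenhoupt a b W K) :
    CubeMuckenhoupt a b' W (K ^ (b / b')) := by
  have hb' : 0 < b' := hb.trans_le hbb
  intro x l hl
  set v := volume (cube x l) with hv
  have hv0 : v ≠ 0 := volume_cube_ne_zero x hl
  have hv1 : v ≠ ∞ := volume_cube_ne_top x l
  have h1 := lintegral_rpow_le_of_le (μ := volume.restrict (cube x l)) (f := W)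
    hW (s := 1 / b') (t := 1 / b) (by positivity) (one_div_le_one_div_of_le hb hbb)
  simp only [Measure.restrict_apply_univ] at h1
  rw [show 1 / b' / (1 / b) = b / b' by field_simp, ← hv] at h1
  have h3 : 0 ≤ b / b' := by positivity
  calc _ ≤ (∫⁻ y in cube x l, W y ^ (1 / b)) ^ (b / b') * v ^ (1 - b / b') *
        (∫⁻ y in cube x l, W y ^ (-(1 / a))) ^ (a / b') := mul_le_mul_left h1 _
    _ = ((∫⁻ y in cube x l, W y ^ (1 / b)) * (∫⁻ y in cube x l, W y ^ (-(1 / a))) ^ (a / b)) ^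
          (b / b') * v ^ (1 - b / b') := by
        rw [ENNReal.mul_rpow_of_nonneg _ _ h3, ← ENNReal.rpow_mul,
          show a / b * (b / b') = a / b' by field_simp]
        ring
    _ ≤ (K * v ^ (1 + a / b)) ^ (b / b') * v ^ (1 - b / b') :=
        mul_le_mul_left (ENNReal.rpow_le_rpow (h x l hl) h3) _
    _ = _ := by
        rw [ENNReal.mul_rpow_of_nonneg _ _ h3, ← ENNReal.rpow_mul, mul_assoc,
          ← ENNReal.rpow_add _ _ hv0 hv1]
        congr 2
        field_simp
        ring

theorem setLIntegral_rpow_ne_zero {W : Rn n → ℝ≥0∞} (hW : Measurable W) (hW0 : ∀ x, W x ≠ 0)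
    (hW1 : ∀ x, W x ≠ ∞) (r : ℝ) (a : Rn n) {l : ℝ} (hl : 0 < l) :
    ∫⁻ x in cube a l, W x ^ r ≠ 0 := by
  rw [← pos_iff_ne_zero, setLIntegral_pos_iff (hW.pow_const _)]
  have : Function.support (fun x => W x ^ r) = Set.univ :=
    Set.eq_univ_of_forall fun x => (ENNReal.rpow_pos (pos_iff_ne_zero.2 (hW0 x)) (hW1 x)).ne'
  rw [this, Set.univ_inter]
  exact pos_iff_ne_zero.2 (volume_cube_ne_zero a hl)

theorem CubeMuckenhoupt.lintegral_ne_top {a b : ℝ} (ha : 0 < a) (hb : 0 < b) {W : Rn n → ℝ≥0∞}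
    (hW : Measurable W) (hW0 : ∀ x, W x ≠ 0) (hW1 : ∀ x, W x ≠ ∞) {K : ℝ≥0∞} (hK : K ≠ ∞)
    (h : CubeMuckenhoupt a b W K) (x : Rn n) {l : ℝ} (hl : 0 < l) :
    ∫⁻ y in cube x l, W y ^ (1 / b) ≠ ∞ ∧ ∫⁻ y in cube x l, W y ^ (-(1 / a)) ≠ ∞ := by
  have h1 : K * volume (cube x l) ^ (1 + a / b) ≠ ∞ := ENNReal.mul_ne_top hK
    (ENNReal.rpow_ne_top_of_nonneg (by positivity) (volume_cube_ne_top x l))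
  have h2 := ne_top_of_le_ne_top h1 (h x l hl)
  have h3 := setLIntegral_rpow_ne_zero hW hW0 hW1 (1 / b) x hl
  have h4 := setLIntegral_rpow_ne_zero hW hW0 hW1 (-(1 / a)) x hl
  have hr : 0 < a / b := by positivity
  constructor
  · intro h5
    rw [h5, ENNReal.top_mul] at h2
    · exact h2 rfl
    · intro h6
      exact h4 ((ENNReal.rpow_eq_zero_iff_of_pos hr).1 h6)
  · intro h5
    rw [h5, ENNReal.top_rpow_of_pos hr, ENNReal.mul_top h3] at h2
    exact h2 rfl

/-! ### The weights between `λ` and `μ` -/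

/-- The `m`-th root of the quotient of two weights. -/
noncomputable def rootRatio (m : ℕ) (U V : Rn n → ℝ≥0∞) (x : Rn n) : ℝ≥0∞ :=
  U x ^ (-(1 / (m : ℝ))) * V x ^ (1 / (m : ℝ))

/-- The `j`-th weight between `U` and `V`. -/
noncomputable def interpWeight (m : ℕ) (U V : Rn n → ℝ≥0∞) (j : ℕ) (x : Rn n) : ℝ≥0∞ :=
  U x ^ (((m : ℝ) - j) / m) * V x ^ ((j : ℝ) / m)

theorem isGeometric_interpWeight {m : ℕ} (hm : 1 ≤ m) {U V : Rn n → ℝ≥0∞} {u v : Rn n → ℝ}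
    (hU : IsVersion U u) (hV : IsVersion V v) :
    NestedFamily.IsGeometric (interpWeight m U V) (rootRatio m U V) where
  measurable j := (hU.measurable.pow_const _).mul (hV.measurable.pow_const _)
  measurable_ratio := (hU.measurable.pow_const _).mul (hV.measurable.pow_const _)
  ne_zero j x := mul_ne_zero
    (ENNReal.rpow_pos (pos_iff_ne_zero.2 (hU.ne_zero x)) (hU.ne_top x)).ne'
    (ENNReal.rpow_pos (pos_iff_ne_zero.2 (hV.ne_zero x)) (hV.ne_top x)).ne'
  ne_top j x := ENNReal.mul_ne_top (ENNReal.rpow_ne_top_of_ne_zero (hU.ne_zero x) (hU.ne_top x))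
    (ENNReal.rpow_ne_top_of_ne_zero (hV.ne_zero x) (hV.ne_top x))
  succ j x := by
    have hm0 : (m : ℝ) ≠ 0 := by positivity
    unfold interpWeight rootRatio
    rw [show ((m : ℝ) - (j + 1 : ℕ)) / m = -(1 / m) + (m - j) / m by push_cast; field_simp; ring,
      show ((j + 1 : ℕ) : ℝ) / m = 1 / m + j / m by push_cast; field_simp; ring,
      ENNReal.rpow_add _ _ (hU.ne_zero x) (hU.ne_top x),
      ENNReal.rpow_add _ _ (hV.ne_zero x) (hV.ne_top x)]
    ring

theorem interpWeight_zero {m : ℕ} (hm : 1 ≤ m) (U V : Rn n → ℝ≥0∞) : interpWeight m U V 0 = U := by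
  have hm0 : (m : ℝ) ≠ 0 := by positivity
  ext x
  simp [interpWeight, hm0]

theorem interpWeight_self {m : ℕ} (hm : 1 ≤ m) (U V : Rn n → ℝ≥0∞) : interpWeight m U V m = V := by
  have hm0 : (m : ℝ) ≠ 0 := by positivity
  ext x
  simp [interpWeight, hm0]

theorem CubeMuckenhoupt.interpWeight {a b : ℝ} (ha : 0 < a) (hb : 0 < b) {m : ℕ} (hm : 1 ≤ m)
    {U V : Rn n → ℝ≥0∞} {u v : Rn n → ℝ} (hU : IsVersion U u) (hV : IsVersion V v) {L M : ℝ≥0∞}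
    (hL : CubeMuckenhoupt a b U L) (hM : CubeMuckenhoupt a b V M) {j : ℕ} (hj : j ≤ m) :
    CubeMuckenhoupt a b (interpWeight m U V j) (interpConst m L M j) := by
  have hm0 : (0 : ℝ) < m := by exact_mod_cast hm
  have hj' : (j : ℝ) ≤ m := by exact_mod_cast hj
  intro x l hl
  exact NestedFamily.muckenhoupt_interpolate_le ha hb (hL x l hl) (hM x l hl) hU.measurable
    hV.measurable hU.ne_top hV.ne_top (div_nonneg (sub_nonneg.2 hj') hm0.le) (by positivity)
    (by field_simp; ring)

theorem interpConst_ne_top {m : ℕ} {L M : ℝ≥0∞} (hL : L ≠ ∞) (hM : M ≠ ∞) {j : ℕ} (hj : j ≤ m) :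
    interpConst m L M j ≠ ∞ := by
  have hj' : (j : ℝ) ≤ m := by exact_mod_cast hj
  exact ENNReal.mul_ne_top (ENNReal.rpow_ne_top_of_nonneg
    (div_nonneg (sub_nonneg.2 hj') (Nat.cast_nonneg m)) hL)
    (ENNReal.rpow_ne_top_of_nonneg (by positivity) hM)

theorem IsVersion.rootRatio_ae_eq {m : ℕ} {U V : Rn n → ℝ≥0∞} {lam μ : Rn n → ℝ}
    (hU : IsVersion U lam) (hV : IsVersion V μ) :
    ∀ᵐ x, ENNReal.ofReal (bloomWeight m μ lam x) = rootRatio m U V x := by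
  filter_upwards [hU.ae_pos, hU.ae_eq, hV.ae_pos, hV.ae_eq] with x h1 h2 h3 h4
  rw [rootRatio, h2, h4, bloomWeight, Real.div_rpow h3.le h1.le, ENNReal.ofReal_rpow_of_pos h1,
    ENNReal.ofReal_rpow_of_pos h3, ← ENNReal.ofReal_mul (by positivity), Real.rpow_neg h1.le,
    div_eq_inv_mul]

/-- The weight `ν^{1/m}` is locally integrable. -/
theorem lintegral_rootRatio_ne_top {m : ℕ} (hm : 1 ≤ m) {γ : ℝ} (hγ : 0 < γ) (hγ1 : γ < 1)
    {U V : Rn n → ℝ≥0∞} {u v : Rn n → ℝ} (hU : IsVersion U u) (hV : IsVersion V v) {L M : ℝ≥0∞}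
    (hL1 : L ≠ ∞) (hM1 : M ≠ ∞) (hL : CubeMuckenhoupt (1 - γ) γ U L)
    (hM : CubeMuckenhoupt (1 - γ) γ V M) (a : Rn n) {l : ℝ} (hl : 0 < l) :
    ∫⁻ x in cube a l, rootRatio m U V x ≠ ∞ := by
  have hm0 : (0 : ℝ) < m := by exact_mod_cast hm
  have hpt (x : Rn n) : rootRatio m U V x ≤ 1 + V x * (U x)⁻¹ := by
    have h1 : rootRatio m U V x = (V x * (U x)⁻¹) ^ (1 / (m : ℝ)) := by
      rw [rootRatio, ENNReal.mul_rpow_of_nonneg _ _ (by positivity), ENNReal.inv_rpow,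
        ENNReal.rpow_neg, mul_comm]
    rw [h1]
    set t := V x * (U x)⁻¹
    rcases le_total t 1 with h | h
    · exact (ENNReal.rpow_le_one h (by positivity)).trans le_self_add
    · calc t ^ (1 / (m : ℝ)) ≤ t ^ (1 : ℝ) := ENNReal.rpow_le_rpow_of_exponent_le h
            ((div_le_one hm0).2 (by exact_mod_cast hm))
        _ ≤ _ := by rw [ENNReal.rpow_one]; exact le_add_self
  have hU2 := (hL.lintegral_ne_top (by linarith) hγ hU.measurable hU.ne_zero hU.ne_top hL1 a hl).2
  have hV1 := (hM.lintegral_ne_top (by linarith) hγ hV.measurable hV.ne_zero hV.ne_top hM1 a hl).1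
  have h2 : ∫⁻ x in cube a l, V x * (U x)⁻¹ ≠ ∞ := by
    refine ne_top_of_le_ne_top ?_ (lintegral_mul_le_rpow hγ hγ1 hV.measurable.aemeasurable
      hU.measurable.inv.aemeasurable)
    simp only [ENNReal.inv_rpow, ← ENNReal.rpow_neg]
    exact ENNReal.mul_ne_top (ENNReal.rpow_ne_top_of_nonneg hγ.le hV1)
      (ENNReal.rpow_ne_top_of_nonneg (by linarith) hU2)
  refine ne_top_of_le_ne_top ?_ (lintegral_mono hpt)
  rw [lintegral_add_left measurable_const]
  simp only [lintegral_const, one_mul, Measure.restrict_apply_univ]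
  exact ENNReal.add_ne_top.2 ⟨volume_cube_ne_top a l, h2⟩

theorem lintegral_rootRatio_ne_zero {m : ℕ} {U V : Rn n → ℝ≥0∞} {u v : Rn n → ℝ}
    (hU : IsVersion U u) (hV : IsVersion V v) (a : Rn n) {l : ℝ} (hl : 0 < l) :
    ∫⁻ x in cube a l, rootRatio m U V x ≠ 0 := by
  have := setLIntegral_rpow_ne_zero (W := rootRatio m U V)
    ((hU.measurable.pow_const _).mul (hV.measurable.pow_const _)) (fun x => mul_ne_zero
      (ENNReal.rpow_pos (pos_iff_ne_zero.2 (hU.ne_zero x)) (hU.ne_top x)).ne'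
      (ENNReal.rpow_pos (pos_iff_ne_zero.2 (hV.ne_zero x)) (hV.ne_top x)).ne')
    (fun x => ENNReal.mul_ne_top (ENNReal.rpow_ne_top_of_ne_zero (hU.ne_zero x) (hU.ne_top x))
      (ENNReal.rpow_ne_top_of_ne_zero (hV.ne_zero x) (hV.ne_top x))) 1 a hl
  simpa using this

theorem IsVersion.cubeMuckenhoupt {p q : ℝ} (hp : 1 < p) (hq : 0 < q) {w : Rn n → ℝ}
    {W : Rn n → ℝ≥0∞} (hW : IsVersion W w) :
    CubeMuckenhoupt (1 - 1 / p) (1 / q) W (apqConst p q w) :=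
  (apqConst_le_iff hp hq hW).1 le_rfl

/-- The inclusions `A_{p,q} ⊆ A_q` and `A_{p,q} ⊆ A_p` for the powers of a weight. -/
theorem MemApq.apConst_lt_top {p q : ℝ} (hp : 1 < p) (hpq : p ≤ q) {w : Rn n → ℝ}
    (hw : MemApq p q w) : apConst q (fun x => w x ^ q) < ∞ ∧ apConst p (fun x => w x ^ p) < ∞ := by
  obtain ⟨W, hW⟩ := hw.isWeight.exists_isVersion
  have hp0 : 0 < p := by linarith
  have hq0 : 0 < q := by linarith
  have h := hW.cubeMuckenhoupt hp hq0
  have hinv : 1 / q ≤ 1 / p := one_div_le_one_div_of_le hp0 hpq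
  have hp1 : 0 < 1 - 1 / p := by rw [one_sub_one_div_eq hp]; exact one_div_pos.2 (conjExponent_pos hp)
  have hq1 : 0 < 1 / q := by positivity
  constructor
  · exact ((apConst_le_iff (hp.trans_le hpq) hW).2
      (h.mono_left hp1 (by linarith) hq1 hW.measurable)).trans_lt hw.const_lt_top
  · exact ((apConst_le_iff hp hW).2 (h.mono_right hp1 hq1 hinv hW.measurable)).trans_lt
      (ENNReal.rpow_lt_top_of_nonneg (by positivity) hw.const_lt_top.ne)

theorem lintegral_osc_le_bmoNorm_mul {m : ℕ} {U V : Rn n → ℝ≥0∞} {lam μ b : Rn n → ℝ}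
    (hU : IsVersion U lam) (hV : IsVersion V μ) (a : Rn n) {l : ℝ} (hl : 0 < l) (htop : ∫⁻ x in cube a l, rootRatio m U V x ≠ ∞) :
    ∫⁻ x in cube a l, ENNReal.ofReal |b x - ⨍ y in cube a l, b y| ≤
      bmoNorm (bloomWeight m μ lam) b * ∫⁻ x in cube a l, rootRatio m U V x := by
  have h0 := lintegral_rootRatio_ne_zero (m := m) hU hV a hl
  rw [← ENNReal.div_le_iff_le_mul (Or.inl h0) (Or.inl htop),
    ← lintegral_congr_ae (ae_restrict_of_ae (hU.rootRatio_ae_eq (m := m) hV))]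
  exact le_iSup₂_of_le a l (le_iSup_of_le hl le_rfl)

/-- The two-weight bound for the positive operator that dominates the commutator. -/
theorem weightedNorm_positive_commutator_le {m : ℕ} (hm : 1 ≤ m) {α p q : ℝ} (hα : 0 < α)
    (hαn : α < n) (hp : 1 < p) (hq : 0 < q) (hpq : 1 / q + α / n = 1 / p) :
    ∃ C : ℝ≥0∞, C ≠ ∞ ∧ ∀ {μ lam b : Rn n → ℝ}, MemApq p q μ → MemApq p q lam →
      Measurable b → MemBMO (bloomWeight m μ lam) b → ∀ {U V : Rn n → ℝ≥0∞}, IsVersion U lam →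
      IsVersion V μ → ∀ {f : Rn n → ℝ≥0∞}, Measurable f →
      weightedNorm volume (1 / q) U (fun x => ∫⁻ y, rieszKernel α x y *
        (ENNReal.ofReal |b x - b y| ^ m * f y)) ≤
      C * bmoNorm (bloomWeight m μ lam) b ^ m * kappa α p q m μ lam *
        weightedNorm volume (1 / p) V f := by
  have hn : (0 : ℝ) < n := hα.trans hαn
  have hp0 : 0 < p := by linarith
  have hγ : 0 < 1 / q := one_div_pos.2 hq
  have hβ : 1 / p < 1 := (div_lt_one hp0).2 hp
  have hlt : 1 / q < 1 / p := by rw [← hpq]; linarith [div_pos hα hn]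
  have hpq' : p ≤ q := le_of_not_gt fun h => absurd (one_div_lt_one_div_of_lt hq h) (by linarith)
  have hq1 : 1 < q := hp.trans_le hpq'
  obtain ⟨C, hC, H⟩ := weightedNorm_lintegral_rieszKernel_le hα hαn hγ hpq hβ m
  refine ⟨C, hC, fun {μ lam b} hμ hlam hbm hb {U V} hU hV {f} hf => ?_⟩
  have hμq := hμ.apConst_lt_top hp hpq'
  have hlq := hlam.apConst_lt_top hp hpq'
  have hLq := (apConst_le_iff hq1 hU).1 (le_refl (apConst q fun x => lam x ^ q))
  have hMq := (apConst_le_iff hq1 hV).1 (le_refl (apConst q fun x => μ x ^ q))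
  have hLp := (apConst_le_iff hp hU).1 (le_refl (apConst p fun x => lam x ^ p))
  have hMp := (apConst_le_iff hp hV).1 (le_refl (apConst p fun x => μ x ^ p))
  have hLs := hU.cubeMuckenhoupt hp hq
  have hMs := hV.cubeMuckenhoupt hp hq
  have hγ1 : 0 < 1 - 1 / q := by linarith
  have hβ1 : 0 < 1 - 1 / p := by linarith
  have main := H hbm hb.locallyIntegrable (isGeometric_interpWeight hm hU hV)
    (fun a l hl => lintegral_osc_le_bmoNorm_mul hU hV a hl
      (lintegral_rootRatio_ne_top hm hγ (by linarith) hU hV hlq.1.ne hμq.1.ne hLq hMq a hl))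
    (fun j hj => interpConst_ne_top hlq.1.ne hμq.1.ne hj)
    (fun j hj => interpConst_ne_top hlam.const_lt_top.ne hμ.const_lt_top.ne hj)
    (fun j hj => interpConst_ne_top hlq.2.ne hμq.2.ne hj)
    (fun j hj => hLq.interpWeight hγ1 hγ hm hU hV hMq hj)
    (fun j hj => hLs.interpWeight hβ1 hγ hm hU hV hMs hj)
    (fun j hj => hLp.interpWeight hβ1 (by linarith) hm hU hV hMp hj) hf
  rw [interpWeight_zero hm, interpWeight_self hm] at main
  refine main.trans (le_of_eq ?_)
  congr 2
  unfold kappa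
  refine Finset.sum_congr rfl fun h hh => ?_
  have hhm : h ≤ m := Nat.lt_succ_iff.1 (Finset.mem_range.1 hh)
  have e1 : 1 / q / (1 - 1 / q) = 1 / (q - 1) := by
    have : q - 1 ≠ 0 := by linarith
    field_simp
  have e2 : 1 / p / (1 - 1 / p) = 1 / (p - 1) := by
    have : p - 1 ≠ 0 := by linarith
    field_simp
  have e3 : 1 / q / (1 - 1 / p) = p.conjExponent / q := by
    rw [one_sub_one_div_eq hp]
    field_simp
  have e4 : 1 - 1 / p + 1 / q = 1 - α / n := by linarith
  rw [e1, e2, e3, e4, prod_interpConst_rpow_eq_factorP hm hhm,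
    prod_interpConst_rpow_eq_factorQ hm hhm, interpConst, Nat.cast_sub hhm, sub_sub_cancel]
  ring

/-- The one-weight bound for the fractional integral, with a constant that depends on the
weight. -/
theorem weightedNorm_rieszKernel_ne_top {α p q : ℝ} (hα : 0 < α) (hαn : α < n) (hp : 1 < p)
    (hq : 0 < q) (hpq : 1 / q + α / n = 1 / p) {μ : Rn n → ℝ} (hμ : MemApq p q μ)
    {V : Rn n → ℝ≥0∞} (hV : IsVersion V μ) {f : Rn n → ℝ≥0∞} (hf : Measurable f)
    (hfin : weightedNorm volume (1 / p) V f ≠ ∞) :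
    weightedNorm volume (1 / q) V (fun x => ∫⁻ y, rieszKernel α x y * f y) ≠ ∞ := by
  have hn : (0 : ℝ) < n := hα.trans hαn
  have hp0 : 0 < p := by linarith
  have hγ : 0 < 1 / q := one_div_pos.2 hq
  have hβ : 1 / p < 1 := (div_lt_one hp0).2 hp
  have hlt : 1 / q < 1 / p := by rw [← hpq]; linarith [div_pos hα hn]
  have hpq' : p ≤ q := le_of_not_gt fun h => absurd (one_div_lt_one_div_of_lt hq h) (by linarith)
  obtain ⟨C, hC, H⟩ := weightedNorm_lintegral_rieszKernel_le hα hαn hγ hpq hβ 0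
  have hμq := hμ.apConst_lt_top hp hpq'
  have hW : NestedFamily.IsGeometric (fun _ => V) (fun _ : Rn n => 1) :=
    ⟨fun _ => hV.measurable, measurable_const, fun _ => hV.ne_zero, fun _ => hV.ne_top,
      fun _ _ => (one_mul _).symm⟩
  have main := H (b := fun _ => 0) measurable_const (by
      exact locallyIntegrable_zero) hW (B := 0) (fun a l hl => by simp)
    (fun j _ => hμq.1.ne) (fun j _ => hμ.const_lt_top.ne) (fun j _ => hμq.2.ne)
    (fun j _ => (apConst_le_iff (hp.trans_le hpq') hV).1 le_rfl)
    (fun j _ => hV.cubeMuckenhoupt hp hq) (fun j _ => (apConst_le_iff hp hV).1 le_rfl) hf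
  simp only [pow_zero, one_mul] at main
  refine ne_top_of_le_ne_top ?_ main
  have h3 : 0 ≤ (1 - 1 / p + 1 / q) * max 1 (1 / q / (1 - 1 / p)) :=
    mul_nonneg (by linarith) (le_max_of_le_left zero_le_one)
  have h4 := ENNReal.rpow_ne_top_of_nonneg h3 hμ.const_lt_top.ne
  simp only [zero_add, Finset.range_one, Finset.sum_singleton, Nat.choose_self, Nat.sub_zero,
    Finset.range_zero, Finset.prod_empty, ENNReal.one_rpow, Nat.cast_one, one_mul, mul_one]
  finiteness

/-! ### The iterated commutator -/

theorem eLpNorm_powMeasure_eq {F : Type*} [NormedAddCommGroup F] {r : ℝ} (hr : 0 < r)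
    {w : Rn n → ℝ} {W : Rn n → ℝ≥0∞} (hW : IsVersion W w) (hw : IsWeight w) (g : Rn n → F) :
    eLpNorm g (ENNReal.ofReal r) (powMeasure w r) =
      weightedNorm volume (1 / r) W fun x => ‖g x‖ₑ := by
  rw [eLpNorm_eq_lintegral_rpow_enorm_toReal (by simpa using hr) ENNReal.ofReal_ne_top,
    ENNReal.toReal_ofReal hr.le, powMeasure, weightedNorm, one_div_one_div,
    lintegral_withDensity_eq_lintegral_mul_non_measurable₀ _
      (hw.aemeasurable.pow_const _).ennreal_ofReal (ae_of_all _ fun _ => ENNReal.ofReal_lt_top)]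
  congr 1
  refine lintegral_congr_ae ?_
  filter_upwards [hW.ae_rpow_eq r] with x hx
  rw [Pi.mul_apply, hx, mul_comm, ENNReal.mul_rpow_of_nonneg _ _ hr.le]

theorem powMeasure_absolutelyContinuous (w : Rn n → ℝ) (r : ℝ) : powMeasure w r ≪ volume :=
  withDensity_absolutelyContinuous _ _

theorem IsWeight.absolutelyContinuous_powMeasure {w : Rn n → ℝ} (hw : IsWeight w) (r : ℝ) :
    volume ≪ powMeasure w r := by
  refine withDensity_absolutelyContinuous' (hw.aemeasurable.pow_const _).ennreal_ofReal ?_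
  filter_upwards [hw.pos] with x hx
  simpa using Real.rpow_pos_of_pos hx r

theorem bmoNorm_congr {η b b' : Rn n → ℝ} (h : b =ᵐ[volume] b') : bmoNorm η b = bmoNorm η b' := by
  unfold bmoNorm
  refine iSup_congr fun a => iSup_congr fun l => iSup_congr fun hl => ?_
  have h1 : ⨍ y in cube a l, b y = ⨍ y in cube a l, b' y := by
    rw [setAverage_eq, setAverage_eq, integral_congr_ae (ae_restrict_of_ae h)]
  rw [h1]
  congr 1
  refine lintegral_congr_ae (ae_restrict_of_ae ?_)
  filter_upwards [h] with x hx
  rw [hx]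

theorem ae_lt_top_of_weightedNorm_ne_top {r : ℝ} (hr : 0 < r) {W g : Rn n → ℝ≥0∞}
    (hW : Measurable W) (hW0 : ∀ x, W x ≠ 0) (hg : AEMeasurable g)
    (h : weightedNorm volume r W g ≠ ∞) : ∀ᵐ x, g x ≠ ∞ := by
  have h1 : ∫⁻ x, (g x * W x) ^ (1 / r) ≠ ∞ := fun h2 => h (by
    rw [weightedNorm, h2, ENNReal.top_rpow_of_pos hr])
  filter_upwards [ae_lt_top' ((hg.mul hW.aemeasurable).pow_const _) h1] with x hx hx'
  rw [Pi.mul_apply, hx', ENNReal.top_mul (hW0 x), ENNReal.top_rpow_of_pos (one_div_pos.2 hr)] at hx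
  exact lt_irrefl _ hx

section Formula

variable {F : Type*} [NormedAddCommGroup F] [NormedSpace ℝ F]

theorem integrable_sub_pow_mul_smul {X : Type*} [MeasurableSpace X] {μ : Measure X} {b : X → ℝ}
    (c : ℝ) {g : X → F} (m : ℕ) (h : ∀ k ≤ m, Integrable (fun y => b y ^ k • g y) μ) :
    Integrable (fun y => (c - b y) ^ m • g y) μ := by
  induction m generalizing g with
  | zero => simpa using h 0 le_rfl
  | succ m ih =>
    have h1 := (ih fun k hk => h k (by omega)).smul c
    have h2 : Integrable (fun y => (c - b y) ^ m • (b y • g y)) μ := ih fun k hk => by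
      simpa only [smul_smul, pow_succ] using h (k + 1) (by omega)
    refine (h1.sub h2).congr (ae_of_all _ fun y => ?_)
    simp only [Pi.sub_apply, Pi.smul_apply, smul_smul, ← sub_smul]
    congr 1
    ring

theorem rieszIntegrand_smul (α : ℝ) (b : Rn n → ℝ) (f : Rn n → F) (x y : Rn n) :
    rieszIntegrand α (fun y => b y • f y) x y = b y • rieszIntegrand α f x y :=
  smul_comm _ _ _

/-- The iterated commutator as an integral operator. -/
theorem iterCommutator_eq_integral {α : ℝ} {b : Rn n → ℝ} {x : Rn n} (m : ℕ) {f : Rn n → F}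
    (h : ∀ k ≤ m, Integrable (rieszIntegrand α (fun y => b y ^ k • f y) x) volume) :
    iterCommutator b (rieszPotential α) m f x =
      ∫ y, (b x - b y) ^ m • rieszIntegrand α f x y := by
  induction m generalizing f with
  | zero => simp [iterCommutator, rieszPotential]
  | succ m ih =>
    have hb : ∀ k ≤ m, Integrable (rieszIntegrand α (fun y => b y ^ k • (b y • f y)) x) volume := by
      intro k hk
      simpa only [smul_smul, pow_succ] using h (k + 1) (by omega)
    have h' : ∀ k ≤ m + 1, Integrable (fun y => b y ^ k • rieszIntegrand α f x y) volume := by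
      intro k hk
      simpa only [← rieszIntegrand_smul α (fun y => b y ^ k)] using h k hk
    rw [iterCommutator, bCommutator, ih fun k hk => h k (by omega), ih hb, ← integral_smul,
      ← integral_sub]
    · refine integral_congr_ae (ae_of_all _ fun y => ?_)
      simp only [rieszIntegrand_smul, smul_smul, ← sub_smul]
      congr 1
      ring
    · exact (integrable_sub_pow_mul_smul _ m fun k hk => h' k (by omega)).smul _
    · refine integrable_sub_pow_mul_smul _ m fun k hk => ?_
      simpa only [rieszIntegrand_smul, smul_smul, pow_succ] using h' (k + 1) (by omega)

theorem enorm_rieszIntegrand (α : ℝ) (f : Rn n → F) (x y : Rn n) :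
    ‖rieszIntegrand α f x y‖ₑ = rieszKernel α x y * ‖f y‖ₑ := by
  rw [rieszIntegrand, enorm_smul, rieszKernel, Real.enorm_of_nonneg (by positivity)]

theorem aestronglyMeasurable_rieszIntegrand {α : ℝ} {f : Rn n → F}
    (hf : AEStronglyMeasurable f volume) (x : Rn n) :
    AEStronglyMeasurable (rieszIntegrand α f x) volume := by
  refine AEStronglyMeasurable.smul ?_ hf
  exact Measurable.aestronglyMeasurable (by fun_prop)

end Formula

theorem locallyIntegrable_of_integrableOn_cube {f : Rn n → ℝ}
    (h : ∀ (a : Rn n) (l : ℝ), 0 < l → IntegrableOn f (cube a l)) :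
    LocallyIntegrable f volume := by
  intro x
  refine ⟨cube (WithLp.toLp 2 fun i => x i - 1) 2, ?_, h _ _ two_pos⟩
  refine Filter.mem_of_superset (Metric.ball_mem_nhds x one_pos) fun y hy i => ?_
  have h1 := PiLp.norm_apply_le (y - x) i
  rw [Metric.mem_ball, dist_eq_norm] at hy
  rw [Real.norm_eq_abs, PiLp.sub_apply] at h1
  have h2 := abs_lt.1 (h1.trans_lt hy)
  simp only
  constructor <;> linarith

theorem MemBMO.congr {η b b' : Rn n → ℝ} (h : b =ᵐ[volume] b') (hb : MemBMO η b) : MemBMO η b' where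
  locallyIntegrable := hb.locallyIntegrable.congr h
  norm_lt_top := (bmoNorm_congr h) ▸ hb.norm_lt_top

theorem ofReal_abs_pow_le (m : ℕ) (s t : ℝ) :
    ENNReal.ofReal |t| ^ m ≤ 2 ^ m * (ENNReal.ofReal |s| ^ m + ENNReal.ofReal |s - t| ^ m) := by
  have h1 : ENNReal.ofReal |t| ≤ ENNReal.ofReal |s| + ENNReal.ofReal |s - t| := by
    rw [← ENNReal.ofReal_add (abs_nonneg _) (abs_nonneg _)]
    refine ENNReal.ofReal_le_ofReal ?_
    have := abs_sub_abs_le_abs_sub t s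
    rw [abs_sub_comm] at this
    linarith
  set A := ENNReal.ofReal |s|
  set B := ENNReal.ofReal |s - t|
  have h2 : A + B ≤ 2 * max A B := by
    rw [two_mul]; exact add_le_add (le_max_left _ _) (le_max_right _ _)
  calc _ ≤ (2 * max A B) ^ m := pow_le_pow_left' (h1.trans h2) m
    _ = 2 ^ m * max A B ^ m := mul_pow _ _ _
    _ ≤ _ := by
        refine mul_le_mul_right ?_ _
        rcases max_choice A B with h | h <;> rw [h]
        · exact le_self_add
        · exact le_add_self

theorem kappa_ne_top {m : ℕ} (hm : 1 ≤ m) {α p q : ℝ} (hαn : α ≤ n) {μ lam : Rn n → ℝ}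
    (hμ : MemApq p q μ) (hlam : MemApq p q lam) (hp : 1 < p) (hpq : p ≤ q) :
    kappa α p q m μ lam ≠ ∞ := by
  have hμq := hμ.apConst_lt_top hp hpq
  have hlq := hlam.apConst_lt_top hp hpq
  unfold kappa
  refine ENNReal.sum_ne_top.2 fun h hh => ?_
  have hhm : h ≤ m := Nat.lt_succ_iff.1 (Finset.mem_range.1 hh)
  have h1 : ((apqConst p q lam ^ ((h : ℝ) / m) * apqConst p q μ ^ (((m : ℝ) - h) / m)) ^
      ((1 - α / n) * max 1 (p.conjExponent / q))) ≠ ∞ := by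
    refine ENNReal.rpow_ne_top_of_nonneg (mul_nonneg ?_ (le_max_of_le_left zero_le_one)) ?_
    · exact sub_nonneg.2 (div_le_one_of_le₀ hαn (Nat.cast_nonneg n))
    · have := interpConst_ne_top (m := m) hlam.const_lt_top.ne hμ.const_lt_top.ne (Nat.sub_le m h)
      rwa [interpConst, Nat.cast_sub hhm, sub_sub_cancel] at this
  rw [← prod_interpConst_rpow_eq_factorP hm hhm, ← prod_interpConst_rpow_eq_factorQ hm hhm]
  refine ENNReal.mul_ne_top (ENNReal.mul_ne_top (ENNReal.mul_ne_top (by finiteness) h1) ?_) ?_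
  · refine ENNReal.rpow_ne_top_of_nonneg (le_max_of_le_left zero_le_one)
      (ENNReal.prod_ne_top fun j hj => interpConst_ne_top hlq.1.ne hμq.1.ne ?_)
    have := Finset.mem_range.1 hj
    omega
  · exact ENNReal.rpow_ne_top_of_nonneg (le_max_of_le_left zero_le_one)
      (ENNReal.prod_ne_top fun j hj => interpConst_ne_top hlq.2.ne hμq.2.ne (Nat.sub_le _ _))

/-! ### Sufficiency -/

theorem measurable_lintegral_rieszKernel {α : ℝ} {b : Rn n → ℝ} (hb : Measurable b) (m : ℕ)
    {f : Rn n → ℝ≥0∞} (hf : Measurable f) : Measurable fun x =>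
      ∫⁻ y, rieszKernel α x y * (ENNReal.ofReal |b x - b y| ^ m * f y) := by
  refine Measurable.lintegral_prod_right' (f := fun p : Rn n × Rn n =>
    rieszKernel α p.1 p.2 * (ENNReal.ofReal |b p.1 - b p.2| ^ m * f p.2)) ?_
  exact (measurable_rieszKernel α).mul (by fun_prop)

theorem one_le_rieszKernel_mul {α : ℝ} (hαn : α < n) {x y : Rn n} (hxy : x ≠ y) {d : ℝ}
    (hd : ‖x - y‖ ≤ d) : 1 ≤ ENNReal.ofReal (d ^ (n - α)) * rieszKernel α x y := by
  have h0 : 0 < ‖x - y‖ := norm_pos_iff.2 (sub_ne_zero.2 hxy)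
  have h1 : 0 < ‖x - y‖ ^ (n - α) := Real.rpow_pos_of_pos h0 _
  rw [rieszKernel, ← ENNReal.ofReal_mul (Real.rpow_nonneg (h0.le.trans hd) _),
    ENNReal.one_le_ofReal, ← div_eq_mul_inv, one_le_div h1]
  exact Real.rpow_le_rpow h0.le hd (sub_pos.2 hαn).le

theorem ofReal_abs_pow_eq_enorm (t : ℝ) (m : ℕ) : ENNReal.ofReal |t| ^ m = ‖t ^ m‖ₑ := by
  rw [enorm_pow, ← Real.norm_eq_abs, ofReal_norm]

section Sufficiency

variable {m : ℕ} {α p q : ℝ} {μ lam b : Rn n → ℝ} {U V : Rn n → ℝ≥0∞}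

/-- The commutator integrals converge absolutely almost everywhere on `L^p(μ^p)`. -/
theorem ae_lintegral_commutator_ne_top (hm : 1 ≤ m) (hα : 0 < α)
    (hαn : α < n) (hp : 1 < p) (hq : 0 < q) (hpq : 1 / q + α / n = 1 / p) (hμ : MemApq p q μ)
    (hlam : MemApq p q lam) (hbm : Measurable b) (hb : MemBMO (bloomWeight m μ lam) b)
    (hU : IsVersion U lam) (hV : IsVersion V μ) {f : Rn n → ℝ≥0∞} (hf : Measurable f)
    (hfin : weightedNorm volume (1 / p) V f ≠ ∞) :
    ∀ᵐ x, ∫⁻ y, rieszKernel α x y * (ENNReal.ofReal |b x - b y| ^ m * f y) ≠ ∞ := by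
  obtain ⟨C, hC, H⟩ := weightedNorm_positive_commutator_le hm hα hαn hp hq hpq
  have hn : (0 : ℝ) < n := hα.trans hαn
  have hlt : 1 / q < 1 / p := by rw [← hpq]; linarith [div_pos hα hn]
  have hpq' : p ≤ q := le_of_not_gt fun h => absurd (one_div_lt_one_div_of_lt hq h) (by linarith)
  refine ae_lt_top_of_weightedNorm_ne_top (one_div_pos.2 hq) hU.measurable hU.ne_zero
    (measurable_lintegral_rieszKernel hbm m hf).aemeasurable
    (ne_top_of_le_ne_top ?_ (H hμ hlam hbm hb hU hV hf))
  have h1 := kappa_ne_top hm hαn.le hμ hlam hp hpq'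
  have h2 := hb.norm_lt_top.ne
  finiteness

theorem weightedNorm_indicator_cube_ne_top (hp : 1 < p) (hV : IsVersion V μ)
    (hfin : apConst p (fun x => μ x ^ p) ≠ ∞) (a : Rn n) {l : ℝ} (hl : 0 < l) :
    weightedNorm volume (1 / p) V ((cube a l).indicator fun _ => 1) ≠ ∞ := by
  have hp0 : 0 < p := by linarith
  have h1 := (((apConst_le_iff hp hV).1 le_rfl).lintegral_ne_top
    (by rw [one_sub_one_div_eq hp]; exact one_div_pos.2 (conjExponent_pos hp)) (one_div_pos.2 hp0)
    hV.measurable hV.ne_zero hV.ne_top hfin a hl).1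
  refine ENNReal.rpow_ne_top_of_nonneg (by positivity) ?_
  rw [← lintegral_indicator (measurableSet_cube a l)] at h1
  refine ne_top_of_le_ne_top h1 (lintegral_mono fun x => ?_)
  by_cases hx : x ∈ cube a l
  · simp [hx]
  · simp [hx, hp0]

/-- Functions in `BMO` with respect to `ν^{1/m}` have locally integrable `m`-th powers: the
commutator integral for the characteristic function of a cube is finite at some point of it. -/
theorem MemBMO.memLocPow (hm : 1 ≤ m) (hα : 0 < α)
    (hαn : α < n) (hp : 1 < p) (hq : 0 < q) (hpq : 1 / q + α / n = 1 / p) (hμ : MemApq p q μ)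
    (hlam : MemApq p q lam) (hb : MemBMO (bloomWeight m μ lam) b) : MemLocPow m b := by
  have hmeas : AEStronglyMeasurable b volume := hb.locallyIntegrable.aestronglyMeasurable
  refine ⟨hmeas, locallyIntegrable_of_integrableOn_cube fun a l hl => ?_⟩
  obtain ⟨U, hU⟩ := hlam.isWeight.exists_isVersion
  obtain ⟨V, hV⟩ := hμ.isWeight.exists_isVersion
  have hn : (0 : ℝ) < n := hα.trans hαn
  have hlt : 1 / q < 1 / p := by rw [← hpq]; linarith [div_pos hα hn]
  have hpq' : p ≤ q := le_of_not_gt fun h => absurd (one_div_lt_one_div_of_lt hq h) (by linarith)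
  set b' := hmeas.mk b with hb'
  have hbm : Measurable b' := hmeas.stronglyMeasurable_mk.measurable
  have hae : b =ᵐ[volume] b' := hmeas.ae_eq_mk
  have h1 := ae_lintegral_commutator_ne_top hm hα hαn hp hq hpq hμ hlam hbm (hb.congr hae) hU hV
    (measurable_const.indicator (measurableSet_cube a l))
    (weightedNorm_indicator_cube_ne_top hp hV (hμ.apConst_lt_top hp hpq').2.ne a hl)
  obtain ⟨x, hxQ, hx⟩ : ∃ x ∈ cube a l, ∫⁻ y, rieszKernel α x y *
      (ENNReal.ofReal |b' x - b' y| ^ m * (cube a l).indicator (fun _ => 1) y) ≠ ∞ := by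
    have h2 : ∃ᵐ x, x ∈ cube a l := by
      rw [frequently_ae_mem_iff]
      exact volume_cube_ne_zero a hl
    obtain ⟨x, hx, hx'⟩ := (h2.and_eventually h1).exists
    exact ⟨x, hx, hx'⟩
  refine ⟨((hmeas.norm.pow m).restrict.congr (ae_of_all _ fun y => rfl) :), ?_⟩
  refine lt_of_le_of_lt ?_ (show (2 : ℝ≥0∞) ^ m * (ENNReal.ofReal |b' x| ^ m * volume (cube a l) +
    ENNReal.ofReal ((n * l) ^ (n - α)) * ∫⁻ y, rieszKernel α x y *
      (ENNReal.ofReal |b' x - b' y| ^ m * (cube a l).indicator (fun _ => 1) y)) < ∞ by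
    have := volume_cube_ne_top a l
    exact lt_top_iff_ne_top.2 (by finiteness))
  have hkm : Measurable fun y => rieszKernel α x y *
      (ENNReal.ofReal |b' x - b' y| ^ m * (cube a l).indicator (fun _ => 1) y) :=
    ((measurable_rieszKernel α).of_uncurry_left).mul (Measurable.mul (by fun_prop)
      (measurable_const.indicator (measurableSet_cube a l)))
  calc ∫⁻ y in cube a l, ‖|b y| ^ m‖ₑ
      = ∫⁻ y in cube a l, ENNReal.ofReal |b' y| ^ m := by
        refine lintegral_congr_ae (ae_restrict_of_ae ?_)
        filter_upwards [hae] with y hy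
        rw [hy, ← ofReal_abs_pow_eq_enorm, abs_abs]
    _ ≤ ∫⁻ y in cube a l, 2 ^ m * (ENNReal.ofReal |b' x| ^ m +
          ENNReal.ofReal ((n * l) ^ (n - α)) * (rieszKernel α x y *
      (ENNReal.ofReal |b' x - b' y| ^ m * (cube a l).indicator (fun _ => 1) y))) := by
        refine setLIntegral_mono' (measurableSet_cube a l) fun y hy => ?_
        refine (ofReal_abs_pow_le m (b' x) (b' y)).trans ?_
        refine mul_le_mul_right (add_le_add_right ?_ _) _
        rw [Set.indicator_of_mem hy, mul_one]
        rcases eq_or_ne x y with rfl | hxy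
        · simp [(show m ≠ 0 by omega)]
        · rw [← mul_assoc]
          exact le_mul_of_one_le_left' (one_le_rieszKernel_mul hαn hxy
            (norm_sub_le_of_mem_cube hl.le hxQ hy))
    _ ≤ _ := by
        have hsum : Measurable fun y => ENNReal.ofReal |b' x| ^ m +
            ENNReal.ofReal ((n * l) ^ (n - α)) * (rieszKernel α x y *
              (ENNReal.ofReal |b' x - b' y| ^ m * (cube a l).indicator (fun _ => 1) y)) :=
          measurable_const.add (hkm.const_mul _)
        rw [lintegral_const_mul _ hsum, lintegral_add_left measurable_const, lintegral_const_mul _ hkm]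
        simp only [lintegral_const, Measure.restrict_apply_univ]
        exact mul_le_mul_right (add_le_add_right (mul_le_mul_right
          (setLIntegral_le_lintegral _ _) _) _) _

end Sufficiency

/-- The sufficiency of the condition on `b`, with the quantitative bound. -/
theorem bloom_sufficiency {𝕜 : Type*} [RCLike 𝕜] {m : ℕ} (hm : 1 ≤ m) {α p q : ℝ} (hα : 0 < α)
    (hαn : α < n) (hp : 1 < p) (hq : 0 < q) (hpq : 1 / q + α / n = 1 / p) :
    ∃ c : ℝ≥0, ∀ μ lam b : Rn n → ℝ, MemApq p q μ → MemApq p q lam →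
      MemBMO (bloomWeight m μ lam) b → MemLocPow m b ∧
      ∀ f : Rn n → 𝕜, MemLp f (ENNReal.ofReal p) (powMeasure μ p) →
        (∀ᵐ x ∂(volume : Measure (Rn n)), ∀ k ≤ m,
          Integrable (rieszIntegrand α (fun y => b y ^ k • f y) x) volume) ∧
        MemLp (iterCommutator b (rieszPotential α) m f) (ENNReal.ofReal q) (powMeasure lam q) ∧
        eLpNorm (iterCommutator b (rieszPotential α) m f) (ENNReal.ofReal q) (powMeasure lam q) ≤
          c * bmoNorm (bloomWeight m μ lam) b ^ m * kappa α p q m μ lam *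
            eLpNorm f (ENNReal.ofReal p) (powMeasure μ p) := by
  obtain ⟨C, hC, H⟩ := weightedNorm_positive_commutator_le hm hα hαn hp hq hpq
  refine ⟨C.toNNReal, fun μ lam b hμ hlam hb =>
    ⟨hb.memLocPow hm hα hαn hp hq hpq hμ hlam, fun f hf => ?_⟩⟩
  rw [ENNReal.coe_toNNReal hC]
  obtain ⟨U, hU⟩ := hlam.isWeight.exists_isVersion
  obtain ⟨V, hV⟩ := hμ.isWeight.exists_isVersion
  have hp0 : 0 < p := by linarith
  have hn : (0 : ℝ) < n := hα.trans hαn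
  have hlt : 1 / q < 1 / p := by rw [← hpq]; linarith [div_pos hα hn]
  have hpq' : p ≤ q := le_of_not_gt fun h => absurd (one_div_lt_one_div_of_lt hq h) (by linarith)
  have hbmeas : AEStronglyMeasurable b volume := hb.locallyIntegrable.aestronglyMeasurable
  have hfmeas : AEStronglyMeasurable f volume :=
    hf.1.mono_ac (hμ.isWeight.absolutelyContinuous_powMeasure p)
  set b' := hbmeas.mk b with hb'
  set f' := hfmeas.mk f with hf'
  have hbm : Measurable b' := hbmeas.stronglyMeasurable_mk.measurable
  have hbae : b =ᵐ[volume] b' := hbmeas.ae_eq_mk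
  have hfm : StronglyMeasurable f' := hfmeas.stronglyMeasurable_mk
  have hfae : f =ᵐ[volume] f' := hfmeas.ae_eq_mk
  set F : Rn n → ℝ≥0∞ := fun y => ‖f' y‖ₑ with hF
  have hFm : Measurable F := hfm.enorm
  have hnorm : eLpNorm f (ENNReal.ofReal p) (powMeasure μ p) =
      weightedNorm volume (1 / p) V F := by
    rw [eLpNorm_powMeasure_eq hp0 hV hμ.isWeight]
    refine le_antisymm (weightedNorm_mono (by positivity) ?_)
      (weightedNorm_mono (by positivity) ?_)
    all_goals
      filter_upwards [hfae] with y hy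
      rw [hF]; simp only; rw [hy]
  have hfin : weightedNorm volume (1 / p) V F ≠ ∞ := hnorm ▸ hf.2.ne
  have hb2 := hb.congr hbae
  have h1 := ae_lintegral_commutator_ne_top hm hα hαn hp hq hpq hμ hlam hbm hb2 hU hV hFm hfin
  have h0 := ae_lt_top_of_weightedNorm_ne_top (one_div_pos.2 hq) hV.measurable hV.ne_zero
    (by simpa using (measurable_lintegral_rieszKernel (α := α) measurable_const 0 hFm
      (b := fun _ => (0 : ℝ))).aemeasurable)
    (weightedNorm_rieszKernel_ne_top hα hαn hp hq hpq hμ hV hFm hfin)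
  have hconv : ∀ᵐ x ∂(volume : Measure (Rn n)), ∀ k ≤ m,
      Integrable (rieszIntegrand α (fun y => b y ^ k • f y) x) volume := by
    filter_upwards [h0, h1] with x hx0 hx1 k hk
    refine ⟨aestronglyMeasurable_rieszIntegrand ((hbmeas.pow k).smul hfmeas) x, ?_⟩
    have hk0 : Measurable fun y => rieszKernel α x y * F y :=
      (measurable_rieszKernel α).of_uncurry_left.mul hFm
    have hk1 : Measurable fun y => rieszKernel α x y * (ENNReal.ofReal |b' x - b' y| ^ m * F y) :=
      (measurable_rieszKernel α).of_uncurry_left.mul (Measurable.mul (by fun_prop) hFm)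
    calc ∫⁻ y, ‖rieszIntegrand α (fun y => b y ^ k • f y) x y‖ₑ
        ≤ ∫⁻ y, ((1 + 2 ^ m * ENNReal.ofReal |b' x| ^ m) * (rieszKernel α x y * F y) +
          2 ^ m * (rieszKernel α x y * (ENNReal.ofReal |b' x - b' y| ^ m * F y))) := by
          refine lintegral_mono_ae ?_
          filter_upwards [hbae, hfae] with y hy1 hy2
          rw [enorm_rieszIntegrand, enorm_smul, ← ofReal_abs_pow_eq_enorm, hy1, hy2]
          have h2 : ENNReal.ofReal |b' y| ^ k ≤ 1 + ENNReal.ofReal |b' y| ^ m := by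
            rcases le_total (ENNReal.ofReal |b' y|) 1 with h | h
            · exact (pow_le_one₀ zero_le h).trans le_self_add
            · exact (pow_le_pow_right₀ h hk).trans le_add_self
          have h3 := h2.trans (add_le_add_right (ofReal_abs_pow_le m (b' x) (b' y)) 1)
          calc rieszKernel α x y * (ENNReal.ofReal |b' y| ^ k * ‖f' y‖ₑ)
              ≤ rieszKernel α x y * ((1 + 2 ^ m * (ENNReal.ofReal |b' x| ^ m +
                ENNReal.ofReal |b' x - b' y| ^ m)) * ‖f' y‖ₑ) :=
                mul_le_mul_right (mul_le_mul_left h3 _) _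
            _ = _ := by rw [hF]; ring
      _ = (1 + 2 ^ m * ENNReal.ofReal |b' x| ^ m) * (∫⁻ y, rieszKernel α x y * F y) +
          2 ^ m * ∫⁻ y, rieszKernel α x y * (ENNReal.ofReal |b' x - b' y| ^ m * F y) := by
          rw [lintegral_add_left (hk0.const_mul _), lintegral_const_mul _ hk0,
            lintegral_const_mul _ hk1]
      _ < ∞ := lt_top_iff_ne_top.2 (by finiteness)
  have hformula : ∀ᵐ x, iterCommutator b (rieszPotential α) m f x =
      ∫ y, (b' x - b' y) ^ m • rieszIntegrand α f' x y := by
    filter_upwards [hconv, hbae] with x hx hbx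
    rw [iterCommutator_eq_integral m hx]
    refine integral_congr_ae ?_
    filter_upwards [hbae, hfae] with y hy1 hy2
    rw [hbx, hy1, rieszIntegrand, rieszIntegrand, hy2]
  have hsm : StronglyMeasurable fun x => ∫ y, (b' x - b' y) ^ m • rieszIntegrand α f' x y := by
    refine StronglyMeasurable.integral_prod_right' (f := fun p : Rn n × Rn n =>
      (b' p.1 - b' p.2) ^ m • rieszIntegrand α f' p.1 p.2) ?_
    unfold rieszIntegrand
    refine StronglyMeasurable.smul (Measurable.stronglyMeasurable (by fun_prop))
      (StronglyMeasurable.smul (Measurable.stronglyMeasurable (by fun_prop))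
        (hfm.comp_measurable measurable_snd))
  have hbound : eLpNorm (iterCommutator b (rieszPotential α) m f) (ENNReal.ofReal q)
      (powMeasure lam q) ≤ C * bmoNorm (bloomWeight m μ lam) b ^ m * kappa α p q m μ lam *
        eLpNorm f (ENNReal.ofReal p) (powMeasure μ p) := by
    rw [eLpNorm_powMeasure_eq hq hU hlam.isWeight, hnorm, bmoNorm_congr hbae]
    refine le_trans (weightedNorm_mono (by positivity) ?_) (H hμ hlam hbm hb2 hU hV hFm)
    filter_upwards [hformula] with x hx
    rw [hx]
    refine (enorm_integral_le_lintegral_enorm _).trans (le_of_eq (lintegral_congr fun y => ?_))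
    rw [enorm_smul, ← ofReal_abs_pow_eq_enorm, enorm_rieszIntegrand]
    ring
  refine ⟨hconv, ⟨?_, hbound.trans_lt ?_⟩, hbound⟩
  · exact ((hsm.aestronglyMeasurable (μ := volume)).congr
      (hformula.mono fun x hx => hx.symm)).mono_ac (powMeasure_absolutelyContinuous lam q)
  · have h2 := kappa_ne_top hm hαn.le hμ hlam hp hpq'
    have h3 := hb.norm_lt_top.ne
    have h4 := hf.2.ne
    exact lt_top_iff_ne_top.2 (by finiteness)

/-! ### Medians and averages over a probability space -/

/-- Every probability measure on the line has a median. -/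
theorem exists_median (ρ : Measure ℝ) [IsProbabilityMeasure ρ] :
    ∃ c, ρ (Set.Ioi c) ≤ 1 / 2 ∧ ρ (Set.Iio c) ≤ 1 / 2 := by
  set S : Set ℝ := {t | ρ (Set.Ioi t) ≤ 1 / 2} with hS
  have hanti : Antitone fun t => ρ (Set.Ioi t) := fun s t hst => measure_mono (Set.Ioi_subset_Ioi hst)
  have hne : S.Nonempty := by
    have h : Filter.Tendsto (fun k : ℕ => ρ (Set.Ioi (k : ℝ))) Filter.atTop
        (nhds (ρ (⋂ k : ℕ, Set.Ioi (k : ℝ)))) :=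
      tendsto_measure_iInter_atTop (fun k => measurableSet_Ioi.nullMeasurableSet)
        (fun k l hkl => Set.Ioi_subset_Ioi (by exact_mod_cast hkl)) ⟨0, measure_ne_top _ _⟩
    have h0 : ⋂ k : ℕ, Set.Ioi (k : ℝ) = ∅ := by
      refine Set.eq_empty_of_forall_notMem fun x hx => ?_
      obtain ⟨k, hk⟩ := exists_nat_gt x
      exact absurd (Set.mem_iInter.1 hx k) (not_lt.2 hk.le)
    rw [h0, measure_empty] at h
    obtain ⟨k, hk⟩ := (h.eventually_le_const (show (0 : ℝ≥0∞) < 1 / 2 by simp)).exists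
    exact ⟨k, hk⟩
  have hbdd : BddBelow S := by
    have h : Filter.Tendsto (fun k : ℕ => ρ (Set.Ioi (-(k : ℝ)))) Filter.atTop
        (nhds (ρ (⋃ k : ℕ, Set.Ioi (-(k : ℝ))))) :=
      tendsto_measure_iUnion_atTop fun k l hkl =>
        Set.Ioi_subset_Ioi (neg_le_neg (by exact_mod_cast hkl))
    have h0 : ⋃ k : ℕ, Set.Ioi (-(k : ℝ)) = Set.univ := by
      refine Set.eq_univ_of_forall fun x => Set.mem_iUnion.2 ?_
      obtain ⟨k, hk⟩ := exists_nat_gt (-x)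
      exact ⟨k, by rw [Set.mem_Ioi]; linarith⟩
    rw [h0, measure_univ] at h
    obtain ⟨k, hk⟩ := (h.eventually_const_lt (show (1 / 2 : ℝ≥0∞) < 1 by
      rw [one_div]; exact ENNReal.one_half_lt_one)).exists
    refine ⟨-(k : ℝ), fun t ht => ?_⟩
    by_contra hcon
    exact absurd (hk.trans_le (hanti (not_le.1 hcon).le)) (not_lt.2 ht)
  set c := sInf S with hc
  refine ⟨c, ?_, ?_⟩
  · obtain ⟨u, hu1, hu2, hu3⟩ := exists_seq_strictAnti_tendsto c
    have h1 : Set.Ioi c = ⋃ k, Set.Ioi (u k) := by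
      ext x
      simp only [Set.mem_Ioi, Set.mem_iUnion]
      exact ⟨fun h => ((hu3.eventually_lt_const h).exists), fun ⟨k, hk⟩ => (hu2 k).trans hk⟩
    rw [h1, (monotone_nat_of_le_succ fun k => Set.Ioi_subset_Ioi
      (hu1 (Nat.lt_succ_self k)).le).measure_iUnion]
    refine iSup_le fun k => ?_
    obtain ⟨s, hs, hsk⟩ := exists_lt_of_csInf_lt hne (hu2 k)
    exact (hanti hsk.le).trans hs
  · obtain ⟨u, hu1, hu2, hu3⟩ := exists_seq_strictMono_tendsto c
    have h1 : Set.Iio c = ⋃ k, Set.Iic (u k) := by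
      ext x
      simp only [Set.mem_Iio, Set.mem_iUnion, Set.mem_Iic]
      exact ⟨fun h => ((hu3.eventually_const_le h).exists), fun ⟨k, hk⟩ => hk.trans_lt (hu2 k)⟩
    rw [h1, (monotone_nat_of_le_succ fun k => Set.Iic_subset_Iic.2
      (hu1 (Nat.lt_succ_self k)).le).measure_iUnion]
    refine iSup_le fun k => ?_
    have h2 : u k ∉ S := fun h => absurd (csInf_le hbdd h) (not_le.2 (hu2 k))
    have h3 : 1 / 2 < ρ (Set.Ioi (u k)) := not_le.1 h2
    rw [← Set.compl_Ioi, prob_compl_eq_one_sub measurableSet_Ioi]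
    refine (tsub_le_tsub_left h3.le 1).trans (le_of_eq ?_)
    rw [one_div, ENNReal.one_sub_inv_two]

section Averages

variable {X : Type*} [MeasurableSpace X] {ν : Measure X} [IsProbabilityMeasure ν]
  {U V : X → ℝ≥0∞} {β γ : ℝ} {m : ℕ}

/-- The lower bound for the average of `(V / U)^{1/m}` that follows from Hölder's inequality. -/
theorem one_le_lintegral_rootRatio_mul (hU : Measurable U) (hV : Measurable V)
    (hU0 : ∀ x, U x ≠ 0) (hU1 : ∀ x, U x ≠ ∞) (hV0 : ∀ x, V x ≠ 0) (hV1 : ∀ x, V x ≠ ∞)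
    (hγ : 0 < γ) (hβ : β < 1) (hm : 1 ≤ m) :
    1 ≤ (∫⁻ x, U x ^ (-(1 / (m : ℝ))) * V x ^ (1 / (m : ℝ)) ∂ν) ^ m *
      (∫⁻ x, V x ^ (-(1 / (1 - β))) ∂ν) ^ (1 - β) * (∫⁻ x, U x ^ (1 / γ) ∂ν) ^ γ := by
  have hm0 : (0 : ℝ) < m := by exact_mod_cast hm
  have hβ1 : 0 < 1 - β := by linarith
  set a : ℝ := 1 / (m + (1 - β) + γ) with ha
  have ha0 : 0 < a := by positivity
  set g : Fin 3 → X → ℝ≥0∞ := ![fun x => U x ^ (-(1 / (m : ℝ))) * V x ^ (1 / (m : ℝ)),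
    fun x => V x ^ (-(1 / (1 - β))), fun x => U x ^ (1 / γ)] with hg
  have hgm : ∀ i ∈ Finset.univ, AEMeasurable (g i) ν := by
    intro i _
    fin_cases i
    · exact ((hU.pow_const _).mul (hV.pow_const _)).aemeasurable
    · exact (hV.pow_const _).aemeasurable
    · exact (hU.pow_const _).aemeasurable
  have h := ENNReal.lintegral_prod_norm_pow_le (μ := ν) Finset.univ hgm
    (p := ![a * m, a * (1 - β), a * γ]) (by
      rw [Fin.sum_univ_three]
      simp only [Matrix.cons_val]
      rw [ha]; field_simp) (by
      intro i _
      fin_cases i <;> simp only [Matrix.cons_val, Fin.mk_zero, Fin.mk_one, Fin.reduceFinMk] <;>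
        positivity)
  simp only [Fin.prod_univ_three, hg, Matrix.cons_val] at h
  have hpt (x : X) : (U x ^ (-(1 / (m : ℝ))) * V x ^ (1 / (m : ℝ))) ^ (a * m) *
      (V x ^ (-(1 / (1 - β)))) ^ (a * (1 - β)) * (U x ^ (1 / γ)) ^ (a * γ) = 1 := by
    rw [ENNReal.mul_rpow_of_nonneg _ _ (by positivity), ← ENNReal.rpow_mul, ← ENNReal.rpow_mul,
      ← ENNReal.rpow_mul, ← ENNReal.rpow_mul,
      show -(1 / (m : ℝ)) * (a * m) = -a by field_simp,
      show 1 / (m : ℝ) * (a * m) = a by field_simp,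
      show -(1 / (1 - β)) * (a * (1 - β)) = -a by field_simp,
      show 1 / γ * (a * γ) = a by field_simp, mul_assoc, mul_assoc, ← mul_assoc (V x ^ a),
      ← ENNReal.rpow_add _ _ (hV0 x) (hV1 x), add_neg_cancel, ENNReal.rpow_zero, one_mul,
      ← ENNReal.rpow_add _ _ (hU0 x) (hU1 x), neg_add_cancel, ENNReal.rpow_zero]
  simp only [hpt, lintegral_const, measure_univ, mul_one] at h
  have h2 := ENNReal.rpow_le_rpow h (one_div_pos.2 ha0).le
  rw [ENNReal.one_rpow, ENNReal.mul_rpow_of_nonneg _ _ (by positivity),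
    ENNReal.mul_rpow_of_nonneg _ _ (by positivity), ← ENNReal.rpow_mul, ← ENNReal.rpow_mul,
    ← ENNReal.rpow_mul, show a * m * (1 / a) = m by field_simp,
    show a * (1 - β) * (1 / a) = 1 - β by field_simp, show a * γ * (1 / a) = γ by field_simp,
    ENNReal.rpow_natCast] at h2
  exact h2

/-- From a weighted bound for the `m`-th power of `g` to a bound for the mean of `g` by the mean of
`(V / U)^{1/m}`. -/
theorem lintegral_le_mul_lintegral_rootRatio (hU : Measurable U) (hV : Measurable V)
    (hU0 : ∀ x, U x ≠ 0) (hU1 : ∀ x, U x ≠ ∞) (hV0 : ∀ x, V x ≠ 0) (hV1 : ∀ x, V x ≠ ∞)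
    (hγ : 0 < γ) (hγβ : γ ≤ β) (hβ : β < 1) (hm : 1 ≤ m) {K L A : ℝ≥0∞}
    (hK : (∫⁻ x, U x ^ (1 / γ) ∂ν) * (∫⁻ x, U x ^ (-(1 / (1 - β))) ∂ν) ^ ((1 - β) / γ) ≤ K)
    (hL : (∫⁻ x, V x ^ (1 / γ) ∂ν) * (∫⁻ x, V x ^ (-(1 / (1 - β))) ∂ν) ^ ((1 - β) / γ) ≤ L)
    {g : X → ℝ≥0∞} (hg : Measurable g)
    (hA : weightedNorm ν γ U (fun x => g x ^ m) ≤ A * (∫⁻ x, V x ^ (1 / β) ∂ν) ^ β) :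
    ∫⁻ x, g x ∂ν ≤ (A * K ^ γ * L ^ γ) ^ (1 / (m : ℝ)) *
      ∫⁻ x, U x ^ (-(1 / (m : ℝ))) * V x ^ (1 / (m : ℝ)) ∂ν := by
  have hm1 : (1 : ℝ) ≤ m := by exact_mod_cast hm
  have hm0 : (0 : ℝ) < m := by linarith
  have hβ1 : 0 < 1 - β := by linarith
  have hβ0 : 0 < β := by linarith
  set H := ∫⁻ x, U x ^ (-(1 / (m : ℝ))) * V x ^ (1 / (m : ℝ)) ∂ν with hH
  set U1 := (∫⁻ x, U x ^ (1 / γ) ∂ν) ^ γ with hU1'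
  set U2 := (∫⁻ x, U x ^ (-(1 / (1 - β))) ∂ν) ^ (1 - β) with hU2'
  set V1 := (∫⁻ x, V x ^ (1 / γ) ∂ν) ^ γ with hV1'
  set V2 := (∫⁻ x, V x ^ (-(1 / (1 - β))) ∂ν) ^ (1 - β) with hV2'
  have hpow {a b c : ℝ≥0∞} (h : a * b ^ ((1 - β) / γ) ≤ c) : a ^ γ * b ^ (1 - β) ≤ c ^ γ := by
    have := ENNReal.rpow_le_rpow h hγ.le
    rwa [ENNReal.mul_rpow_of_nonneg _ _ hγ.le, ← ENNReal.rpow_mul, div_mul_cancel₀ _ hγ.ne'] at this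
  have hUU : U1 * U2 ≤ K ^ γ := hpow hK
  have hVV : V1 * V2 ≤ L ^ γ := hpow hL
  have hone : 1 ≤ H ^ m * V2 * U1 :=
    one_le_lintegral_rootRatio_mul hU hV hU0 hU1 hV0 hV1 hγ hβ hm
  have hVβ : (∫⁻ x, V x ^ (1 / β) ∂ν) ^ β ≤ V1 := by
    have h := ENNReal.rpow_le_rpow (lintegral_rpow_le_of_le (μ := ν) hV (s := 1 / β) (t := 1 / γ)
      (by positivity) (one_div_le_one_div_of_le hγ hγβ)) hβ0.le
    rwa [measure_univ, ENNReal.one_rpow, mul_one, ← ENNReal.rpow_mul,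
      show 1 / β / (1 / γ) * β = γ by field_simp] at h
  have hθ0 : 0 < γ / m := by positivity
  have hθ1 : γ / m < 1 := by rw [div_lt_one hm0]; linarith
  have hmγ : 0 < m - γ := by linarith
  -- Hölder's inequality with the exponent `m / γ`
  have hhold : ∫⁻ x, g x ∂ν ≤ (weightedNorm ν γ U fun x => g x ^ m) ^ (1 / (m : ℝ)) *
      U2 ^ (1 / (m : ℝ)) := by
    have h1 := lintegral_mul_le_rpow (μ := ν) hθ0 hθ1 (f := fun x => g x * U x ^ (1 / (m : ℝ)))
      (g := fun x => U x ^ (-(1 / (m : ℝ)))) (hg.mul (hU.pow_const _)).aemeasurable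
      (hU.pow_const _).aemeasurable
    have h2 (x : X) : g x * U x ^ (1 / (m : ℝ)) * U x ^ (-(1 / (m : ℝ))) = g x := by
      rw [mul_assoc, ← ENNReal.rpow_add _ _ (hU0 x) (hU1 x), add_neg_cancel, ENNReal.rpow_zero,
        mul_one]
    have h3 (x : X) : (g x * U x ^ (1 / (m : ℝ))) ^ (1 / (γ / m)) = (g x ^ m * U x) ^ (1 / γ) := by
      rw [show 1 / (γ / m) = m * (1 / γ) by field_simp, ENNReal.rpow_mul,
        ENNReal.mul_rpow_of_nonneg _ _ hm0.le, ← ENNReal.rpow_mul, one_div_mul_cancel hm0.ne',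
        ENNReal.rpow_one, ENNReal.rpow_natCast]
    simp only [h2, h3, ← ENNReal.rpow_mul] at h1
    refine h1.trans (mul_le_mul' (le_of_eq ?_) ?_)
    · rw [weightedNorm, ← ENNReal.rpow_mul, mul_one_div]
    · have h4 := ENNReal.rpow_le_rpow (lintegral_rpow_le_of_le (μ := ν) (f := fun x => (U x)⁻¹)
        hU.inv (s := 1 / (m - γ)) (t := 1 / (1 - β)) (by positivity)
        (one_div_le_one_div_of_le hβ1 (by linarith))) (sub_pos.2 hθ1).le
      rw [measure_univ, ENNReal.one_rpow, mul_one, ← ENNReal.rpow_mul] at h4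
      simp only [ENNReal.inv_rpow, ← ENNReal.rpow_neg] at h4
      rw [hU2', ← ENNReal.rpow_mul]
      have e1 : -(1 / (m : ℝ)) * (1 / (1 - γ / m)) = -(1 / (m - γ)) := by field_simp
      have e2 : 1 / (m - γ) / (1 / (1 - β)) * (1 - γ / m) = (1 - β) * (1 / m) := by field_simp
      rw [e2] at h4
      rwa [e1]
  have hfinal : (∫⁻ x, g x ∂ν) ^ (m : ℝ) ≤ A * K ^ γ * L ^ γ * H ^ (m : ℝ) := by
    calc (∫⁻ x, g x ∂ν) ^ (m : ℝ)
        ≤ ((weightedNorm ν γ U fun x => g x ^ m) ^ (1 / (m : ℝ)) * U2 ^ (1 / (m : ℝ))) ^ (m : ℝ) :=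
          ENNReal.rpow_le_rpow hhold hm0.le
      _ = (weightedNorm ν γ U fun x => g x ^ m) * U2 := by
          rw [ENNReal.mul_rpow_of_nonneg _ _ hm0.le, ← ENNReal.rpow_mul, ← ENNReal.rpow_mul,
            one_div_mul_cancel hm0.ne', ENNReal.rpow_one, ENNReal.rpow_one]
      _ ≤ A * V1 * U2 := mul_le_mul_left (hA.trans (mul_le_mul_right hVβ _)) _
      _ ≤ A * V1 * U2 * (H ^ m * V2 * U1) := le_mul_of_one_le_right' hone
      _ = A * (U1 * U2) * (V1 * V2) * H ^ m := by ring
      _ ≤ A * K ^ γ * L ^ γ * H ^ m :=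
          mul_le_mul_left (mul_le_mul' (mul_le_mul_right hUU _) hVV) _
      _ = _ := by rw [ENNReal.rpow_natCast]
  have := ENNReal.rpow_le_rpow hfinal (one_div_pos.2 hm0).le
  rwa [ENNReal.mul_rpow_of_nonneg _ _ (by positivity), ← ENNReal.rpow_mul, ← ENNReal.rpow_mul,
    mul_one_div_cancel hm0.ne', ENNReal.rpow_one, ENNReal.rpow_one] at this

end Averages

/-! ### Necessity -/

/-- The normalized Lebesgue measure on a cube. -/
noncomputable def cubeMeasure (a : Rn n) (l : ℝ) : Measure (Rn n) :=
  (volume (cube a l))⁻¹ • volume.restrict (cube a l)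

theorem isProbabilityMeasure_cubeMeasure (a : Rn n) {l : ℝ} (hl : 0 < l) :
    IsProbabilityMeasure (cubeMeasure a l) :=
  ⟨by simp [cubeMeasure, ENNReal.inv_mul_cancel (volume_cube_ne_zero a hl)
    (volume_cube_ne_top a l)]⟩

theorem lintegral_cubeMeasure (a : Rn n) (l : ℝ) (f : Rn n → ℝ≥0∞) :
    ∫⁻ x, f x ∂(cubeMeasure a l) = (∫⁻ x in cube a l, f x) / volume (cube a l) := by
  rw [cubeMeasure, lintegral_smul_measure, smul_eq_mul, ENNReal.div_eq_inv_mul]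

theorem CubeMuckenhoupt.cubeMeasure_le {a b : ℝ} (ha : 0 < a) (hb : 0 < b) {W : Rn n → ℝ≥0∞}
    {K : ℝ≥0∞} (h : CubeMuckenhoupt a b W K) (x : Rn n) {l : ℝ} (hl : 0 < l) :
    (∫⁻ y, W y ^ (1 / b) ∂(cubeMeasure x l)) *
      (∫⁻ y, W y ^ (-(1 / a)) ∂(cubeMeasure x l)) ^ (a / b) ≤ K := by
  rw [lintegral_cubeMeasure, lintegral_cubeMeasure,
    mul_rpow_div_le_iff (volume_cube_ne_zero x hl) (volume_cube_ne_top x l) (by positivity)]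
  exact h x l hl

theorem rieszKernel_comm (α : ℝ) (x y : Rn n) : rieszKernel α x y = rieszKernel α y x := by
  rw [rieszKernel, rieszKernel, norm_sub_rev]

/-- The kernel of the fractional integral is integrable over cubes. -/
theorem exists_lintegral_rieszKernel_le {α : ℝ} (hα : 0 < α) (hαn : α < n) (a : Rn n) {l : ℝ}
    (hl : 0 < l) : ∃ C : ℝ≥0∞, C ≠ ∞ ∧ ∀ y ∈ cube a l, ∫⁻ x in cube a l, rieszKernel α x y ≤ C := by
  obtain ⟨C, hC, H⟩ := tsum_side_rpow_le hα
  have hL : 0 < 3 * ((n + 1) * l) := by positivity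
  refine ⟨ENNReal.ofReal (6 ^ (n - α)) * ∑ _t : Fin n → Fin 2,
    C * ENNReal.ofReal (3 * ((n + 1) * l) / 2 ^ 0) ^ α, ?_, fun y hy => ?_⟩
  · have h1 : ENNReal.ofReal (3 * ((n + 1) * l) / 2 ^ 0) ^ α ≠ ∞ :=
      ENNReal.rpow_ne_top_of_nonneg hα.le ENNReal.ofReal_ne_top
    rw [Finset.sum_const, nsmul_eq_mul]
    finiteness
  · have hsub : cube a l ⊆ Metric.ball y (3 * ((n + 1) * l) / 3) := fun x hx => by
      rw [Metric.mem_ball, dist_eq_norm]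
      have := norm_sub_le_of_mem_cube hl.le hx hy
      linarith
    calc ∫⁻ x in cube a l, rieszKernel α x y
        ≤ ∫⁻ x in Metric.ball y (3 * ((n + 1) * l) / 3), rieszKernel α y x * 1 := by
          simp_rw [rieszKernel_comm α y, mul_one]
          exact lintegral_mono_set hsub
      _ ≤ _ := lintegral_ball_rieszKernel_mul_le hαn hL measurable_const y
      _ ≤ _ := by
          refine mul_le_mul_right (Finset.sum_le_sum fun t _ => ?_) _
          refine le_trans (ENNReal.tsum_le_tsum fun k => ?_) (H hL 0)
          rw [Set.indicator_of_mem (by exact Nat.zero_le k), NestedFamily.avg]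
          simp only [lintegral_const, one_mul, Measure.restrict_apply_univ]
          exact mul_le_of_le_one_right' ENNReal.div_self_le_one

/-- The commutator integrals of characteristic functions converge absolutely almost everywhere. -/
theorem MemLocPow.ae_integrable_rieszIntegrand {𝕜 : Type*} [RCLike 𝕜] {m : ℕ} {α : ℝ} (hα : 0 < α)
    (hαn : α < n) {b : Rn n → ℝ} (hb : MemLocPow m b) (a : Rn n) {l : ℝ} (hl : 0 < l)
    {E : Set (Rn n)} (hE : MeasurableSet E) (hEQ : E ⊆ cube a l) :
    ∀ᵐ x ∂(volume.restrict (cube a l)), ∀ k ≤ m,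
      Integrable (rieszIntegrand α (fun y => b y ^ k • E.indicator (fun _ => (1 : 𝕜)) y) x)
        volume := by
  obtain ⟨C, hC, H⟩ := exists_lintegral_rieszKernel_le hα hαn a hl
  have hbm : AEMeasurable b := hb.aestronglyMeasurable.aemeasurable
  have hgm : AEMeasurable (fun y => 1 + ‖b y‖ₑ ^ m) := aemeasurable_const.add (hbm.enorm.pow_const m)
  have hgm' : AEMeasurable (fun y => 1 + ‖b y‖ₑ ^ m) (volume.restrict (cube a l)) := hgm.restrict
  have hgint : ∫⁻ y in cube a l, (1 + ‖b y‖ₑ ^ m) ≠ ∞ := by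
    rw [lintegral_add_left measurable_const]
    simp only [lintegral_const, one_mul, Measure.restrict_apply_univ]
    have h1 := (integrableOn_cube hb.locallyIntegrable_pow a hl).2.ne
    simp only [← ofReal_abs_pow_eq_enorm, abs_abs] at h1
    simp only [← Real.norm_eq_abs, ofReal_norm] at h1
    exact ENNReal.add_ne_top.2 ⟨volume_cube_ne_top a l, h1⟩
  have hkm : AEMeasurable (Function.uncurry fun x y => rieszKernel α x y * (1 + ‖b y‖ₑ ^ m))
      ((volume.restrict (cube a l)).prod (volume.restrict (cube a l))) :=
    (measurable_rieszKernel α).aemeasurable.mul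
      (hgm'.comp_quasiMeasurePreserving Measure.quasiMeasurePreserving_snd)
  have hfin : ∫⁻ x in cube a l, ∫⁻ y in cube a l, rieszKernel α x y * (1 + ‖b y‖ₑ ^ m) ≠ ∞ := by
    rw [lintegral_lintegral_swap hkm]
    refine ne_top_of_le_ne_top (ENNReal.mul_ne_top hC hgint) ?_
    rw [← lintegral_const_mul' _ _ hC]
    refine setLIntegral_mono' (measurableSet_cube a l) fun y hy => ?_
    rw [lintegral_mul_const _ ((measurable_rieszKernel α).of_uncurry_right)]
    exact mul_le_mul_left (H y hy) _
  filter_upwards [ae_lt_top' hkm.lintegral_prod_right' hfin] with x hx k hk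
  have hmeas : AEStronglyMeasurable (fun y => b y ^ k • E.indicator (fun _ => (1 : 𝕜)) y) :=
    (hb.aestronglyMeasurable.pow k).smul (aestronglyMeasurable_const.indicator hE)
  refine ⟨aestronglyMeasurable_rieszIntegrand hmeas x, lt_of_le_of_lt ?_ hx⟩
  rw [← lintegral_indicator (measurableSet_cube a l)]
  refine lintegral_mono fun y => ?_
  rw [enorm_rieszIntegrand, enorm_smul]
  by_cases hy : y ∈ E
  · rw [Set.indicator_of_mem (hEQ hy), Set.indicator_of_mem hy, enorm_one, mul_one]
    refine mul_le_mul_right ?_ _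
    rw [enorm_pow]
    rcases le_total ‖b y‖ₑ 1 with h | h
    · exact (pow_le_one₀ zero_le h).trans le_self_add
    · exact (pow_le_pow_right₀ h hk).trans le_add_self
  · simp [Set.indicator_of_notMem hy]

/-- If the values of `b` on `E` lie on one side of `c` and the value at `x` on the other, then the
integrand of the commutator of `χ_E` has a constant sign. -/
theorem mul_volume_le_enorm_iterCommutator {𝕜 : Type*} [RCLike 𝕜] {m : ℕ} (hm : 1 ≤ m) {α : ℝ}
    (hαn : α < n) {b b' : Rn n → ℝ} (hb : b =ᵐ[volume] b') {a : Rn n} {l : ℝ} (hl : 0 < l)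
    {E : Set (Rn n)} (hE : MeasurableSet E) (hEQ : E ⊆ cube a l) {x : Rn n} (hx : x ∈ cube a l)
    (hbx : b x = b' x)
    (hconv : ∀ k ≤ m,
      Integrable (rieszIntegrand α (fun y => b y ^ k • E.indicator (fun _ => (1 : 𝕜)) y) x) volume)
    {c ε : ℝ} (hε : |ε| = 1) (hxc : 0 ≤ ε * (b' x - c)) (hEc : ∀ y ∈ E, ε * (b' y - c) ≤ 0) :
    ENNReal.ofReal |b' x - c| ^ m * volume E ≤ ENNReal.ofReal ((n * l) ^ (n - α)) *
      ‖iterCommutator b (rieszPotential α) m (E.indicator fun _ => (1 : 𝕜)) x‖ₑ := by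
  set f : Rn n → 𝕜 := E.indicator fun _ => (1 : 𝕜) with hf
  have hεε : ε * ε = 1 := by rw [← abs_mul_abs_self, hε, one_mul]
  have hint : Integrable (fun y => (b x - b y) ^ m • rieszIntegrand α f x y) volume :=
    integrable_sub_pow_mul_smul _ m fun k hk => by
      simpa only [← rieszIntegrand_smul α (fun y => b y ^ k)] using hconv k hk
  have hsign : ∀ y ∈ E, (b' x - b' y) ^ m = ε ^ m * |b' x - b' y| ^ m := by
    intro y hy
    have h1 : 0 ≤ ε * (b' x - b' y) := by have := hEc y hy; linarith
    have h2 : |b' x - b' y| = ε * (b' x - b' y) := by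
      rw [← abs_of_nonneg h1, abs_mul, hε, one_mul]
    rw [h2, ← mul_pow, ← mul_assoc, hεε, one_mul]
  have hae : ∀ᵐ y, (b x - b y) ^ m • rieszIntegrand α f x y =
      (ε ^ m * ‖(b x - b y) ^ m • rieszIntegrand α f x y‖) • (1 : 𝕜) := by
    filter_upwards [hb] with y hy
    rw [hy, hbx]
    by_cases hyE : y ∈ E
    · have h1 : rieszIntegrand α f x y = (‖x - y‖ ^ ((n : ℝ) - α))⁻¹ • (1 : 𝕜) := by
        rw [rieszIntegrand, hf, Set.indicator_of_mem hyE]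
      rw [h1, smul_smul, norm_smul, norm_one, mul_one, norm_mul, norm_pow, Real.norm_eq_abs,
        Real.norm_of_nonneg (by positivity), hsign y hyE, mul_assoc]
    · have h1 : rieszIntegrand α f x y = 0 := by
        rw [rieszIntegrand, hf, Set.indicator_of_notMem hyE, smul_zero]
      simp [h1]
  have hnorm : ‖iterCommutator b (rieszPotential α) m f x‖ₑ =
      ∫⁻ y, ‖(b x - b y) ^ m • rieszIntegrand α f x y‖ₑ := by
    rw [iterCommutator_eq_integral m hconv, integral_congr_ae hae, integral_smul_const,
      integral_const_mul, enorm_smul, enorm_one, mul_one, enorm_mul, enorm_pow,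
      ← ofReal_norm ε, Real.norm_eq_abs, hε, ENNReal.ofReal_one, one_pow, one_mul,
      Real.enorm_of_nonneg (integral_nonneg fun _ => norm_nonneg _),
      ofReal_integral_norm_eq_lintegral_enorm hint]
  have hd : ENNReal.ofReal ((n * l) ^ (n - α)) ≠ ∞ := ENNReal.ofReal_ne_top
  rw [hnorm, ← lintegral_const_mul' _ _ hd, ← setLIntegral_const]
  refine le_trans ?_ (setLIntegral_le_lintegral E _)
  refine lintegral_mono_ae ((ae_restrict_iff' hE).2 ?_)
  filter_upwards [hb] with y hy hyE
  rw [enorm_smul, enorm_rieszIntegrand, ← ofReal_abs_pow_eq_enorm, hbx, hy, hf,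
    Set.indicator_of_mem hyE, enorm_one, mul_one]
  have hxcy : |b' x - c| ≤ |b' x - b' y| := by
    have h1 : 0 ≤ ε * (b' x - b' y) := by have := hEc y hyE; linarith
    have h2 : |b' x - b' y| = ε * (b' x - b' y) := by
      rw [← abs_of_nonneg h1, abs_mul, hε, one_mul]
    have h3 : |b' x - c| = ε * (b' x - c) := by
      rw [← abs_of_nonneg hxc, abs_mul, hε, one_mul]
    rw [h2, h3]
    have := hEc y hyE
    linarith
  rcases eq_or_ne x y with rfl | hxy
  · have h0 : |b' x - c| = 0 := by
      refine le_antisymm (hxcy.trans ?_) (abs_nonneg _)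
      simp
    rw [h0]
    simp [show m ≠ 0 by omega]
  · calc ENNReal.ofReal |b' x - c| ^ m ≤ ENNReal.ofReal |b' x - b' y| ^ m :=
          pow_le_pow_left' (ENNReal.ofReal_le_ofReal hxcy) m
      _ ≤ (ENNReal.ofReal ((n * l) ^ (n - α)) * rieszKernel α x y) *
          ENNReal.ofReal |b' x - b' y| ^ m :=
          le_mul_of_one_le_left' (one_le_rieszKernel_mul hαn hxy
            (norm_sub_le_of_mem_cube hl.le hx (hEQ hyE)))
      _ = _ := by ring

/-- A median of `b` over a cube: on at least half of the cube `b` is at most `c`, and on at least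
half of it `b` is at least `c`. -/
theorem exists_median_cube {b : Rn n → ℝ} (hb : Measurable b) (a : Rn n) {l : ℝ} (hl : 0 < l) :
    ∃ c : ℝ, ∀ ε : ℝ, |ε| = 1 →
      volume (cube a l) / 2 ≤ volume (cube a l ∩ {x | ε * (b x - c) ≤ 0}) := by
  have := isProbabilityMeasure_cubeMeasure a hl
  have : IsProbabilityMeasure ((cubeMeasure a l).map b) :=
    Measure.isProbabilityMeasure_map hb.aemeasurable
  obtain ⟨c, hc1, hc2⟩ := exists_median ((cubeMeasure a l).map b)
  rw [Measure.map_apply hb measurableSet_Ioi] at hc1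
  rw [Measure.map_apply hb measurableSet_Iio] at hc2
  have hmeas (ε : ℝ) : MeasurableSet {x | ε * (b x - c) ≤ 0} :=
    measurableSet_le (by fun_prop) measurable_const
  have key (ε : ℝ) (h : cubeMeasure a l {x | ε * (b x - c) ≤ 0}ᶜ ≤ 1 / 2) :
      volume (cube a l) / 2 ≤ volume (cube a l ∩ {x | ε * (b x - c) ≤ 0}) := by
    rw [prob_compl_eq_one_sub (hmeas ε), tsub_le_iff_right] at h
    have h2 : (1 : ℝ≥0∞) / 2 ≤ cubeMeasure a l {x | ε * (b x - c) ≤ 0} := by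
      have h3 := tsub_le_iff_left.2 h
      rwa [one_div, ENNReal.one_sub_inv_two, ← one_div] at h3
    rw [cubeMeasure, Measure.smul_apply, Measure.restrict_apply (hmeas ε), smul_eq_mul,
      Set.inter_comm] at h2
    have h3 := mul_le_mul_right h2 (volume (cube a l))
    rwa [← mul_assoc, ENNReal.mul_inv_cancel (volume_cube_ne_zero a hl) (volume_cube_ne_top a l),
      one_mul, mul_one_div] at h3
  refine ⟨c, fun ε hε => key ε ?_⟩
  rcases (abs_eq zero_le_one).1 hε with rfl | rfl
  · refine le_trans (measure_mono fun x hx => ?_) hc1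
    have hx' : ¬ (1 * (b x - c) ≤ 0) := hx
    rw [Set.mem_preimage, Set.mem_Ioi]
    linarith
  · refine le_trans (measure_mono fun x hx => ?_) hc2
    have hx' : ¬ (-1 * (b x - c) ≤ 0) := hx
    rw [Set.mem_preimage, Set.mem_Iio]
    linarith

/-- On the part of the cube where `b` lies on the other side of the median than on `E`, the
oscillation of `b` is controlled by the commutator of `χ_E`. -/
theorem setLIntegral_osc_le {𝕜 : Type*} [RCLike 𝕜] {m : ℕ} (hm : 1 ≤ m) {α : ℝ} (hα : 0 < α)
    (hαn : α < n) {b b' : Rn n → ℝ} (hb : MemLocPow m b) (hbb : b =ᵐ[volume] b')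
    (hbm : Measurable b') (a : Rn n) {l : ℝ} (hl : 0 < l) {c ε : ℝ} (hε : |ε| = 1)
    (hc : volume (cube a l) / 2 ≤ volume (cube a l ∩ {x | ε * (b' x - c) ≤ 0}))
    (U : Rn n → ℝ≥0∞) {r : ℝ} (hr : 0 < r) :
    ∫⁻ x in cube a l ∩ {x | 0 ≤ ε * (b' x - c)}, (ENNReal.ofReal |b' x - c| ^ m * U x) ^ r ≤
      (2 * (ENNReal.ofReal ((n * l) ^ (n - α)) / volume (cube a l))) ^ r *
        ∫⁻ x, (‖iterCommutator b (rieszPotential α) m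
          ((cube a l ∩ {x | ε * (b' x - c) ≤ 0}).indicator fun _ => (1 : 𝕜)) x‖ₑ * U x) ^ r := by
  set E := cube a l ∩ {x | ε * (b' x - c) ≤ 0} with hE
  have hEm : MeasurableSet E :=
    (measurableSet_cube a l).inter (measurableSet_le (by fun_prop) measurable_const)
  have hFm : MeasurableSet {x | 0 ≤ ε * (b' x - c)} :=
    measurableSet_le measurable_const (by fun_prop)
  have hv0 := volume_cube_ne_zero a hl
  have hv1 := volume_cube_ne_top a l
  set v := volume (cube a l) with hv
  have hD : (2 * (ENNReal.ofReal ((n * l) ^ (n - α)) / v)) ^ r ≠ ∞ :=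
    ENNReal.rpow_ne_top_of_nonneg hr.le
      (ENNReal.mul_ne_top (by simp) (ENNReal.div_ne_top ENNReal.ofReal_ne_top hv0))
  rw [← lintegral_const_mul' _ _ hD]
  refine le_trans ?_ (setLIntegral_le_lintegral (cube a l ∩ {x | 0 ≤ ε * (b' x - c)}) _)
  refine lintegral_mono_ae ((ae_restrict_iff' ((measurableSet_cube a l).inter hFm)).2 ?_)
  have h1 := hb.ae_integrable_rieszIntegrand (𝕜 := 𝕜) hα hαn a hl hEm Set.inter_subset_left
  rw [ae_restrict_iff' (measurableSet_cube a l)] at h1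
  filter_upwards [h1, hbb] with x hx hbx hxF
  have h2 := mul_volume_le_enorm_iterCommutator hm hαn hbb hl hEm Set.inter_subset_left hxF.1 hbx
    (hx hxF.1) hε hxF.2 (c := c) fun y hy => hy.2
  rw [← ENNReal.mul_rpow_of_nonneg _ _ hr.le]
  refine ENNReal.rpow_le_rpow ?_ hr.le
  rw [← mul_assoc]
  refine mul_le_mul_left ?_ _
  have h3 := (mul_le_mul_right hc (ENNReal.ofReal |b' x - c| ^ m)).trans h2
  have hv20 : v / 2 ≠ 0 := (ENNReal.div_pos hv0 (by simp)).ne'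
  have hv21 : v / 2 ≠ ∞ := ENNReal.div_ne_top hv1 (by simp)
  rw [← ENNReal.le_div_iff_mul_le (Or.inl hv20) (Or.inl hv21)] at h3
  refine h3.trans (le_of_eq ?_)
  rw [ENNReal.div_eq_inv_mul, ENNReal.div_eq_inv_mul, ENNReal.div_eq_inv_mul,
    ENNReal.mul_inv (by simp) (by simp), inv_inv]
  ring

/-- The restricted strong type bound for the commutator bounds the oscillation of `b` over cubes in
a weighted mean of order `m`. -/
theorem exists_weightedNorm_osc_le {𝕜 : Type*} [RCLike 𝕜] {m : ℕ} (hm : 1 ≤ m) {α p q : ℝ}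
    (hα : 0 < α) (hαn : α < n) (hp : 1 < p) (hq : 1 < q) (hpq : 1 / q + α / n = 1 / p)
    {μ lam b b' : Rn n → ℝ} {U V : Rn n → ℝ≥0∞} (hU : IsVersion U lam) (hlam : IsWeight lam)
    (hV : IsVersion V μ) (hb : MemLocPow m b) (hbb : b =ᵐ[volume] b') (hbm : Measurable b')
    {C : ℝ≥0∞} (hC : ∀ E : Set (Rn n), MeasurableSet E → volume E < ∞ →
      eLpNorm (iterCommutator b (rieszPotential α) m (E.indicator fun _ => (1 : 𝕜)))
        (ENNReal.ofReal q) (powMeasure lam q) ≤ C * powMeasure μ p E ^ (1 / p))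
    (a : Rn n) {l : ℝ} (hl : 0 < l) :
    ∃ c : ℝ, weightedNorm (cubeMeasure a l) (1 / q) U (fun x => ENNReal.ofReal |b' x - c| ^ m) ≤
      4 * C * ENNReal.ofReal ((n : ℝ) ^ (n - α)) *
        (∫⁻ x, V x ^ (1 / (1 / p)) ∂(cubeMeasure a l)) ^ (1 / p) := by
  have hn : (0 : ℝ) < n := hα.trans hαn
  have hp0 : 0 < p := by linarith
  have hq0 : 0 < q := by linarith
  obtain ⟨c, hc⟩ := exists_median_cube hbm a hl
  refine ⟨c, ?_⟩
  have hv0 := volume_cube_ne_zero a hl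
  have hv1 := volume_cube_ne_top a l
  set v := volume (cube a l) with hv
  set D := 2 * (ENNReal.ofReal ((n * l) ^ (n - α)) / v) with hD
  set Y := (∫⁻ x, V x ^ p ∂(cubeMeasure a l)) with hY
  have hYv : ∫⁻ x in cube a l, V x ^ p = v * Y := by
    rw [hY, lintegral_cubeMeasure, ENNReal.mul_div_cancel hv0 hv1]
  have hT (ε : ℝ) : ∫⁻ x, (‖iterCommutator b (rieszPotential α) m
      ((cube a l ∩ {x | ε * (b' x - c) ≤ 0}).indicator fun _ => (1 : 𝕜)) x‖ₑ * U x) ^ q ≤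
      (C * (v * Y) ^ (1 / p)) ^ q := by
    have hEm : MeasurableSet (cube a l ∩ {x | ε * (b' x - c) ≤ 0}) :=
      (measurableSet_cube a l).inter (measurableSet_le (by fun_prop) measurable_const)
    have h1 := hC _ hEm ((measure_mono Set.inter_subset_left).trans_lt hv1.lt_top)
    rw [eLpNorm_powMeasure_eq hq0 hU hlam, weightedNorm, one_div_one_div, powMeasure,
      withDensity_apply _ hEm] at h1
    have h2 : ∫⁻ x in cube a l ∩ {x | ε * (b' x - c) ≤ 0}, ENNReal.ofReal (μ x ^ p) ≤ v * Y := by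
      rw [← hYv]
      refine (lintegral_mono_set Set.inter_subset_left).trans (le_of_eq ?_)
      exact lintegral_congr_ae (ae_restrict_of_ae (hV.ae_rpow_eq p))
    have h3 := ENNReal.rpow_le_rpow (h1.trans (mul_le_mul_right
      (ENNReal.rpow_le_rpow h2 (by positivity)) C)) hq0.le
    rwa [← ENNReal.rpow_mul, one_div_mul_cancel hq0.ne', ENNReal.rpow_one] at h3
  have hosc : ∫⁻ x in cube a l, (ENNReal.ofReal |b' x - c| ^ m * U x) ^ q ≤
      2 * (D * (C * (v * Y) ^ (1 / p))) ^ q := by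
    have hone (ε : ℝ) (hε : |ε| = 1) := (setLIntegral_osc_le (𝕜 := 𝕜) hm hα hαn hb hbb hbm a hl hε
      (hc ε hε) U hq0).trans (mul_le_mul_right (hT ε) _)
    have hsub : cube a l ⊆ (cube a l ∩ {x | 0 ≤ 1 * (b' x - c)}) ∪
        (cube a l ∩ {x | 0 ≤ -1 * (b' x - c)}) := by
      intro x hx
      rcases le_total (b' x) c with h | h
      · exact Or.inr ⟨hx, by
          have : 0 ≤ -1 * (b' x - c) := by linarith
          exact this⟩
      · exact Or.inl ⟨hx, by
          have : 0 ≤ 1 * (b' x - c) := by linarith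
          exact this⟩
    refine (lintegral_mono_set hsub).trans ((lintegral_union_le _ _ _).trans ?_)
    rw [two_mul, ENNReal.mul_rpow_of_nonneg _ _ hq0.le]
    exact add_le_add (hone 1 (by simp)) (hone (-1) (by simp))
  rw [one_div_one_div, weightedNorm, one_div_one_div, lintegral_cubeMeasure]
  have hL0 : ENNReal.ofReal l ≠ 0 := by simpa using hl
  have hL1 : ENNReal.ofReal l ≠ ∞ := ENNReal.ofReal_ne_top
  have hvl : v = ENNReal.ofReal l ^ (n : ℝ) := by
    rw [hv, volume_cube, ENNReal.rpow_natCast]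
  have hscale : ENNReal.ofReal ((n * l) ^ (n - α)) / v * v ^ (1 / p) * v ^ (-(1 / q)) =
      ENNReal.ofReal ((n : ℝ) ^ (n - α)) := by
    rw [Real.mul_rpow hn.le hl.le, ENNReal.ofReal_mul (by positivity),
      ← ENNReal.ofReal_rpow_of_pos hl, hvl, ENNReal.div_eq_inv_mul, ← ENNReal.rpow_neg,
      ← ENNReal.rpow_mul, ← ENNReal.rpow_mul]
    calc _ = ENNReal.ofReal ((n : ℝ) ^ (n - α)) * (ENNReal.ofReal l ^ (-(n : ℝ)) *
          ENNReal.ofReal l ^ (n - α) * ENNReal.ofReal l ^ (n * (1 / p)) *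
          ENNReal.ofReal l ^ (n * -(1 / q))) := by ring
      _ = _ := by
          rw [← ENNReal.rpow_add _ _ hL0 hL1, ← ENNReal.rpow_add _ _ hL0 hL1,
            ← ENNReal.rpow_add _ _ hL0 hL1, ← hpq]
          rw [show -(n : ℝ) + (n - α) + n * (1 / q + α / n) + n * -(1 / q) = 0 by
            field_simp; ring, ENNReal.rpow_zero, mul_one]
  have h2q : (2 : ℝ≥0∞) ^ (1 / q) ≤ 2 :=
    (ENNReal.rpow_le_rpow_of_exponent_le one_le_two ((div_le_one hq0).2 hq.le)).trans_eq
      (ENNReal.rpow_one 2)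
  calc _ ≤ (2 * (D * (C * (v * Y) ^ (1 / p))) ^ q / v) ^ (1 / q) :=
        ENNReal.rpow_le_rpow (ENNReal.div_le_div_right hosc _) (by positivity)
    _ = 2 ^ (1 / q) * (D * (C * (v * Y) ^ (1 / p))) * v ^ (-(1 / q)) := by
        rw [ENNReal.div_rpow_of_nonneg _ _ (by positivity),
          ENNReal.mul_rpow_of_nonneg _ _ (by positivity), ← ENNReal.rpow_mul,
          mul_one_div_cancel hq0.ne', ENNReal.rpow_one, ENNReal.rpow_neg, ENNReal.div_eq_inv_mul]
        ring
    _ ≤ 2 * (D * (C * (v * Y) ^ (1 / p))) * v ^ (-(1 / q)) :=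
        mul_le_mul_left (mul_le_mul_left h2q _) _
    _ = 4 * C * (ENNReal.ofReal ((n * l) ^ (n - α)) / v * v ^ (1 / p) * v ^ (-(1 / q))) *
          Y ^ (1 / p) := by
        rw [hD, ENNReal.mul_rpow_of_nonneg _ _ (by positivity)]
        ring
    _ = _ := by rw [hscale]

theorem MemLocPow.locallyIntegrable {m : ℕ} (hm : 1 ≤ m) {b : Rn n → ℝ} (hb : MemLocPow m b) :
    LocallyIntegrable b volume := by
  refine ((locallyIntegrable_const (1 : ℝ)).add hb.locallyIntegrable_pow).mono
    hb.aestronglyMeasurable (ae_of_all _ fun x => ?_)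
  rw [Pi.add_apply, Real.norm_eq_abs, Real.norm_of_nonneg (by positivity)]
  rcases le_total |b x| 1 with h | h
  · linarith [pow_nonneg (abs_nonneg (b x)) m]
  · linarith [le_self_pow₀ h (show m ≠ 0 by omega)]

/-- The necessity of the condition on `b`. -/
theorem memBMO_of_restricted_strong_type {𝕜 : Type*} [RCLike 𝕜] {m : ℕ} (hm : 1 ≤ m) {α p q : ℝ}
    (hα : 0 < α) (hαn : α < n) (hp : 1 < p) (hq : 0 < q) (hpq : 1 / q + α / n = 1 / p)
    {μ lam b : Rn n → ℝ} (hμ : MemApq p q μ) (hlam : MemApq p q lam) (hb : MemLocPow m b)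
    {C : ℝ≥0} (hC : ∀ E : Set (Rn n), MeasurableSet E → volume E < ∞ →
      eLpNorm (iterCommutator b (rieszPotential α) m (E.indicator fun _ => (1 : 𝕜)))
        (ENNReal.ofReal q) (powMeasure lam q) ≤ C * powMeasure μ p E ^ (1 / p)) :
    MemBMO (bloomWeight m μ lam) b := by
  refine ⟨hb.locallyIntegrable hm, ?_⟩
  have hn : (0 : ℝ) < n := hα.trans hαn
  have hp0 : 0 < p := by linarith
  have hlt : 1 / q < 1 / p := by rw [← hpq]; linarith [div_pos hα hn]
  have hpq' : p ≤ q := le_of_not_gt fun h => absurd (one_div_lt_one_div_of_lt hq h) (by linarith)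
  have hp1 : 1 / p < 1 := (div_lt_one hp0).2 hp
  obtain ⟨U, hU⟩ := hlam.isWeight.exists_isVersion
  obtain ⟨V, hV⟩ := hμ.isWeight.exists_isVersion
  set b' := hb.aestronglyMeasurable.mk b with hb'
  have hbm : Measurable b' := hb.aestronglyMeasurable.stronglyMeasurable_mk.measurable
  have hae : b =ᵐ[volume] b' := hb.aestronglyMeasurable.ae_eq_mk
  set S := (4 * C * ENNReal.ofReal ((n : ℝ) ^ (n - α)) * apqConst p q lam ^ (1 / q) *
    apqConst p q μ ^ (1 / q)) ^ (1 / (m : ℝ)) with hS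
  have hS1 : S ≠ ∞ := by
    have h1 : apqConst p q lam ^ (1 / q) ≠ ∞ :=
      ENNReal.rpow_ne_top_of_nonneg (by positivity) hlam.const_lt_top.ne
    have h2 : apqConst p q μ ^ (1 / q) ≠ ∞ :=
      ENNReal.rpow_ne_top_of_nonneg (by positivity) hμ.const_lt_top.ne
    exact ENNReal.rpow_ne_top_of_nonneg (by positivity) (by finiteness)
  refine lt_of_le_of_lt ?_ (show 2 * S < ∞ from lt_top_iff_ne_top.2 (by finiteness))
  rw [bmoNorm_congr hae]
  refine iSup_le fun a => iSup_le fun l => iSup_le fun hl => ENNReal.div_le_of_le_mul ?_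
  have hv0 := volume_cube_ne_zero a hl
  have hv1 := volume_cube_ne_top a l
  obtain ⟨c, hc⟩ := exists_weightedNorm_osc_le (𝕜 := 𝕜) hm hα hαn hp (by linarith) hpq hU
    hlam.isWeight hV hb hae hbm hC a hl
  have hint : IntegrableOn b' (cube a l) :=
    integrableOn_cube ((hb.locallyIntegrable hm).congr hae) a hl
  have := isProbabilityMeasure_cubeMeasure a hl
  have h1 := lintegral_le_mul_lintegral_rootRatio (ν := cubeMeasure a l) hU.measurable
    hV.measurable hU.ne_zero hU.ne_top hV.ne_zero hV.ne_top (one_div_pos.2 hq) hlt.le hp1 hm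
    ((hU.cubeMuckenhoupt hp hq).cubeMeasure_le (by linarith) (one_div_pos.2 hq) a hl)
    ((hV.cubeMuckenhoupt hp hq).cubeMeasure_le (by linarith) (one_div_pos.2 hq) a hl)
    (g := fun x => ENNReal.ofReal |b' x - c|) (by fun_prop) hc
  rw [lintegral_cubeMeasure, lintegral_cubeMeasure, ENNReal.div_eq_inv_mul,
    ENNReal.div_eq_inv_mul, mul_left_comm, ENNReal.mul_le_mul_iff_right
      (ENNReal.inv_ne_zero.2 hv1) (ENNReal.inv_ne_top.2 hv0)] at h1
  have h2 : ∫⁻ x in cube a l, ENNReal.ofReal (bloomWeight m μ lam x) =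
      ∫⁻ x in cube a l, U x ^ (-(1 / (m : ℝ))) * V x ^ (1 / (m : ℝ)) :=
    lintegral_congr_ae (ae_restrict_of_ae (IsVersion.rootRatio_ae_eq hU hV))
  rw [h2, mul_assoc]
  refine le_trans ?_ (mul_le_mul_right h1 2)
  have hmeas : Measurable fun x => ENNReal.ofReal |b' x - c| := by fun_prop
  calc ∫⁻ x in cube a l, ENNReal.ofReal |b' x - ⨍ y in cube a l, b' y|
      ≤ ∫⁻ x in cube a l, (ENNReal.ofReal |b' x - c| +
          ENNReal.ofReal |(⨍ y in cube a l, b' y) - c|) := by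
        refine lintegral_mono fun x => ?_
        rw [← ENNReal.ofReal_add (abs_nonneg _) (abs_nonneg _), abs_sub_comm (⨍ y in cube a l, b' y) c]
        exact ENNReal.ofReal_le_ofReal (abs_sub_le _ _ _)
    _ = (∫⁻ x in cube a l, ENNReal.ofReal |b' x - c|) +
          ENNReal.ofReal |(⨍ y in cube a l, b' y) - c| * volume (cube a l) := by
        rw [lintegral_add_left hmeas, setLIntegral_const]
    _ ≤ (∫⁻ x in cube a l, ENNReal.ofReal |b' x - c|) +
          ∫⁻ x in cube a l, ENNReal.ofReal |b' x - c| := by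
        refine add_le_add_right ?_ _
        refine (mul_le_mul_left (ofReal_abs_setAverage_sub_le hv0 hv1 hint c) _).trans ?_
        rw [ENNReal.div_mul_cancel hv0 hv1]
    _ = _ := (two_mul _).symm

end Euclidean

theorem theorem1p3 {𝕜 : Type*} [RCLike 𝕜] (n m : ℕ) (α p q : ℝ)
    (hα : 0 < α) (hαn : α < n) (hp : 1 < p) (hpn : p < n / α)
    (hq : 1 / q + α / n = 1 / p) (hm : 1 ≤ m) :
    -- sufficiency, with the quantitative bound
    (∃ c : ℝ≥0, ∀ μ lam b : Rn n → ℝ, MemApq p q μ → MemApq p q lam →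
      MemBMO (bloomWeight m μ lam) b →
      -- the commutator is well defined: `b` is in `L^m_loc`, the integrals converge a.e.
      MemLocPow m b ∧
      ∀ f : Rn n → 𝕜, MemLp f (ENNReal.ofReal p) (powMeasure μ p) →
        (∀ᵐ x ∂(volume : Measure (Rn n)), ∀ k ≤ m,
          Integrable (rieszIntegrand α (fun y => b y ^ k • f y) x) volume) ∧
        MemLp (iterCommutator b (rieszPotential α) m f) (ENNReal.ofReal q) (powMeasure lam q) ∧
        eLpNorm (iterCommutator b (rieszPotential α) m f) (ENNReal.ofReal q) (powMeasure lam q) ≤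
          c * bmoNorm (bloomWeight m μ lam) b ^ m * kappa α p q m μ lam *
            eLpNorm f (ENNReal.ofReal p) (powMeasure μ p)) ∧
    -- necessity, from the restricted strong type bound
    (∀ μ lam b : Rn n → ℝ, MemApq p q μ → MemApq p q lam → MemLocPow m b →
      (∃ c : ℝ≥0, ∀ E : Set (Rn n), MeasurableSet E → volume E < ∞ →
        eLpNorm (iterCommutator b (rieszPotential α) m (E.indicator fun _ => (1 : 𝕜)))
            (ENNReal.ofReal q) (powMeasure lam q) ≤
          c * powMeasure μ p E ^ (1 / p)) →
      MemBMO (bloomWeight m μ lam) b) := by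
  have hn : (0 : ℝ) < n := hα.trans hαn
  have hq0 : 0 < q := by
    have h1 : α / n < 1 / p := by
      rw [lt_div_iff₀ hα] at hpn
      rw [div_lt_div_iff₀ hn (by linarith)]
      linarith
    exact one_div_pos.1 (by linarith)
  exact ⟨bloom_sufficiency hm hα hαn hp hq0 hq, fun μ lam b hμ hlam hb ⟨_, hC⟩ =>
    memBMO_of_restricted_strong_type hm hα hαn hp hq0 hq hμ hlam hb hC⟩
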